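/- Let $\mathcal M$ be a monoidal bicategory with unit object $I$ and constraint equivalences $a:(X\otimes Y)\otimes Z\to X\otimes(Y\otimes Z)$, $\ell:I\otimes X\to X$, $r:X\to X\otimes I$ (formulas below are written as in a Gray monoid, suppressing these and the other constraints; in general they are inserted). Composition is written from right to left. A **left skew monoidale** in $\mathcal M$ is an object $A$ with morphisms $p:A\otimes A\to A$, $j:I\to A$ and (not necessarily invertible) 2-cells $$\alpha:p(p\otimes1)\Rightarrow p(1\otimes p),\qquad \lambda:p(j\otimes1)\Rightarrow 1_A,\qquad \rho:1_A\Rightarrow p(1\otimes j)$$ satisfying the five axioms: the pentagon for $\alpha$; $p(1\otimes\lambda)\cdot\alpha(1\otimes j\otimes1)\cdot p(\rho\otimes1)=1_p$; $p(\lambda\otimes1)=\lambda p\cdot\alpha(j\otimes1\otimes1)$; $p(1\otimes\rho)=\alpha(1\otimes1\otimes j)\cdot\rho p$; $\lambda j\cdot\rho j=1_j$ (up to the canonical interchange isomorphisms). It is **right normal** if $\rho$ is invertible. An **opmonoidal monad** on $A$ is a monad $(t:A\to A,\ \eta,\ \mu)$ in $\mathcal M$ with 2-cells $\psi:tp\Rightarrow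 p(t\otimes t)$ and $\psi_0:tj\Rightarrow j$ making $t$ an opmonoidal morphism (coassociativity with respect to $\alpha$ and the two counit conditions with respect to $\lambda,\rho$) and such that $\eta:1_A\Rightarrow t$ and $\mu:tt\Rightarrow t$ are opmonoidal 2-cells. A **skew left warping** on $A$ consists of morphisms $t:A\to A$, $k:I\to A$ and 2-cells $$v:tp(t\otimes1)\Rightarrow p(t\otimes t),\qquad v_0:tk\Rightarrow j,\qquad \kappa:1_A\Rightarrow p(t\otimes k)$$ satisfying five axioms, written here in element style (with $\otimes$ for $p$, $J$ for $j$, $T$ for $t$, $K$ for $k$): 1. $(1\otimes v_{Y,Z})\,v_{X,TY\otimes Z}\,T\alpha_{TX,TY,Z}\,T(v_{X,Y}\otimes1)=\alpha_{TX,TY,TZ}\,(v_{X,Y}\otimes1)\,v_{TX\otimes Y,Z}$; 2. $\lambda_{TY}\,(v_0\otimes1)\,v_{K,Y}=T\lambda_Y\,T(v_0\otimes1)$; 3. $(1\otimes v_0)\,v_{X,K}\,T\kappa_X=\rho_{TX}$; 4. $\alpha_{TX,TY,K}\,(v_{X,Y}\otimes1)\,\kappa_{TX\otimes Y}=1_{TX}\otimes\kappa_Y$;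 5. $\lambda_K\,(v_0\otimes1)\,\kappa_K=1_K$. **Proposition.** Let $A$ be a right normal left skew monoidale in $\mathcal M$. Then there is a bijection between opmonoidal monads on $A$ and skew left warpings on $A$ for which $k=j$. It sends $(t,\eta,\mu,\psi,\psi_0)$ to the skew left warping $(t,j,v,v_0,\kappa)$ with $$v=\bigl(tp(t\otimes1)\xRightarrow{\psi(t\otimes1)}p(t\otimes t)(t\otimes1)\cong p(tt\otimes t)\xRightarrow{p(\mu\otimes1)}p(t\otimes t)\bigr),\quad v_0=\psi_0,\quad \kappa=\bigl(1_A\xRightarrow{\eta}t\xRightarrow{\rho t}p(1\otimes j)t\cong p(t\otimes j)\bigr).$$ -/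

import Mathlib

open CategoryTheory Bicategory

universe w v u w₁ v₁ u₁ w₂ v₂ u₂ w₃ v₃ u₃ w₄ v₄ u₄

/-! Composition of 1-cells is written in diagrammatic order. The operation `⊗≫` is vertical
composition of 2-cells up to the associators and unitors of the ambient bicategory; the constraints
of the tensor product are always written out. Formulas in comments are in element style or are
written as in a Gray monoid, with composition from right to left. -/

namespace SkewWarp

/-! ### Products of pseudofunctors and equivalences -/

section Preliminaries

/-- The product `F × G : B × C ⥤ B' × C'` of two pseudofunctors. -/
@[simps!]
def prodMap {B : Type u₁} [Bicategory.{w₁, v₁} B] {B' : Type u₂} [Bicategory.{w₂, v₂} B']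
    {C : Type u₃} [Bicategory.{w₃, v₃} C] {C' : Type u₄} [Bicategory.{w₄, v₄} C']
    (F : B ⥤ᵖ B') (G : C ⥤ᵖ C') : (B × C) ⥤ᵖ (B' × C') where
  obj X := (F.obj X.1, G.obj X.2)
  map f := (F.map f.1, G.map f.2)
  map₂ η := (F.map₂ η.1, G.map₂ η.2)
  mapId X := Iso.prod (F.mapId X.1) (G.mapId X.2)
  mapComp f g := Iso.prod (F.mapComp f.1 g.1) (G.mapComp f.2 g.2)

/-- The rebracketing `(B × C) × D ⥤ B × (C × D)`. -/
@[simps!]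
def prodAssoc (B : Type u₁) [Bicategory.{w₁, v₁} B] (C : Type u₂) [Bicategory.{w₂, v₂} C]
    (D : Type u₃) [Bicategory.{w₃, v₃} D] : ((B × C) × D) ⥤ᵖ (B × (C × D)) where
  obj X := (X.1.1, (X.1.2, X.2))
  map f := (f.1.1, (f.1.2, f.2))
  map₂ η := (η.1.1, (η.1.2, η.2))
  mapId X := Iso.refl _
  mapComp f g := Iso.refl _

/-- A 1-cell of a bicategory is an equivalence if it is invertible up to invertible 2-cells. -/
def IsEquiv {B : Type u} [Bicategory.{w, v} B] {X Y : B} (f : X ⟶ Y) : Prop :=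
  ∃ g : Y ⟶ X, Nonempty (f ≫ g ≅ 𝟙 X) ∧ Nonempty (g ≫ f ≅ 𝟙 Y)

/-- Right cancellation of an equivalence `e`: the unique invertible 2-cell `χ : f ≅ g` such that
`χ ▷ e` is the given 2-cell. -/
noncomputable def cancelRight {B : Type u} [Bicategory.{w, v} B] {W X Y : B} {e : X ⟶ Y}
    (he : IsEquiv e) {f g : W ⟶ X} (φ : f ≫ e ≅ g ≫ e) : f ≅ g :=
  let η : e ≫ he.choose ≅ 𝟙 X := he.choose_spec.1.some
  (ρ_ f).symm ≪≫ whiskerLeftIso f η.symm ≪≫ (α_ f e _).symm ≪≫ whiskerRightIso φ _ ≪≫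
    α_ g e _ ≪≫ whiskerLeftIso g η ≪≫ ρ_ g

end Preliminaries

/-! ### Monoidal bicategories -/

/-- The first layer of the structure of a monoidal bicategory: a tensor product pseudofunctor, a
unit object, and pseudonatural equivalences `a : (X ⊗ Y) ⊗ Z ⟶ X ⊗ (Y ⊗ Z)`, `ℓ : I ⊗ X ⟶ X` and
`r : X ⟶ X ⊗ I`. -/
class TensorBicategory (M : Type u) [Bicategory.{w, v} M] where
  tensor : (M × M) ⥤ᵖ M
  unit : M
  assoc : Pseudofunctor.StrongTrans
    ((prodMap tensor (Pseudofunctor.id M)).comp tensor)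
    ((prodAssoc M M M).comp ((prodMap (Pseudofunctor.id M) tensor).comp tensor))
  leftUnit : Pseudofunctor.StrongTrans
    ((Prod.sectR unit M).toPseudofunctor.comp tensor) (Pseudofunctor.id M)
  rightUnit : Pseudofunctor.StrongTrans
    (Pseudofunctor.id M) ((Prod.sectL M unit).toPseudofunctor.comp tensor)
  assoc_isEquiv (X : (M × M) × M) : IsEquiv (assoc.app X)
  leftUnit_isEquiv (X : M) : IsEquiv (leftUnit.app X)
  rightUnit_isEquiv (X : M) : IsEquiv (rightUnit.app X)

section Tensor

variable {M : Type u} [Bicategory.{w, v} M] [TensorBicategory M]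

/-- The tensor product of objects. -/
abbrev tensorObj (X Y : M) : M := TensorBicategory.tensor.obj (X, Y)

infixr:85 " ⊠ " => tensorObj

/-- The tensor product of 1-cells. -/
abbrev tensorHom {X X' Y Y' : M} (f : X ⟶ X') (g : Y ⟶ Y') : X ⊠ Y ⟶ X' ⊠ Y' :=
  TensorBicategory.tensor.map (X := (X, Y)) (Y := (X', Y')) (f, g)

infixr:85 " ⊠₁ " => tensorHom

/-- The tensor product of 2-cells. -/
abbrev tensorHom₂ {X X' Y Y' : M} {f f' : X ⟶ X'} {g g' : Y ⟶ Y'} (σ : f ⟶ f') (τ : g ⟶ g') :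
    f ⊠₁ g ⟶ f' ⊠₁ g' :=
  TensorBicategory.tensor.map₂ (a := (X, Y)) (b := (X', Y')) (f := (f, g)) (g := (f', g')) (σ, τ)

infixr:85 " ⊠₂ " => tensorHom₂

/-- The 1-cell `1 ⊗ g`. -/
abbrev tensorLeft (X : M) {Y Y' : M} (g : Y ⟶ Y') : X ⊠ Y ⟶ X ⊠ Y' := 𝟙 X ⊠₁ g

infixr:85 " ◁ₜ " => tensorLeft

/-- The 1-cell `f ⊗ 1`. -/
abbrev tensorRight {X X' : M} (f : X ⟶ X') (Y : M) : X ⊠ Y ⟶ X' ⊠ Y := f ⊠₁ 𝟙 Y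

infixl:85 " ▷ₜ " => tensorRight

/-- The 2-cell `1 ⊗ τ`. -/
abbrev tensorLeft₂ (X : M) {Y Y' : M} {g g' : Y ⟶ Y'} (τ : g ⟶ g') : X ◁ₜ g ⟶ X ◁ₜ g' :=
  𝟙 (𝟙 X) ⊠₂ τ

/-- The 2-cell `σ ⊗ 1`. -/
abbrev tensorRight₂ {X X' : M} {f f' : X ⟶ X'} (σ : f ⟶ f') (Y : M) : f ▷ₜ Y ⟶ f' ▷ₜ Y :=
  σ ⊠₂ 𝟙 (𝟙 Y)

/-- The tensor product of invertible 2-cells. -/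
def tensorIso {X X' Y Y' : M} {f f' : X ⟶ X'} {g g' : Y ⟶ Y'} (σ : f ≅ f') (τ : g ≅ g') :
    f ⊠₁ g ≅ f' ⊠₁ g' :=
  TensorBicategory.tensor.map₂Iso (a := (X, Y)) (b := (X', Y')) (f := (f, g)) (g := (f', g'))
    (Iso.prod σ τ)

/-- Functoriality of the tensor product on identities. -/
def tensorId (X Y : M) : 𝟙 X ⊠₁ 𝟙 Y ≅ 𝟙 (X ⊠ Y) :=
  TensorBicategory.tensor.mapId (X, Y)

/-- Functoriality of the tensor product on composites. -/
def tensorComp {X X' X'' Y Y' Y'' : M} (f : X ⟶ X') (f' : X' ⟶ X'') (g : Y ⟶ Y') (g' : Y' ⟶ Y'') :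
    (f ≫ f') ⊠₁ (g ≫ g') ≅ f ⊠₁ g ≫ f' ⊠₁ g' :=
  TensorBicategory.tensor.mapComp (a := (X, Y)) (b := (X', Y')) (c := (X'', Y'')) (f, g) (f', g')

/-- `(f ⊗ 1) (g ⊗ h) ≅ (f g) ⊗ h`, in diagrammatic order, like the next three. -/
def rightMerge {X X' X'' Y Y' : M} (f : X ⟶ X') (g : X' ⟶ X'') (h : Y ⟶ Y') :
    f ▷ₜ Y ≫ g ⊠₁ h ≅ (f ≫ g) ⊠₁ h :=
  (tensorComp f g (𝟙 Y) h).symm ≪≫ tensorIso (Iso.refl _) (λ_ h)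

/-- `(f ⊗ h) (g ⊗ 1) ≅ (f g) ⊗ h`. -/
def mergeRight {X X' X'' Y Y' : M} (f : X ⟶ X') (g : X' ⟶ X'') (h : Y ⟶ Y') :
    f ⊠₁ h ≫ g ▷ₜ Y' ≅ (f ≫ g) ⊠₁ h :=
  (tensorComp f g h (𝟙 Y')).symm ≪≫ tensorIso (Iso.refl _) (ρ_ h)

/-- `(1 ⊗ g) (f ⊗ h) ≅ f ⊗ (g h)`. -/
def leftMerge {X X' Y Y' Y'' : M} (f : X ⟶ X') (g : Y ⟶ Y') (h : Y' ⟶ Y'') :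
    X ◁ₜ g ≫ f ⊠₁ h ≅ f ⊠₁ (g ≫ h) :=
  (tensorComp (𝟙 X) f g h).symm ≪≫ tensorIso (λ_ f) (Iso.refl _)

/-- `(f ⊗ g) (1 ⊗ h) ≅ f ⊗ (g h)`. -/
def mergeLeft {X X' Y Y' Y'' : M} (f : X ⟶ X') (g : Y ⟶ Y') (h : Y' ⟶ Y'') :
    f ⊠₁ g ≫ X' ◁ₜ h ≅ f ⊠₁ (g ≫ h) :=
  (tensorComp f (𝟙 X') g h).symm ≪≫ tensorIso (ρ_ f) (Iso.refl _)

/-- `f ⊗ g ≅ (f ⊗ 1) (1 ⊗ g)`. -/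
def splitRL {X X' Y Y' : M} (f : X ⟶ X') (g : Y ⟶ Y') : f ⊠₁ g ≅ f ▷ₜ Y ≫ X' ◁ₜ g :=
  tensorIso (ρ_ f).symm (λ_ g).symm ≪≫ tensorComp f (𝟙 X') (𝟙 Y) g

/-- `f ⊗ g ≅ (1 ⊗ g) (f ⊗ 1)`. -/
def splitLR {X X' Y Y' : M} (f : X ⟶ X') (g : Y ⟶ Y') : f ⊠₁ g ≅ X ◁ₜ g ≫ f ▷ₜ Y' :=
  tensorIso (λ_ f).symm (ρ_ g).symm ≪≫ tensorComp (𝟙 X) f g (𝟙 Y')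

/-- The interchange isomorphism `(f ⊗ 1) (1 ⊗ g) ≅ (1 ⊗ g) (f ⊗ 1)`. -/
def interchange {X X' Y Y' : M} (f : X ⟶ X') (g : Y ⟶ Y') :
    f ▷ₜ Y ≫ X' ◁ₜ g ≅ X ◁ₜ g ≫ f ▷ₜ Y' :=
  (splitRL f g).symm ≪≫ splitLR f g

/-- `(X ⊗ Y) ⊗ Z ⟶ X ⊗ (Y ⊗ Z)`. -/
def aHom (X Y Z : M) : (X ⊠ Y) ⊠ Z ⟶ X ⊠ (Y ⊠ Z) := TensorBicategory.assoc.app ((X, Y), Z)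

/-- `I ⊗ X ⟶ X`. -/
def lHom (X : M) : TensorBicategory.unit ⊠ X ⟶ X := TensorBicategory.leftUnit.app X

/-- `X ⟶ X ⊗ I`. -/
def rHom (X : M) : X ⟶ X ⊠ TensorBicategory.unit := TensorBicategory.rightUnit.app X

/-- Pseudonaturality of `a`. -/
def aNat {X X' Y Y' Z Z' : M} (f : X ⟶ X') (g : Y ⟶ Y') (h : Z ⟶ Z') :
    (f ⊠₁ g) ⊠₁ h ≫ aHom X' Y' Z' ≅ aHom X Y Z ≫ f ⊠₁ (g ⊠₁ h) :=
  TensorBicategory.assoc.naturality (a := ((X, Y), Z)) (b := ((X', Y'), Z')) ((f, g), h)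

/-- Pseudonaturality of `ℓ`. -/
def lNat {X X' : M} (f : X ⟶ X') :
    TensorBicategory.unit ◁ₜ f ≫ lHom X' ≅ lHom X ≫ f :=
  TensorBicategory.leftUnit.naturality f

/-- Pseudonaturality of `r`. -/
def rNat {X X' : M} (f : X ⟶ X') :
    f ≫ rHom X' ≅ rHom X ≫ f ▷ₜ TensorBicategory.unit :=
  TensorBicategory.rightUnit.naturality f

/-- Pseudonaturality of `a` in the first variable only. -/
def aNatRight {X X' : M} (f : X ⟶ X') (Y Z : M) :
    (f ▷ₜ Y) ▷ₜ Z ≫ aHom X' Y Z ≅ aHom X Y Z ≫ f ▷ₜ (Y ⊠ Z) :=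
  aNat f (𝟙 Y) (𝟙 Z) ≪≫ whiskerLeftIso _ (tensorIso (Iso.refl f) (tensorId Y Z))

/-- Pseudonaturality of `a` in the last variable only. -/
def aNatLeft (X Y : M) {Z Z' : M} (h : Z ⟶ Z') :
    (X ⊠ Y) ◁ₜ h ≫ aHom X Y Z' ≅ aHom X Y Z ≫ X ◁ₜ (Y ◁ₜ h) :=
  whiskerRightIso (tensorIso (tensorId X Y).symm (Iso.refl h)) _ ≪≫ aNat (𝟙 X) (𝟙 Y) h

end Tensor

/-- A monoidal bicategory: a tensor product with pseudonatural equivalences `a`, `ℓ`, `r` as above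
and invertible modifications `pent`, `mid`, `left`, `right`, subject to the nonabelian 4-cocycle
condition and the two normalization conditions of a (one-object) tricategory. -/
class MonoidalBicategory (M : Type u) [Bicategory.{w, v} M] extends TensorBicategory M where
  -- The modifications, for the pentagon and for the middle, left and right unit triangles.
  pent (X Y Z W : M) :
    aHom X Y Z ▷ₜ W ≫ aHom X (Y ⊠ Z) W ≫ X ◁ₜ aHom Y Z W ≅ aHom (X ⊠ Y) Z W ≫ aHom X Y (Z ⊠ W)
  mid (X Y : M) : rHom X ▷ₜ Y ≫ aHom X unit Y ≫ X ◁ₜ lHom Y ≅ 𝟙 (X ⊠ Y)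
  left (X Y : M) : aHom unit X Y ≫ lHom (X ⊠ Y) ≅ lHom X ▷ₜ Y
  right (X Y : M) : rHom (X ⊠ Y) ≫ aHom X Y unit ≅ X ◁ₜ rHom Y
  -- The modification axioms.
  pent_natural {X X' Y Y' Z Z' W W' : M} (f : X ⟶ X') (g : Y ⟶ Y') (h : Z ⟶ Z') (k : W ⟶ W') :
    ((f ⊠₁ g) ⊠₁ h) ⊠₁ k ◁ (pent X' Y' Z' W').hom ⊗≫
        (aNat (f ⊠₁ g) h k).hom ▷ aHom X' Y' (Z' ⊠ W') ⊗≫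
        aHom (X ⊠ Y) Z W ◁ (aNat f g (h ⊠₁ k)).hom =
      𝟙 (((f ⊠₁ g) ⊠₁ h) ⊠₁ k ≫ aHom X' Y' Z' ▷ₜ W' ≫ aHom X' (Y' ⊠ Z') W' ≫
          X' ◁ₜ aHom Y' Z' W') ⊗≫
        (mergeRight ((f ⊠₁ g) ⊠₁ h) (aHom X' Y' Z') k).hom ▷
          (aHom X' (Y' ⊠ Z') W' ≫ X' ◁ₜ aHom Y' Z' W') ⊗≫
        ((aNat f g h).hom ⊠₂ 𝟙 k) ▷ (aHom X' (Y' ⊠ Z') W' ≫ X' ◁ₜ aHom Y' Z' W') ⊗≫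
        (rightMerge (aHom X Y Z) (f ⊠₁ (g ⊠₁ h)) k).inv ▷
          (aHom X' (Y' ⊠ Z') W' ≫ X' ◁ₜ aHom Y' Z' W') ⊗≫
        aHom X Y Z ▷ₜ W ◁ (aNat f (g ⊠₁ h) k).hom ▷ (X' ◁ₜ aHom Y' Z' W') ⊗≫
        (aHom X Y Z ▷ₜ W ≫ aHom X (Y ⊠ Z) W) ◁
          (mergeLeft f ((g ⊠₁ h) ⊠₁ k) (aHom Y' Z' W')).hom ⊗≫
        (aHom X Y Z ▷ₜ W ≫ aHom X (Y ⊠ Z) W) ◁ (𝟙 f ⊠₂ (aNat g h k).hom) ⊗≫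
        (aHom X Y Z ▷ₜ W ≫ aHom X (Y ⊠ Z) W) ◁
          (leftMerge f (aHom Y Z W) (g ⊠₁ (h ⊠₁ k))).inv ⊗≫
        (pent X Y Z W).hom ▷ f ⊠₁ (g ⊠₁ (h ⊠₁ k)) ⊗≫
        𝟙 (aHom (X ⊠ Y) Z W ≫ aHom X Y (Z ⊠ W) ≫ f ⊠₁ (g ⊠₁ (h ⊠₁ k)))
  mid_natural {X X' Y Y' : M} (f : X ⟶ X') (g : Y ⟶ Y') :
    f ⊠₁ g ◁ (mid X' Y').hom ⊗≫ 𝟙 (f ⊠₁ g) =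
      𝟙 (f ⊠₁ g ≫ rHom X' ▷ₜ Y' ≫ aHom X' unit Y' ≫ X' ◁ₜ lHom Y') ⊗≫
        (mergeRight f (rHom X') g).hom ▷ (aHom X' unit Y' ≫ X' ◁ₜ lHom Y') ⊗≫
        ((rNat f).hom ⊠₂ 𝟙 g) ▷ (aHom X' unit Y' ≫ X' ◁ₜ lHom Y') ⊗≫
        (rightMerge (rHom X) (f ▷ₜ unit) g).inv ▷ (aHom X' unit Y' ≫ X' ◁ₜ lHom Y') ⊗≫
        rHom X ▷ₜ Y ◁ (aNat f (𝟙 unit) g).hom ▷ X' ◁ₜ lHom Y' ⊗≫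
        (rHom X ▷ₜ Y ≫ aHom X unit Y) ◁ (mergeLeft f (unit ◁ₜ g) (lHom Y')).hom ⊗≫
        (rHom X ▷ₜ Y ≫ aHom X unit Y) ◁ (𝟙 f ⊠₂ (lNat g).hom) ⊗≫
        (rHom X ▷ₜ Y ≫ aHom X unit Y) ◁ (leftMerge f (lHom Y) g).inv ⊗≫
        (mid X Y).hom ▷ f ⊠₁ g ⊗≫ 𝟙 (f ⊠₁ g)
  left_natural {X X' Y Y' : M} (f : X ⟶ X') (g : Y ⟶ Y') :
    (unit ◁ₜ f) ⊠₁ g ◁ (left X' Y').hom ⊗≫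
        (mergeRight (unit ◁ₜ f) (lHom X') g).hom ⊗≫ ((lNat f).hom ⊠₂ 𝟙 g) =
      𝟙 ((unit ◁ₜ f) ⊠₁ g ≫ aHom unit X' Y' ≫ lHom (X' ⊠ Y')) ⊗≫
        (aNat (𝟙 unit) f g).hom ▷ lHom (X' ⊠ Y') ⊗≫
        aHom unit X Y ◁ (lNat (f ⊠₁ g)).hom ⊗≫
        (left X Y).hom ▷ f ⊠₁ g ⊗≫ (rightMerge (lHom X) f g).hom
  right_natural {X X' Y Y' : M} (f : X ⟶ X') (g : Y ⟶ Y') :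
    f ⊠₁ g ◁ (right X' Y').hom ⊗≫
        (mergeLeft f g (rHom Y')).hom ⊗≫ (𝟙 f ⊠₂ (rNat g).hom) =
      𝟙 (f ⊠₁ g ≫ rHom (X' ⊠ Y') ≫ aHom X' Y' unit) ⊗≫
        (rNat (f ⊠₁ g)).hom ▷ aHom X' Y' unit ⊗≫
        rHom (X ⊠ Y) ◁ (aNat f g (𝟙 unit)).hom ⊗≫
        (right X Y).hom ▷ f ⊠₁ (g ▷ₜ unit) ⊗≫ (leftMerge f (rHom Y) (g ▷ₜ unit)).hom
  -- The nonabelian 4-cocycle condition.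
  cocycle (X Y Z W V : M) :
    𝟙 ((aHom X Y Z ▷ₜ W) ▷ₜ V ≫ aHom X (Y ⊠ Z) W ▷ₜ V ≫ (X ◁ₜ aHom Y Z W) ▷ₜ V ≫
          aHom X (Y ⊠ Z ⊠ W) V ≫ X ◁ₜ aHom Y (Z ⊠ W) V ≫ X ◁ₜ Y ◁ₜ aHom Z W V) ⊗≫
        (mergeRight (aHom X Y Z ▷ₜ W) (aHom X (Y ⊠ Z) W) (𝟙 V)).hom ▷
          ((X ◁ₜ aHom Y Z W) ▷ₜ V ≫ aHom X (Y ⊠ Z ⊠ W) V ≫ X ◁ₜ aHom Y (Z ⊠ W) V ≫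
            X ◁ₜ Y ◁ₜ aHom Z W V) ⊗≫
        (mergeRight (aHom X Y Z ▷ₜ W ≫ aHom X (Y ⊠ Z) W) (X ◁ₜ aHom Y Z W) (𝟙 V)).hom ▷
          (aHom X (Y ⊠ Z ⊠ W) V ≫ X ◁ₜ aHom Y (Z ⊠ W) V ≫ X ◁ₜ Y ◁ₜ aHom Z W V) ⊗≫
        tensorRight₂ ((α_ _ _ _).hom ≫ (pent X Y Z W).hom) V ▷
          (aHom X (Y ⊠ Z ⊠ W) V ≫ X ◁ₜ aHom Y (Z ⊠ W) V ≫ X ◁ₜ Y ◁ₜ aHom Z W V) ⊗≫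
        (rightMerge (aHom (X ⊠ Y) Z W) (aHom X Y (Z ⊠ W)) (𝟙 V)).inv ▷
          (aHom X (Y ⊠ Z ⊠ W) V ≫ X ◁ₜ aHom Y (Z ⊠ W) V ≫ X ◁ₜ Y ◁ₜ aHom Z W V) ⊗≫
        aHom (X ⊠ Y) Z W ▷ₜ V ◁ (pent X Y (Z ⊠ W) V).hom ▷ X ◁ₜ Y ◁ₜ aHom Z W V ⊗≫
        (aHom (X ⊠ Y) Z W ▷ₜ V ≫ aHom (X ⊠ Y) (Z ⊠ W) V) ◁ (aNatLeft X Y (aHom Z W V)).inv ⊗≫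
        (pent (X ⊠ Y) Z W V).hom ▷ aHom X Y (Z ⊠ W ⊠ V) ⊗≫
        𝟙 (aHom ((X ⊠ Y) ⊠ Z) W V ≫ aHom (X ⊠ Y) Z (W ⊠ V) ≫ aHom X Y (Z ⊠ W ⊠ V)) =
      𝟙 ((aHom X Y Z ▷ₜ W) ▷ₜ V ≫ aHom X (Y ⊠ Z) W ▷ₜ V ≫ (X ◁ₜ aHom Y Z W) ▷ₜ V ≫
          aHom X (Y ⊠ Z ⊠ W) V ≫ X ◁ₜ aHom Y (Z ⊠ W) V ≫ X ◁ₜ Y ◁ₜ aHom Z W V) ⊗≫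
        ((aHom X Y Z ▷ₜ W) ▷ₜ V ≫ aHom X (Y ⊠ Z) W ▷ₜ V) ◁
          (aNat (𝟙 X) (aHom Y Z W) (𝟙 V)).hom ▷
          (X ◁ₜ aHom Y (Z ⊠ W) V ≫ X ◁ₜ Y ◁ₜ aHom Z W V) ⊗≫
        ((aHom X Y Z ▷ₜ W) ▷ₜ V ≫ aHom X (Y ⊠ Z) W ▷ₜ V ≫ aHom X ((Y ⊠ Z) ⊠ W) V) ◁
          (X ◁ₜ (aHom Y Z W ▷ₜ V) ◁
              (mergeLeft (𝟙 X) (aHom Y (Z ⊠ W) V) (Y ◁ₜ aHom Z W V)).hom ⊗≫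
            (mergeLeft (𝟙 X) (aHom Y Z W ▷ₜ V) (aHom Y (Z ⊠ W) V ≫ Y ◁ₜ aHom Z W V)).hom ⊗≫
            tensorLeft₂ X (pent Y Z W V).hom ⊗≫
            (leftMerge (𝟙 X) (aHom (Y ⊠ Z) W V) (aHom Y Z (W ⊠ V))).inv) ⊗≫
        (aHom X Y Z ▷ₜ W) ▷ₜ V ◁ (pent X (Y ⊠ Z) W V).hom ▷ X ◁ₜ aHom Y Z (W ⊠ V) ⊗≫
        (aNatRight (aHom X Y Z) W V).hom ▷ (aHom X (Y ⊠ Z) (W ⊠ V) ≫ X ◁ₜ aHom Y Z (W ⊠ V)) ⊗≫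
        aHom ((X ⊠ Y) ⊠ Z) W V ◁ (pent X Y Z (W ⊠ V)).hom
  -- The two normalization conditions.
  left_normalization (X Y Z : M) :
    𝟙 ((rHom X ▷ₜ Y) ▷ₜ Z ≫ aHom X unit Y ▷ₜ Z ≫ aHom X (unit ⊠ Y) Z ≫ X ◁ₜ aHom unit Y Z ≫
          X ◁ₜ lHom (Y ⊠ Z)) ⊗≫
        (rHom X ▷ₜ Y) ▷ₜ Z ◁ (pent X unit Y Z).hom ▷ X ◁ₜ lHom (Y ⊠ Z) ⊗≫
        (aNatRight (rHom X) Y Z).hom ▷ (aHom X unit (Y ⊠ Z) ≫ X ◁ₜ lHom (Y ⊠ Z)) ⊗≫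
        aHom X Y Z ◁ (mid X (Y ⊠ Z)).hom ⊗≫ 𝟙 (aHom X Y Z) =
      𝟙 ((rHom X ▷ₜ Y) ▷ₜ Z ≫ aHom X unit Y ▷ₜ Z ≫ aHom X (unit ⊠ Y) Z ≫ X ◁ₜ aHom unit Y Z ≫
          X ◁ₜ lHom (Y ⊠ Z)) ⊗≫
        ((rHom X ▷ₜ Y) ▷ₜ Z ≫ aHom X unit Y ▷ₜ Z ≫ aHom X (unit ⊠ Y) Z) ◁
          ((mergeLeft (𝟙 X) (aHom unit Y Z) (lHom (Y ⊠ Z))).hom ≫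
            tensorLeft₂ X (left Y Z).hom) ⊗≫
        ((rHom X ▷ₜ Y) ▷ₜ Z ≫ aHom X unit Y ▷ₜ Z) ◁ (aNat (𝟙 X) (lHom Y) (𝟙 Z)).inv ⊗≫
        ((rHom X ▷ₜ Y) ▷ₜ Z ◁ (mergeRight (aHom X unit Y) (X ◁ₜ lHom Y) (𝟙 Z)).hom ≫
            (mergeRight (rHom X ▷ₜ Y) (aHom X unit Y ≫ X ◁ₜ lHom Y) (𝟙 Z)).hom ≫
            tensorRight₂ (mid X Y).hom Z ≫ (tensorId (X ⊠ Y) Z).hom) ▷ aHom X Y Z ⊗≫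
        𝟙 (aHom X Y Z)
  right_normalization (X Y Z : M) :
    𝟙 (rHom (X ⊠ Y) ▷ₜ Z ≫ aHom X Y unit ▷ₜ Z ≫ aHom X (Y ⊠ unit) Z ≫ X ◁ₜ aHom Y unit Z ≫
          X ◁ₜ Y ◁ₜ lHom Z) ⊗≫
        rHom (X ⊠ Y) ▷ₜ Z ◁ (pent X Y unit Z).hom ▷ X ◁ₜ Y ◁ₜ lHom Z ⊗≫
        (rHom (X ⊠ Y) ▷ₜ Z ≫ aHom (X ⊠ Y) unit Z) ◁ (aNatLeft X Y (lHom Z)).inv ⊗≫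
        (mid (X ⊠ Y) Z).hom ▷ aHom X Y Z ⊗≫ 𝟙 (aHom X Y Z) =
      𝟙 (rHom (X ⊠ Y) ▷ₜ Z ≫ aHom X Y unit ▷ₜ Z ≫ aHom X (Y ⊠ unit) Z ≫ X ◁ₜ aHom Y unit Z ≫
          X ◁ₜ Y ◁ₜ lHom Z) ⊗≫
        ((mergeRight (rHom (X ⊠ Y)) (aHom X Y unit) (𝟙 Z)).hom ≫
            tensorRight₂ (right X Y).hom Z) ▷
          (aHom X (Y ⊠ unit) Z ≫ X ◁ₜ aHom Y unit Z ≫ X ◁ₜ Y ◁ₜ lHom Z) ⊗≫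
        (aNat (𝟙 X) (rHom Y) (𝟙 Z)).hom ▷ (X ◁ₜ aHom Y unit Z ≫ X ◁ₜ Y ◁ₜ lHom Z) ⊗≫
        aHom X Y Z ◁
          (X ◁ₜ (rHom Y ▷ₜ Z) ◁ (mergeLeft (𝟙 X) (aHom Y unit Z) (Y ◁ₜ lHom Z)).hom ≫
            (mergeLeft (𝟙 X) (rHom Y ▷ₜ Z) (aHom Y unit Z ≫ Y ◁ₜ lHom Z)).hom ≫
            tensorLeft₂ X (mid Y Z).hom ≫ (tensorId X (Y ⊠ Z)).hom) ⊗≫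
        𝟙 (aHom X Y Z)

section Monoidal

variable {M : Type u} [Bicategory.{w, v} M] [MonoidalBicategory M]

/-- The unit object of a monoidal bicategory. -/
abbrev unitObj (M : Type u) [Bicategory.{w, v} M] [MonoidalBicategory M] : M :=
  TensorBicategory.unit

/-- The canonical isomorphism `1 ⊗ ℓ_I ≅ ℓ_(I ⊗ I)`. -/
noncomputable def lHomUnitIso (M : Type u) [Bicategory.{w, v} M] [MonoidalBicategory M] :
    unitObj M ◁ₜ lHom (unitObj M) ≅ lHom (unitObj M ⊠ unitObj M) :=
  cancelRight (TensorBicategory.leftUnit_isEquiv (unitObj M)) (lNat (lHom (unitObj M)))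

/-- The canonical isomorphism `(r_I ℓ_I) ⊗ 1 ≅ 1 ⊗ 1` (composition in diagrammatic order). -/
noncomputable def rlUnitTensorIso (M : Type u) [Bicategory.{w, v} M] [MonoidalBicategory M] :
    (rHom (unitObj M) ≫ lHom (unitObj M)) ▷ₜ unitObj M ≅ 𝟙 (unitObj M) ▷ₜ unitObj M :=
  (rightMerge (rHom (unitObj M)) (lHom (unitObj M)) (𝟙 (unitObj M))).symm ≪≫
    whiskerLeftIso _ (MonoidalBicategory.left (unitObj M) (unitObj M)).symm ≪≫
    whiskerLeftIso _ (whiskerLeftIso _ (lHomUnitIso M).symm) ≪≫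
    MonoidalBicategory.mid (unitObj M) (unitObj M) ≪≫ (tensorId (unitObj M) (unitObj M)).symm

/-- The canonical isomorphism `r_I ℓ_I ≅ 1` (composition in diagrammatic order). -/
noncomputable def rlUnitIso (M : Type u) [Bicategory.{w, v} M] [MonoidalBicategory M] :
    rHom (unitObj M) ≫ lHom (unitObj M) ≅ 𝟙 (unitObj M) :=
  cancelRight (TensorBicategory.rightUnit_isEquiv (unitObj M))
    (rNat (rHom (unitObj M) ≫ lHom (unitObj M)) ≪≫ whiskerLeftIso _ (rlUnitTensorIso M) ≪≫
      (rNat (𝟙 (unitObj M))).symm)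

/-! ### Left skew monoidales -/

variable (M) in
/-- A left skew monoidale in a monoidal bicategory. The fields `α`, `lam`, `rho` are the
associativity, left unit and right unit constraints. -/
structure LeftSkewMonoidale where
  obj : M
  p : obj ⊠ obj ⟶ obj
  j : unitObj M ⟶ obj
  α : p ▷ₜ obj ≫ p ⟶ aHom obj obj obj ≫ obj ◁ₜ p ≫ p
  lam : j ▷ₜ obj ≫ p ⟶ lHom obj
  rho : 𝟙 obj ⟶ rHom obj ≫ obj ◁ₜ j ≫ p
  -- The pentagon, from `p(p⊗1)(p⊗1⊗1)` to `p(1⊗p)(1⊗1⊗p)`.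
  pentagon :
    𝟙 ((p ▷ₜ obj) ▷ₜ obj ≫ p ▷ₜ obj ≫ p) ⊗≫
        (rightMerge (p ▷ₜ obj) p (𝟙 obj)).hom ▷ p ⊗≫
        tensorRight₂ α obj ▷ p ⊗≫
        (rightMerge (aHom obj obj obj) (obj ◁ₜ p ≫ p) (𝟙 obj)).inv ▷ p ⊗≫
        aHom obj obj obj ▷ₜ obj ◁ (rightMerge (obj ◁ₜ p) p (𝟙 obj)).inv ▷ p ⊗≫
        (aHom obj obj obj ▷ₜ obj ≫ (obj ◁ₜ p) ▷ₜ obj) ◁ α ⊗≫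
        aHom obj obj obj ▷ₜ obj ◁ (aNat (𝟙 obj) p (𝟙 obj)).hom ▷ (obj ◁ₜ p ≫ p) ⊗≫
        (aHom obj obj obj ▷ₜ obj ≫ aHom obj (obj ⊠ obj) obj) ◁
          ((mergeLeft (𝟙 obj) (p ▷ₜ obj) p).hom ≫ tensorLeft₂ obj α ≫
            (leftMerge (𝟙 obj) (aHom obj obj obj) (obj ◁ₜ p ≫ p)).inv ≫
            obj ◁ₜ aHom obj obj obj ◁ (leftMerge (𝟙 obj) (obj ◁ₜ p) p).inv) ▷ p ⊗≫
        (MonoidalBicategory.pent obj obj obj obj).hom ▷ (obj ◁ₜ obj ◁ₜ p ≫ obj ◁ₜ p ≫ p) =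
      𝟙 ((p ▷ₜ obj) ▷ₜ obj ≫ p ▷ₜ obj ≫ p) ⊗≫
        (p ▷ₜ obj) ▷ₜ obj ◁ α ⊗≫
        (aNatRight p obj obj).hom ▷ (obj ◁ₜ p ≫ p) ⊗≫
        aHom (obj ⊠ obj) obj obj ◁ (interchange p p).hom ▷ p ⊗≫
        (aHom (obj ⊠ obj) obj obj ≫ (obj ⊠ obj) ◁ₜ p) ◁ α ⊗≫
        aHom (obj ⊠ obj) obj obj ◁ (aNatLeft obj obj p).hom ▷ (obj ◁ₜ p ≫ p) ⊗≫
        𝟙 ((aHom (obj ⊠ obj) obj obj ≫ aHom obj obj (obj ⊠ obj)) ≫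
          obj ◁ₜ obj ◁ₜ p ≫ obj ◁ₜ p ≫ p)
  -- `p → p(p⊗1)(1⊗j⊗1) → p(1⊗p)(1⊗j⊗1) → p`, given by `rho ⊗ 1`, `α`, `1 ⊗ lam`, is the identity.
  middle_unit :
    𝟙 p ⊗≫ (tensorId obj obj).inv ▷ p ⊗≫
        tensorRight₂ rho obj ▷ p ⊗≫
        (rightMerge (rHom obj) (obj ◁ₜ j ≫ p) (𝟙 obj)).inv ▷ p ⊗≫
        rHom obj ▷ₜ obj ◁ (rightMerge (obj ◁ₜ j) p (𝟙 obj)).inv ▷ p ⊗≫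
        (rHom obj ▷ₜ obj ≫ (obj ◁ₜ j) ▷ₜ obj) ◁ α ⊗≫
        rHom obj ▷ₜ obj ◁ (aNat (𝟙 obj) j (𝟙 obj)).hom ▷ (obj ◁ₜ p ≫ p) ⊗≫
        (rHom obj ▷ₜ obj ≫ aHom obj (unitObj M) obj) ◁
          ((mergeLeft (𝟙 obj) (j ▷ₜ obj) p).hom ≫ tensorLeft₂ obj lam) ▷ p ⊗≫
        (MonoidalBicategory.mid obj obj).hom ▷ p ⊗≫ 𝟙 p =
      𝟙 p
  -- `lam ⊗ 1 : p(p⊗1)(j⊗1⊗1) → p` against `p(p⊗1)(j⊗1⊗1) → p(1⊗p)(j⊗1⊗1) ≅ p(j⊗1)p → p`.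
  left_unit :
    ((rightMerge (j ▷ₜ obj) p (𝟙 obj)).hom ≫ tensorRight₂ lam obj) ▷ p =
      𝟙 (((j ▷ₜ obj) ▷ₜ obj ≫ p ▷ₜ obj) ≫ p) ⊗≫
        (j ▷ₜ obj) ▷ₜ obj ◁ α ⊗≫
        (aNatRight j obj obj).hom ▷ (obj ◁ₜ p ≫ p) ⊗≫
        aHom (unitObj M) obj obj ◁ (interchange j p).hom ▷ p ⊗≫
        (aHom (unitObj M) obj obj ≫ unitObj M ◁ₜ p) ◁ lam ⊗≫
        aHom (unitObj M) obj obj ◁ (lNat p).hom ⊗≫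
        (MonoidalBicategory.left obj obj).hom ▷ p
  -- `1 ⊗ rho : p → p(1⊗p)(1⊗1⊗j)` against `p → p(1⊗j)p ≅ p(p⊗1)(1⊗1⊗j) → p(1⊗p)(1⊗1⊗j)`.
  right_unit :
    𝟙 p ⊗≫ (tensorId obj obj).inv ▷ p ⊗≫
        tensorLeft₂ obj rho ▷ p ⊗≫
        (leftMerge (𝟙 obj) (rHom obj) (obj ◁ₜ j ≫ p)).inv ▷ p ⊗≫
        obj ◁ₜ rHom obj ◁ (leftMerge (𝟙 obj) (obj ◁ₜ j) p).inv ▷ p ⊗≫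
        𝟙 (obj ◁ₜ rHom obj ≫ obj ◁ₜ obj ◁ₜ j ≫ obj ◁ₜ p ≫ p) =
      𝟙 p ⊗≫ p ◁ rho ⊗≫
        (rNat p).hom ▷ (obj ◁ₜ j ≫ p) ⊗≫
        rHom (obj ⊠ obj) ◁ (interchange p j).hom ▷ p ⊗≫
        (rHom (obj ⊠ obj) ≫ (obj ⊠ obj) ◁ₜ j) ◁ α ⊗≫
        rHom (obj ⊠ obj) ◁ (aNatLeft obj obj j).hom ▷ (obj ◁ₜ p ≫ p) ⊗≫
        (MonoidalBicategory.right obj obj).hom ▷ (obj ◁ₜ obj ◁ₜ j ≫ obj ◁ₜ p ≫ p)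
  -- `j → p(1⊗j)j ≅ p(j⊗1)j → j` is the identity.
  unit_unit :
    𝟙 j ⊗≫ j ◁ rho ⊗≫
        (rNat j).hom ▷ (obj ◁ₜ j ≫ p) ⊗≫
        rHom (unitObj M) ◁ (interchange j j).hom ▷ p ⊗≫
        (rHom (unitObj M) ≫ unitObj M ◁ₜ j) ◁ lam ⊗≫
        rHom (unitObj M) ◁ (lNat j).hom ⊗≫
        (rlUnitIso M).hom ▷ j ⊗≫ 𝟙 j =
      𝟙 j

namespace LeftSkewMonoidale

/-- A left skew monoidale is right normal if its right unit constraint is invertible. -/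
def RightNormal (A : LeftSkewMonoidale M) : Prop := IsIso A.rho

end LeftSkewMonoidale

/-! ### Opmonoidal morphisms, opmonoidal 2-cells and opmonoidal monads -/

/-- The data of an opmonoidal structure on a 1-cell between left skew monoidales. -/
@[ext]
structure OpmonoidalData {A B : LeftSkewMonoidale M} (f : A.obj ⟶ B.obj) where
  ψ : A.p ≫ f ⟶ f ⊠₁ f ≫ B.p
  ψ₀ : A.j ≫ f ⟶ B.j

/-- The opmonoidal structure of the identity morphism. -/
def OpmonoidalData.id (A : LeftSkewMonoidale M) : OpmonoidalData (A := A) (B := A) (𝟙 A.obj) where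
  ψ := (ρ_ A.p).hom ≫ (λ_ A.p).inv ≫ (tensorId A.obj A.obj).inv ▷ A.p
  ψ₀ := (ρ_ A.j).hom

/-- The opmonoidal structure of a composite of opmonoidal morphisms. -/
def OpmonoidalData.comp {A B C : LeftSkewMonoidale M} {f : A.obj ⟶ B.obj} {g : B.obj ⟶ C.obj}
    (F : OpmonoidalData f) (G : OpmonoidalData g) : OpmonoidalData (A := A) (B := C) (f ≫ g) where
  ψ := 𝟙 (A.p ≫ f ≫ g) ⊗≫ F.ψ ▷ g ⊗≫ f ⊠₁ f ◁ G.ψ ⊗≫ (tensorComp f g f g).inv ▷ C.p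
  ψ₀ := 𝟙 (A.j ≫ f ≫ g) ⊗≫ F.ψ₀ ▷ g ⊗≫ G.ψ₀

/-- The three axioms of an opmonoidal morphism between left skew monoidales. -/
structure IsOpmonoidal {A B : LeftSkewMonoidale M} {f : A.obj ⟶ B.obj}
    (F : OpmonoidalData f) : Prop where
  -- `T((X⊗Y)⊗Z) → T(X⊗Y)⊗TZ → (TX⊗TY)⊗TZ → TX⊗(TY⊗TZ)` against
  -- `T((X⊗Y)⊗Z) → T(X⊗(Y⊗Z)) → TX⊗T(Y⊗Z) → TX⊗(TY⊗TZ)`.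
  assoc :
    A.p ▷ₜ A.obj ◁ F.ψ ⊗≫
        (rightMerge A.p f f).hom ▷ B.p ⊗≫
        (F.ψ ⊠₂ 𝟙 f) ▷ B.p ⊗≫
        (mergeRight (f ⊠₁ f) B.p f).inv ▷ B.p ⊗≫
        (f ⊠₁ f) ⊠₁ f ◁ B.α ⊗≫
        (aNat f f f).hom ▷ (B.obj ◁ₜ B.p ≫ B.p) ⊗≫
        𝟙 (aHom A.obj A.obj A.obj ≫ f ⊠₁ (f ⊠₁ f) ≫ B.obj ◁ₜ B.p ≫ B.p) =
      𝟙 (A.p ▷ₜ A.obj ≫ A.p ≫ f) ⊗≫ A.α ▷ f ⊗≫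
        (aHom A.obj A.obj A.obj ≫ A.obj ◁ₜ A.p) ◁ F.ψ ⊗≫
        aHom A.obj A.obj A.obj ◁ (leftMerge f A.p f).hom ▷ B.p ⊗≫
        aHom A.obj A.obj A.obj ◁ (𝟙 f ⊠₂ F.ψ) ▷ B.p ⊗≫
        aHom A.obj A.obj A.obj ◁ (mergeLeft f (f ⊠₁ f) B.p).inv ▷ B.p ⊗≫
        𝟙 (aHom A.obj A.obj A.obj ≫ f ⊠₁ (f ⊠₁ f) ≫ B.obj ◁ₜ B.p ≫ B.p)
  -- `T(I⊗X) → TI⊗TX → I⊗TX → TX` against `T(I⊗X) → TX`.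
  left_unit :
    A.j ▷ₜ A.obj ◁ F.ψ ⊗≫
        (rightMerge A.j f f).hom ▷ B.p ⊗≫
        (F.ψ₀ ⊠₂ 𝟙 f) ▷ B.p ⊗≫
        (splitLR B.j f).hom ▷ B.p ⊗≫
        unitObj M ◁ₜ f ◁ B.lam ⊗≫
        (lNat f).hom =
      𝟙 (A.j ▷ₜ A.obj ≫ A.p ≫ f) ⊗≫ A.lam ▷ f
  -- `TX → T(X⊗I) → TX⊗TI → TX⊗I` against `TX → TX⊗I`.
  right_unit :
    𝟙 f ⊗≫ A.rho ▷ f ⊗≫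
        (rHom A.obj ≫ A.obj ◁ₜ A.j) ◁ F.ψ ⊗≫
        rHom A.obj ◁ (leftMerge f A.j f).hom ▷ B.p ⊗≫
        rHom A.obj ◁ (𝟙 f ⊠₂ F.ψ₀) ▷ B.p =
      𝟙 f ⊗≫ f ◁ B.rho ⊗≫
        (rNat f).hom ▷ (B.obj ◁ₜ B.j ≫ B.p) ⊗≫
        rHom A.obj ◁ (splitRL f B.j).inv ▷ B.p

/-- A 2-cell between opmonoidal morphisms is opmonoidal if it is compatible with the opmonoidal
structures. -/
structure IsOpmonoidal₂ {A B : LeftSkewMonoidale M} {f g : A.obj ⟶ B.obj}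
    (F : OpmonoidalData f) (G : OpmonoidalData g) (σ : f ⟶ g) : Prop where
  tensor : F.ψ ≫ (σ ⊠₂ σ) ▷ B.p = A.p ◁ σ ≫ G.ψ
  unit : A.j ◁ σ ≫ G.ψ₀ = F.ψ₀

/-- An opmonoidal monad on a left skew monoidale `A`: a monad in the bicategory of left skew
monoidales, opmonoidal morphisms and opmonoidal 2-cells. -/
structure OpmonoidalMonad (A : LeftSkewMonoidale M) where
  t : A.obj ⟶ A.obj
  opm : OpmonoidalData (A := A) (B := A) t
  η : 𝟙 A.obj ⟶ t
  μ : t ≫ t ⟶ t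
  assoc : μ ▷ t ≫ μ = (α_ t t t).hom ≫ t ◁ μ ≫ μ
  left_unit : η ▷ t ≫ μ = (λ_ t).hom
  right_unit : t ◁ η ≫ μ = (ρ_ t).hom
  isOpmonoidal : IsOpmonoidal opm
  η_isOpmonoidal : IsOpmonoidal₂ (OpmonoidalData.id A) opm η
  μ_isOpmonoidal : IsOpmonoidal₂ (opm.comp opm) opm μ

/-! ### Skew left warpings -/

/-- The data of a skew left warping on a left skew monoidale. -/
structure SkewLeftWarpingData (A : LeftSkewMonoidale M) where
  t : A.obj ⟶ A.obj
  k : unitObj M ⟶ A.obj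
  v : t ▷ₜ A.obj ≫ A.p ≫ t ⟶ t ⊠₁ t ≫ A.p
  v₀ : k ≫ t ⟶ A.j
  κ : 𝟙 A.obj ⟶ rHom A.obj ≫ t ⊠₁ k ≫ A.p

/-- A skew left warping on a left skew monoidale. -/
structure SkewLeftWarping (A : LeftSkewMonoidale M) extends SkewLeftWarpingData A where
  -- `T(TA ⊗ B) ⊗ TC → (TA ⊗ TB) ⊗ TC → TA ⊗ (TB ⊗ TC)` against
  -- `T((TA ⊗ TB) ⊗ C) → T(TA ⊗ (TB ⊗ C)) → TA ⊗ T(TB ⊗ C) → TA ⊗ (TB ⊗ TC)`,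
  -- both from `T(T(TA ⊗ B) ⊗ C)`.
  assoc :
    𝟙 ((t ▷ₜ A.obj) ▷ₜ A.obj ≫ A.p ▷ₜ A.obj ≫ t ▷ₜ A.obj ≫ A.p ≫ t) ⊗≫
        ((t ▷ₜ A.obj) ▷ₜ A.obj ≫ A.p ▷ₜ A.obj) ◁ v ⊗≫
        (t ▷ₜ A.obj) ▷ₜ A.obj ◁ (rightMerge A.p t t).hom ▷ A.p ⊗≫
        (rightMerge (t ▷ₜ A.obj) (A.p ≫ t) t).hom ▷ A.p ⊗≫
        (v ⊠₂ 𝟙 t) ▷ A.p ⊗≫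
        (mergeRight (t ⊠₁ t) A.p t).inv ▷ A.p ⊗≫
        (t ⊠₁ t) ⊠₁ t ◁ A.α ⊗≫
        (aNat t t t).hom ▷ (A.obj ◁ₜ A.p ≫ A.p) ⊗≫
        𝟙 (aHom A.obj A.obj A.obj ≫ t ⊠₁ (t ⊠₁ t) ≫ A.obj ◁ₜ A.p ≫ A.p) =
      𝟙 ((t ▷ₜ A.obj) ▷ₜ A.obj ≫ A.p ▷ₜ A.obj ≫ t ▷ₜ A.obj ≫ A.p ≫ t) ⊗≫
        (t ▷ₜ A.obj) ▷ₜ A.obj ◁ (rightMerge A.p t (𝟙 A.obj)).hom ▷ (A.p ≫ t) ⊗≫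
        (rightMerge (t ▷ₜ A.obj) (A.p ≫ t) (𝟙 A.obj)).hom ▷ (A.p ≫ t) ⊗≫
        tensorRight₂ v A.obj ▷ (A.p ≫ t) ⊗≫
        (mergeRight (t ⊠₁ t) A.p (𝟙 A.obj)).inv ▷ (A.p ≫ t) ⊗≫
        (t ⊠₁ t) ▷ₜ A.obj ◁ A.α ▷ t ⊗≫
        (aNat t t (𝟙 A.obj)).hom ▷ (A.obj ◁ₜ A.p ≫ A.p ≫ t) ⊗≫
        aHom A.obj A.obj A.obj ◁ (mergeLeft t (t ▷ₜ A.obj) A.p).hom ▷ (A.p ≫ t) ⊗≫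
        aHom A.obj A.obj A.obj ◁ (splitLR t (t ▷ₜ A.obj ≫ A.p)).hom ▷ (A.p ≫ t) ⊗≫
        (aHom A.obj A.obj A.obj ≫ A.obj ◁ₜ (t ▷ₜ A.obj ≫ A.p)) ◁ v ⊗≫
        aHom A.obj A.obj A.obj ◁ (leftMerge t (t ▷ₜ A.obj ≫ A.p) t).hom ▷ A.p ⊗≫
        aHom A.obj A.obj A.obj ◁ (𝟙 t ⊠₂ ((α_ _ _ _).hom ≫ v)) ▷ A.p ⊗≫
        aHom A.obj A.obj A.obj ◁ (mergeLeft t (t ⊠₁ t) A.p).inv ▷ A.p ⊗≫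
        𝟙 (aHom A.obj A.obj A.obj ≫ t ⊠₁ (t ⊠₁ t) ≫ A.obj ◁ₜ A.p ≫ A.p)
  -- `T(TK ⊗ B) → TK ⊗ TB → I ⊗ TB → TB` against `T(TK ⊗ B) → T(I ⊗ B) → TB`.
  left_unit :
    𝟙 (k ▷ₜ A.obj ≫ t ▷ₜ A.obj ≫ A.p ≫ t) ⊗≫
        k ▷ₜ A.obj ◁ v ⊗≫
        (rightMerge k t t).hom ▷ A.p ⊗≫
        (v₀ ⊠₂ 𝟙 t) ▷ A.p ⊗≫
        (splitLR A.j t).hom ▷ A.p ⊗≫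
        unitObj M ◁ₜ t ◁ A.lam ⊗≫
        (lNat t).hom =
      𝟙 (k ▷ₜ A.obj ≫ t ▷ₜ A.obj ≫ A.p ≫ t) ⊗≫
        (rightMerge k t (𝟙 A.obj)).hom ▷ (A.p ≫ t) ⊗≫
        tensorRight₂ v₀ A.obj ▷ (A.p ≫ t) ⊗≫
        A.lam ▷ t
  -- `TA → T(TA ⊗ K) → TA ⊗ TK → TA ⊗ I` against `TA → TA ⊗ I`.
  right_unit :
    𝟙 t ⊗≫ κ ▷ t ⊗≫
        rHom A.obj ◁ (splitLR t k).hom ▷ (A.p ≫ t) ⊗≫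
        (rHom A.obj ≫ A.obj ◁ₜ k) ◁ v ⊗≫
        rHom A.obj ◁ (leftMerge t k t).hom ▷ A.p ⊗≫
        rHom A.obj ◁ (𝟙 t ⊠₂ v₀) ▷ A.p =
      𝟙 t ⊗≫ t ◁ A.rho ⊗≫
        (rNat t).hom ▷ (A.obj ◁ₜ A.j ≫ A.p) ⊗≫
        rHom A.obj ◁ (splitRL t A.j).inv ▷ A.p
  -- `TA ⊗ B → T(TA ⊗ B) ⊗ K → (TA ⊗ TB) ⊗ K → TA ⊗ (TB ⊗ K)` against
  -- `TA ⊗ B → TA ⊗ (TB ⊗ K)`.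
  unit_tensor :
    𝟙 (t ▷ₜ A.obj ≫ A.p) ⊗≫ (t ▷ₜ A.obj ≫ A.p) ◁ κ ⊗≫
        (rNat (t ▷ₜ A.obj ≫ A.p)).hom ▷ (t ⊠₁ k ≫ A.p) ⊗≫
        rHom (A.obj ⊠ A.obj) ◁ (rightMerge (t ▷ₜ A.obj ≫ A.p) t k).hom ▷ A.p ⊗≫
        rHom (A.obj ⊠ A.obj) ◁ (((α_ _ _ _).hom ≫ v) ⊠₂ 𝟙 k) ▷ A.p ⊗≫
        rHom (A.obj ⊠ A.obj) ◁ (mergeRight (t ⊠₁ t) A.p k).inv ▷ A.p ⊗≫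
        (rHom (A.obj ⊠ A.obj) ≫ (t ⊠₁ t) ⊠₁ k) ◁ A.α ⊗≫
        rHom (A.obj ⊠ A.obj) ◁ (aNat t t k).hom ▷ (A.obj ◁ₜ A.p ≫ A.p) ⊗≫
        (MonoidalBicategory.right A.obj A.obj).hom ▷
          (t ⊠₁ (t ⊠₁ k) ≫ A.obj ◁ₜ A.p ≫ A.p) =
      (𝟙 t ⊠₂ κ) ▷ A.p ⊗≫
        (leftMerge t (rHom A.obj) (t ⊠₁ k ≫ A.p)).inv ▷ A.p ⊗≫
        A.obj ◁ₜ rHom A.obj ◁ (mergeLeft t (t ⊠₁ k) A.p).inv ▷ A.p ⊗≫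
        𝟙 (A.obj ◁ₜ rHom A.obj ≫ t ⊠₁ (t ⊠₁ k) ≫ A.obj ◁ₜ A.p ≫ A.p)
  -- `K → TK ⊗ K → I ⊗ K → K` is the identity.
  unit_unit :
    𝟙 k ⊗≫ k ◁ κ ⊗≫
        (rNat k).hom ▷ (t ⊠₁ k ≫ A.p) ⊗≫
        rHom (unitObj M) ◁ (rightMerge k t k).hom ▷ A.p ⊗≫
        rHom (unitObj M) ◁ (v₀ ⊠₂ 𝟙 k) ▷ A.p ⊗≫
        rHom (unitObj M) ◁ (splitLR A.j k).hom ▷ A.p ⊗≫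
        (rHom (unitObj M) ≫ unitObj M ◁ₜ k) ◁ A.lam ⊗≫
        rHom (unitObj M) ◁ (lNat k).hom ⊗≫
        (rlUnitIso M).hom ▷ k ⊗≫ 𝟙 k =
      𝟙 k

/-- The data of the skew left warping `(t, j, v, v₀, κ)` constructed from an opmonoidal monad:
`v` is `T(TA ⊗ B) → TTA ⊗ TB → TA ⊗ TB`, `v₀` is `ψ₀ : TI → I` and `κ` is `A → TA → TA ⊗ I`. -/
def OpmonoidalMonad.warpingData {A : LeftSkewMonoidale M} (T : OpmonoidalMonad A) :
    SkewLeftWarpingData A where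
  t := T.t
  k := A.j
  v := T.t ▷ₜ A.obj ◁ T.opm.ψ ⊗≫
    (rightMerge T.t T.t T.t).hom ▷ A.p ⊗≫
    (T.μ ⊠₂ 𝟙 T.t) ▷ A.p
  v₀ := T.opm.ψ₀
  κ := T.η ⊗≫ T.t ◁ A.rho ⊗≫
    (rNat T.t).hom ▷ (A.obj ◁ₜ A.j ≫ A.p) ⊗≫
    rHom A.obj ◁ (splitRL T.t A.j).inv ▷ A.p

end Monoidal

end SkewWarp

set_option linter.unusedSimpArgs false
set_option linter.unusedSectionVars false
set_option linter.unusedTactic false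
set_option synthInstance.maxHeartbeats 400000

namespace SkewWarp

/-! ### Laws of the tensor pseudofunctor and of the constraints `a`, `ℓ`, `r`. -/

section
variable {M : Type u} [Bicategory.{w, v} M] [TensorBicategory M]

/-! Formulas in these comments are in element style, with composition from right to left.

From monads to warpings, put v = (μ ⊗ 1)ψ and κ = ρη. Axiom 1 comes from coassociativity of ψ,
opmonoidality of μ and associativity of μ; axiom 2 from the left counit condition and ψ₀μ = ψ₀Tψ₀;
axiom 3 from the right counit condition and μTη = 1; axiom 4 from opmonoidality of η, the right unit
axiom of A and μη_T = 1; axiom 5 from ψ₀η = 1 and λρ = 1 on J.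

For the converse, invertibility of ρ allows ρ_{TX} : TX → TX ⊗ J to be cancelled, so η and μ can be
defined by ρ_{TX} η_X = κ_X and ρ_{TX} μ_X = (1 ⊗ v₀) v_{X,J} Tρ_{TX}; then ψ_{X,Y} = v_{X,Y} T(η_X
⊗ 1). Every opmonoidal monad satisfies these three equations (`mu_rhoF`, `opm_ψ`), which gives
injectivity. For surjectivity the main point is to specialise axiom 1 to Y = J and to Z = J. The
first, with axiom 2 and the middle unit axiom of A, gives v_{X,Z} T(μ_X ⊗ 1) = (μ_X ⊗ 1) v_{TX,Z}
(`mu_v`). The second, with the right unit axiom of A, gives v_{X,Y} μ_{TX⊗Y} = (1 ⊗ μ_Y) v_{X,TY}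
Tv_{X,Y} (`v_mu`). Axioms 3, 4, 5 and 2 similarly give μTη = 1, v η = 1 ⊗ η, v₀η = 1 and v₀μ =
v₀Tv₀. The case Y = J of these formulas yields the remaining monad laws, and the opmonoidal axioms
and v = (μ ⊗ 1)ψ follow.

Element style is justified by generalized elements: a 1-cell `U : G ⟶ X` is an element of `X`, and
`Ev e σ e' τ` says that `τ` is the value of the 2-cell `σ` at `U`, relative to chosen values `e`,
`e'` of its source and target. Instance search computes values. Associators, unitors, functoriality
of the tensor product and pseudonaturality of the constraints evaluate to identities, apart from
isomorphisms that record reindexing along `a`, `ℓ`, `r` (`pullAssoc`, `pullTen`, `rightIso`,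
`midIso`, `rlIso`). Evaluation at identities is faithful, so every axiom is equivalent to a family
of equations between values, and the argument above is carried out on these families. -/

@[simp] theorem tensorHom₂_comp {X X' Y Y' : M} {f f' f'' : X ⟶ X'} {g g' g'' : Y ⟶ Y'}
    (σ : f ⟶ f') (σ' : f' ⟶ f'') (τ : g ⟶ g') (τ' : g' ⟶ g'') :
    (σ ⊠₂ τ) ≫ (σ' ⊠₂ τ') = (σ ≫ σ') ⊠₂ (τ ≫ τ') :=
  (PrelaxFunctor.map₂_comp TensorBicategory.tensor.toPrelaxFunctor (a := (X, Y)) (b := (X', Y'))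
      (f := (f, g)) (g := (f', g')) (h := (f'', g'')) (σ, τ) (σ', τ')).symm

theorem tensorHom₂_comp_assoc {X X' Y Y' : M} {f f' f'' : X ⟶ X'} {g g' g'' : Y ⟶ Y'}
    (σ : f ⟶ f') (σ' : f' ⟶ f'') (τ : g ⟶ g') (τ' : g' ⟶ g'') {k : X ⊠ Y ⟶ X' ⊠ Y'}
    (υ : f'' ⊠₁ g'' ⟶ k) : (σ ⊠₂ τ) ≫ (σ' ⊠₂ τ') ≫ υ = ((σ ≫ σ') ⊠₂ (τ ≫ τ')) ≫ υ := by
  rw [← Category.assoc, tensorHom₂_comp]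

@[simp] theorem tensorHom₂_id {X X' Y Y' : M} (f : X ⟶ X') (g : Y ⟶ Y')  :
    𝟙 f ⊠₂ 𝟙 g = 𝟙 (f ⊠₁ g) :=
  PrelaxFunctor.map₂_id TensorBicategory.tensor.toPrelaxFunctor (a := (X, Y)) (b := (X', Y')) (f, g)

@[simp] theorem tensorIso_hom {X X' Y Y' : M} {f f' : X ⟶ X'} {g g' : Y ⟶ Y'} (σ : f ≅ f')
    (τ : g ≅ g') :
    (tensorIso σ τ).hom = σ.hom ⊠₂ τ.hom := rfl

@[simp] theorem tensorIso_inv {X X' Y Y' : M} {f f' : X ⟶ X'} {g g' : Y ⟶ Y'} (σ : f ≅ f')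
    (τ : g ≅ g') :
    (tensorIso σ τ).inv = σ.inv ⊠₂ τ.inv := rfl

theorem tensorComp_whisker_left {X X' X'' Y Y' Y'' : M} (f : X ⟶ X') {f' f'' : X' ⟶ X''}
    (g : Y ⟶ Y') {g' g'' : Y' ⟶ Y''}
    (σ : f' ⟶ f'') (τ : g' ⟶ g'') :
    ((f ◁ σ) ⊠₂ (g ◁ τ)) ≫ (tensorComp f f'' g g'').hom = (tensorComp f f' g g').hom ≫
        f ⊠₁ g ◁ (σ ⊠₂ τ) := by
  have := TensorBicategory.tensor.map₂_whisker_left (a := (X, Y)) (b := (X', Y')) (c := (X'', Y''))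
      (f, g) (g := (f', g')) (h := (f'', g'')) (σ, τ)
  exact (Iso.eq_comp_inv _).1 (this.trans (Category.assoc _ _ _).symm)

theorem tensorComp_whisker_right {X X' X'' Y Y' Y'' : M} {f f₁ : X ⟶ X'} (f' : X' ⟶ X'')
    {g g₁ : Y ⟶ Y'} (g' : Y' ⟶ Y'')
    (σ : f ⟶ f₁) (τ : g ⟶ g₁) :
    ((σ ▷ f') ⊠₂ (τ ▷ g')) ≫ (tensorComp f₁ f' g₁ g').hom = (tensorComp f f' g g').hom ≫
        (σ ⊠₂ τ) ▷ f' ⊠₁ g' := by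
  have := TensorBicategory.tensor.map₂_whisker_right (a := (X, Y)) (b := (X', Y')) (c := (X'', Y''))
      (f := (f, g)) (g := (f₁, g₁)) (σ, τ) (f', g')
  exact (Iso.eq_comp_inv _).1 (this.trans (Category.assoc _ _ _).symm)

theorem tensorComp_assoc {X X' X'' X''' Y Y' Y'' Y''' : M} (f : X ⟶ X') (f' : X' ⟶ X'')
    (f'' : X'' ⟶ X''')
    (g : Y ⟶ Y') (g' : Y' ⟶ Y'') (g'' : Y'' ⟶ Y''') :
    ((α_ f f' f'').hom ⊠₂ (α_ g g' g'').hom) ≫ (tensorComp f (f' ≫ f'') g (g' ≫ g'')).hom ≫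
        f ⊠₁ g ◁ (tensorComp f' f'' g' g'').hom
     = (tensorComp (f ≫ f') f'' (g ≫ g') g'').hom ≫ (tensorComp f f' g g').hom ▷ f'' ⊠₁ g'' ≫
         (α_ _ _ _).hom := by
  have := TensorBicategory.tensor.map₂_associator (a := (X, Y)) (b := (X', Y')) (c := (X'', Y''))
      (d := (X''', Y''')) (f, g) (f', g') (f'', g'')
  have e : ((α_ f f' f'').hom ⊠₂ (α_ g g' g'').hom) = (tensorComp (f ≫ f') f'' (g ≫ g') g'').hom ≫
      (tensorComp f f' g g').hom ▷ f'' ⊠₁ g'' ≫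
      (α_ _ _ _).hom ≫ f ⊠₁ g ◁ (tensorComp f' f'' g' g'').inv ≫
      (tensorComp f (f' ≫ f'') g (g' ≫ g'')).inv := this
  rw [e]; simp

theorem tensorComp_id_right {X X' Y Y' : M} (f : X ⟶ X') (g : Y ⟶ Y') :
    (ρ_ f).hom ⊠₂ (ρ_ g).hom = (tensorComp f (𝟙 X') g (𝟙 Y')).hom ≫ f ⊠₁ g ◁ (tensorId X' Y').hom ≫
        (ρ_ _).hom :=
  TensorBicategory.tensor.map₂_right_unitor (a := (X, Y)) (b := (X', Y')) (f, g)

theorem aNat_naturality {X X' Y Y' Z Z' : M} {f f' : X ⟶ X'} {g g' : Y ⟶ Y'} {h h' : Z ⟶ Z'}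
    (σ : f ⟶ f') (τ : g ⟶ g') (υ : h ⟶ h') :
    ((σ ⊠₂ τ) ⊠₂ υ) ▷ aHom X' Y' Z' ≫ (aNat f' g' h').hom =
        (aNat f g h).hom ≫ aHom X Y Z ◁ (σ ⊠₂ (τ ⊠₂ υ)) :=
  TensorBicategory.assoc.naturality_naturality (a := ((X, Y), Z)) (b := ((X', Y'), Z'))
      (f := ((f, g), h)) (g := ((f', g'), h')) ((σ, τ), υ)

theorem aNat_comp {X X' X'' Y Y' Y'' Z Z' Z'' : M} (f : X ⟶ X') (g : Y ⟶ Y') (h : Z ⟶ Z')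
    (f' : X' ⟶ X'') (g' : Y' ⟶ Y'') (h' : Z' ⟶ Z'') :
    (aNat (f ≫ f') (g ≫ g') (h ≫ h')).hom ≫ aHom X Y Z ◁ ((𝟙 _ ⊠₂ (tensorComp g g' h h').hom) ≫
        (tensorComp f f' (g ⊠₁ h) (g' ⊠₁ h')).hom) =
    (((tensorComp f f' g g').hom ⊠₂ 𝟙 _) ≫ (tensorComp (f ⊠₁ g) (f' ⊠₁ g') h h').hom) ▷ aHom X'' Y''
        Z'' ≫ (α_ _ _ _).hom ≫ (f ⊠₁ g) ⊠₁ h ◁ (aNat f' g' h').hom ≫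
      (α_ _ _ _).inv ≫ (aNat f g h).hom ▷ f' ⊠₁ (g' ⊠₁ h') ≫ (α_ _ _ _).hom := by
  have e : (aNat (f ≫ f') (g ≫ g') (h ≫ h')).hom ≫
      aHom X Y Z ◁ ((𝟙 (f ≫ f') ⊠₂ (𝟙 (g ≫ g') ⊠₂ 𝟙 (h ≫ h'))) ≫
      (𝟙 (f ≫ f') ⊠₂ (tensorComp g g' h h').hom) ≫ (tensorComp f f' (g ⊠₁ h) (g' ⊠₁ h')).hom) =
    (((tensorComp f f' g g').hom ⊠₂ 𝟙 (h ≫ h')) ≫ (tensorComp (f ⊠₁ g) (f' ⊠₁ g') h h').hom) ▷ aHom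
        X'' Y'' Z'' ≫ (α_ _ _ _).hom ≫ (f ⊠₁ g) ⊠₁ h ◁ (aNat f' g' h').hom ≫
      (α_ _ _ _).inv ≫ (aNat f g h).hom ▷ f' ⊠₁ (g' ⊠₁ h') ≫ (α_ _ _ _).hom :=
    TensorBicategory.assoc.naturality_comp (a := ((X, Y), Z)) (b := ((X', Y'), Z'))
        (c := ((X'', Y''), Z'')) ((f, g), h) ((f', g'), h')
  rw [tensorHom₂_id, tensorHom₂_id, Category.id_comp] at e
  exact e

theorem lNat_naturality {X X' : M} {f f' : X ⟶ X'} (σ : f ⟶ f') :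
    (𝟙 (𝟙 TensorBicategory.unit) ⊠₂ σ) ▷ lHom X' ≫ (lNat f').hom = (lNat f).hom ≫ lHom X ◁ σ :=
  TensorBicategory.leftUnit.naturality_naturality σ

theorem lNat_comp {X X' X'' : M} (f : X ⟶ X') (f' : X' ⟶ X'') :
    (lNat (f ≫ f')).hom =
        (((ρ_ (𝟙 TensorBicategory.unit)).inv ⊠₂ 𝟙 _) ≫ (tensorComp _ _ f f').hom) ▷ lHom X'' ≫
        (α_ _ _ _).hom ≫ _ ◁ (lNat f').hom ≫ (α_ _ _ _).inv ≫ (lNat f).hom ▷ f' ≫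
        (α_ _ _ _).hom := by
  have e : (lNat (f ≫ f')).hom ≫ lHom X ◁ (𝟙 (f ≫ f')) =
      (((ρ_ (𝟙 TensorBicategory.unit)).inv ⊠₂ 𝟙 _) ≫ (tensorComp _ _ f f').hom) ▷ lHom X'' ≫
      (α_ _ _ _).hom ≫ _ ◁ (lNat f').hom ≫ (α_ _ _ _).inv ≫ (lNat f).hom ▷ f' ≫ (α_ _ _ _).hom :=
    TensorBicategory.leftUnit.naturality_comp f f'
  rw [Bicategory.whiskerLeft_id, Category.comp_id] at e
  exact e

theorem rNat_naturality {X X' : M} {f f' : X ⟶ X'} (σ : f ⟶ f') :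
    σ ▷ rHom X' ≫ (rNat f').hom = (rNat f).hom ≫ rHom X ◁ (σ ⊠₂ 𝟙 (𝟙 TensorBicategory.unit)) :=
  TensorBicategory.rightUnit.naturality_naturality σ

theorem rNat_comp {X X' X'' : M} (f : X ⟶ X') (f' : X' ⟶ X'') :
    (rNat (f ≫ f')).hom ≫ rHom X ◁ ((𝟙 (f ≫ f') ⊠₂ (λ_ (𝟙 TensorBicategory.unit)).inv) ≫
        (tensorComp f f' _ _).hom) = (α_ _ _ _).hom ≫ f ◁ (rNat f').hom ≫ (α_ _ _ _).inv ≫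
        (rNat f).hom ▷ _ ≫ (α_ _ _ _).hom := by
  have e : (rNat (f ≫ f')).hom ≫ rHom X ◁ ((𝟙 (f ≫ f') ⊠₂ (λ_ (𝟙 TensorBicategory.unit)).inv) ≫
      (tensorComp f f' _ _).hom) = (𝟙 (f ≫ f')) ▷ _ ≫ (α_ _ _ _).hom ≫ f ◁ (rNat f').hom ≫
      (α_ _ _ _).inv ≫ (rNat f).hom ▷ _ ≫ (α_ _ _ _).hom :=
    TensorBicategory.rightUnit.naturality_comp f f'
  rw [Bicategory.id_whiskerRight, Category.id_comp] at e
  exact e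
end

/-! ### Generalized elements and evaluation of 2-cells. -/

section
variable {M : Type u} [Bicategory.{w, v} M]

/-- Reindexing a generalized element `U` of `X` along `a`. -/
def pull {G G' X : M} (a : G ⟶ G') (U : G' ⟶ X) : G ⟶ X := a ≫ U

variable {G G' G'' X Y Z W : M}

/-- The value of `f ≫ g` at `U`, from the value `r` of `f` at `U` and that of `g` at `r`. -/
def evc {U : G ⟶ X} {f : X ⟶ Y} {r : G ⟶ Y} {g : Y ⟶ Z} {q : G ⟶ Z} (e₁ : U ≫ f ≅ r)
    (e₂ : r ≫ g ≅ q) : U ≫ (f ≫ g) ≅ q :=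
  (α_ U f g).symm ≪≫ whiskerRightIso e₁ g ≪≫ e₂

/-- The value of an unanalysed morphism is the composite itself. -/
def evAtom (U : G ⟶ X) (f : X ⟶ Y) : U ≫ f ≅ U ≫ f := Iso.refl _

/-- The value of an identity morphism. -/
def evi (U : G ⟶ X) : U ≫ 𝟙 X ≅ U := ρ_ U

/-- The value of a morphism at the generic element. -/
def evid (f : X ⟶ Y) : 𝟙 X ≫ f ≅ f := λ_ f

/-- Reindexing of a value along `a`. -/
def pre (a : G' ⟶ G) {U : G ⟶ X} {f : X ⟶ Y} {r : G ⟶ Y} (e : U ≫ f ≅ r) : pull a U ≫ f ≅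
    pull a r :=
  α_ a U f ≪≫ whiskerLeftIso a e

theorem evc_hom {U : G ⟶ X} {f : X ⟶ Y} {r : G ⟶ Y} {g : Y ⟶ Z} {q : G ⟶ Z} (e₁ : U ≫ f ≅ r)
    (e₂ : r ≫ g ≅ q) :
  (evc e₁ e₂).hom = (α_ U f g).inv ≫ e₁.hom ▷ g ≫ e₂.hom := rfl

theorem evAtom_hom (U : G ⟶ X) (f : X ⟶ Y) : (evAtom U f).hom = 𝟙 _ := rfl

theorem evid_hom (f : X ⟶ Y) : (evid f).hom = (λ_ f).hom := rfl

theorem pre_hom (a : G' ⟶ G) {U : G ⟶ X} {f : X ⟶ Y} {r : G ⟶ Y} (e : U ≫ f ≅ r) :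
  (pre a e).hom = (α_ a U f).hom ≫ a ◁ e.hom := rfl

/-- evaluation of a 2-cell at a generalized element -/
class Ev {U : G ⟶ X} {f g : X ⟶ Y} {r : G ⟶ Y} (e : U ≫ f ≅ r) (σ : f ⟶ g) {s : outParam (G ⟶ Y)}
    (e' : outParam (U ≫ g ≅ s)) (τ : outParam (r ⟶ s)) : Prop where
  eq : e.hom ≫ τ = U ◁ σ ≫ e'.hom

/-- Effect on the values of `h` of a 2-cell between generalized elements. -/
class Wh {r s : G ⟶ X} {h : X ⟶ Y} {q : G ⟶ Y} (d : r ≫ h ≅ q) (τ : r ⟶ s) {q' : outParam (G ⟶ Y)}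
    (d' : outParam (s ≫ h ≅ q')) (θ : outParam (q ⟶ q')) : Prop where
  eq : d.hom ≫ θ = τ ▷ h ≫ d'.hom

/-- composition, with identities removed -/
class Cmp {r s t : G ⟶ X} (σ : r ⟶ s) (τ : s ⟶ t) (υ : outParam (r ⟶ t)) : Prop where
  eq : σ ≫ τ = υ

/-- The priorities let identities be absorbed before the plain composite is used, so that computed
values carry few superfluous factors. -/
instance (priority := low) {r s t : G ⟶ X} (σ : r ⟶ s) (τ : s ⟶ t) : Cmp σ τ (σ ≫ τ) := ⟨rfl⟩
instance {r s : G ⟶ X} (τ : r ⟶ s) : Cmp (𝟙 r) τ τ := ⟨by simp⟩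
instance (priority := high) {r s : G ⟶ X} (τ : r ⟶ s) : Cmp τ (𝟙 s) τ := ⟨by simp⟩

/-- Reindexing of a 2-cell along `a`. -/
def pull₂ (a : G' ⟶ G) {r s : G ⟶ X} (σ : r ⟶ s) : pull a r ⟶ pull a s := a ◁ σ

/-- Applying `f` commutes with reindexing. -/
def pullAssoc (a : G' ⟶ G) (r : G ⟶ X) (f : X ⟶ Y) : pull a r ≫ f ≅ pull a (r ≫ f) := α_ a r f

@[simp] theorem pull₂_id (a : G' ⟶ G) (r : G ⟶ X) : pull₂ a (𝟙 r) = 𝟙 _ :=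
    Bicategory.whiskerLeft_id _ _

@[simp] theorem pull₂_comp (a : G' ⟶ G) {r s t : G ⟶ X} (σ : r ⟶ s) (τ : s ⟶ t) : pull₂ a (σ ≫ τ) =
    pull₂ a σ ≫ pull₂ a τ := Bicategory.whiskerLeft_comp _ _ _

theorem pullAssoc_naturality (a : G' ⟶ G) {r s : G ⟶ X} (σ : r ⟶ s) (f : X ⟶ Y) : pull₂ a σ ▷ f ≫
    (pullAssoc a s f).hom = (pullAssoc a r f).hom ≫ pull₂ a (σ ▷ f) :=
  Bicategory.associator_naturality_middle _ _ _

theorem pullAssoc_naturality_assoc (a : G' ⟶ G) {r s : G ⟶ X} (σ : r ⟶ s) (f : X ⟶ Y)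
    {q : G' ⟶ Y} (τ : pull a (s ≫ f) ⟶ q) :
    pull₂ a σ ▷ f ≫ (pullAssoc a s f).hom ≫ τ =
      (pullAssoc a r f).hom ≫ pull₂ a (σ ▷ f) ≫ τ := by
  rw [← Category.assoc, pullAssoc_naturality, Category.assoc]

/-- Reindexing of 2-cells, with identities removed. -/
class Pl (a : G' ⟶ G) {r s : G ⟶ X} (σ : r ⟶ s) (υ : outParam (pull a r ⟶ pull a s)) : Prop where
  eq : pull₂ a σ = υ

instance (priority := low) (a : G' ⟶ G) {r s : G ⟶ X} (σ : r ⟶ s) : Pl a σ (pull₂ a σ) := ⟨rfl⟩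
instance (a : G' ⟶ G) (r : G ⟶ X) : Pl a (𝟙 r) (𝟙 _) := ⟨by simp⟩

/-- Whiskering on the right, with identities removed. -/
class Wr {r s : G ⟶ X} (σ : r ⟶ s) (h : X ⟶ Y) (υ : outParam (r ≫ h ⟶ s ≫ h)) : Prop where
  eq : σ ▷ h = υ

instance (priority := low) {r s : G ⟶ X} (σ : r ⟶ s) (h : X ⟶ Y) : Wr σ h (σ ▷ h) := ⟨rfl⟩
instance (r : G ⟶ X) (h : X ⟶ Y) : Wr (𝟙 r) h (𝟙 _) := ⟨by simp⟩

/-- The value `e` is a reindexing of `d`. -/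
class Pull (a : G' ⟶ G) {U : G ⟶ X} {f : X ⟶ Y} {r : G ⟶ Y} (e : pull a U ≫ f ≅ pull a r)
    (d : outParam (U ≫ f ≅ r)) : Prop where
  eq : e = pre a d

/-- The reindexing of the value `d` is `e`, distributed over composites. -/
class Push (a : G' ⟶ G) {U : G ⟶ X} {f : X ⟶ Y} {r : G ⟶ Y} (d : U ≫ f ≅ r)
    (e : outParam (pull a U ≫ f ≅ pull a r)) : Prop where
  eq : pre a d = e

instance (priority := low) (a : G' ⟶ G) {U : G ⟶ X} {f : X ⟶ Y} {r : G ⟶ Y} (d : U ≫ f ≅ r) :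
    Push a d (pre a d) := ⟨rfl⟩

/-- A coherence fact that allows a value to be reindexed factor by factor, so that the result again
has the shape on which the evaluation rules match. -/
theorem pre_evc (a : G' ⟶ G) {U : G ⟶ X} {f : X ⟶ Y} {r : G ⟶ Y} {g : Y ⟶ Z} {q : G ⟶ Z}
    (e₁ : U ≫ f ≅ r) (e₂ : r ≫ g ≅ q) :
   pre a (evc e₁ e₂) = evc (pre a e₁) (pre a e₂) := by
  ext; simp [pre, evc, pull]

instance (a : G' ⟶ G) {U : G ⟶ X} {f : X ⟶ Y} {r : G ⟶ Y} {g : Y ⟶ Z} {q : G ⟶ Z} (e₁ : U ≫ f ≅ r)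
    (e₂ : r ≫ g ≅ q)
   (d₁ : pull a U ≫ f ≅ pull a r) (d₂ : pull a r ≫ g ≅ pull a q) [Push a e₁ d₁] [Push a e₂ d₂] :
       Push a (evc e₁ e₂) (evc d₁ d₂) := ⟨by
  rw [pre_evc, Push.eq (e := d₁), Push.eq (e := d₂)]⟩

instance (a : G' ⟶ G) {U : G ⟶ X} {f : X ⟶ Y} {r : G ⟶ Y} (d : U ≫ f ≅ r) : Pull a (pre a d) d :=
    ⟨rfl⟩

instance (a : G' ⟶ G) {U : G ⟶ X} {f : X ⟶ Y} {r : G ⟶ Y} {g : Y ⟶ Z} {q : G ⟶ Z} (e₁ : U ≫ f ≅ r)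
    (e₂ : r ≫ g ≅ q)
   (d₁ : pull a U ≫ f ≅ pull a r) (d₂ : pull a r ≫ g ≅ pull a q) [Pull a d₁ e₁] [Pull a d₂ e₂] :
       Pull a (evc d₁ d₂) (evc e₁ e₂) := ⟨by
  rw [pre_evc, Pull.eq (e := d₁), Pull.eq (e := d₂)]⟩

/-- d is the right unitor -/
class IsEvi {r : G ⟶ X} (d : r ≫ 𝟙 X ≅ r) : Prop where
  eq : d = ρ_ r

instance (U : G ⟶ X) : IsEvi (evi U) := ⟨rfl⟩
instance (a : G' ⟶ G) (U : G ⟶ X) (d : U ≫ 𝟙 X ≅ U) [IsEvi d] : IsEvi (pre a d) := ⟨by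
  rw [IsEvi.eq (d := d)]; ext; simp [pre, pull]⟩

/-- `d` is the chosen value of the identity at `r`. -/
class Evi (r : G ⟶ X) (d : outParam (r ≫ 𝟙 X ≅ r)) : Prop where
  eq : d = ρ_ r

instance (priority := low) (U : G ⟶ X) : Evi U (evi U) := ⟨rfl⟩

/-- The comparison of a value `e` with the composite, in normal form. -/
class Atom (s : G ⟶ X) (h : X ⟶ Y) {q : outParam (G ⟶ Y)} (e : outParam (s ≫ h ≅ q))
    (c : outParam (s ≫ h ⟶ q)) : Prop where
  eq : e.hom = c

instance (priority := low) (s : G ⟶ X) (h : X ⟶ Y) : Atom s h (evAtom s h) (𝟙 _) := ⟨rfl⟩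
-- At a reindexed element the chosen value is the reindexed value rather than the bare composite.
-- The difference is recorded by `pullAssoc`; this is where the `pullAssoc` factors in later
-- equations come from.
instance (a : G' ⟶ G) (s : G ⟶ X) (h : X ⟶ Y) {q : G ⟶ Y} (e : s ≫ h ≅ q) (c : s ≫ h ⟶ q)
    (c' : pull a (s ≫ h) ⟶ pull a q) [E : Atom s h e c]
    [P : Pl a c c'] (c'' : pull a s ≫ h ⟶ pull a q) [C : Cmp (pullAssoc a s h).hom c' c''] :
        Atom (pull a s) h (pre a e) c'' := ⟨by
  rw [pre_hom, E.eq, ← C.eq, ← P.eq]; rfl⟩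

section
variable {U : G ⟶ X} {f g h : X ⟶ Y} {r s t : G ⟶ Y}

instance evId (e : U ≫ f ≅ r) : Ev e (𝟙 f) e (𝟙 r) := ⟨by simp⟩
instance evComp (e : U ≫ f ≅ r) (σ : f ⟶ g) (e' : U ≫ g ≅ s) (τ : r ⟶ s) [E : Ev e σ e' τ]
    (σ' : g ⟶ h) (e'' : U ≫ h ≅ t) (τ' : s ⟶ t) [E' : Ev e' σ' e'' τ']
   (υ : r ⟶ t) [C : Cmp τ τ' υ] : Ev e (σ ≫ σ') e'' υ := ⟨by
   rw [← C.eq, ← Category.assoc, E.eq, Category.assoc, E'.eq, Bicategory.whiskerLeft_comp,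
       Category.assoc]⟩

/-- By the exchange law, `k` can be evaluated first and `σ` then evaluated at the resulting element.
-/
instance evWhiskerLeft {k : W ⟶ X} {u : G ⟶ X} {V : G ⟶ W} (e₁ : V ≫ k ≅ u) (e : u ≫ f ≅ r)
    (σ : f ⟶ g) (e' : u ≫ g ≅ s) (τ : r ⟶ s) [E : Ev e σ e' τ] :
   Ev (evc e₁ e) (k ◁ σ) (evc e₁ e') τ := ⟨by
   rw [evc_hom, Category.assoc, Category.assoc, E.eq, ← whisker_exchange_assoc]
   simp [evc_hom]⟩

/-- The value of `σ` changes the element at which `k` is evaluated; `Wh` supplies the resulting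
change of the value of `k`. -/
instance evWhiskerRight {k : Y ⟶ W} {q q' : G ⟶ W} (e : U ≫ f ≅ r) (d : r ≫ k ≅ q) (σ : f ⟶ g)
    (e' : U ≫ g ≅ s) (τ : r ⟶ s) [E : Ev e σ e' τ]
   (d' : s ≫ k ≅ q') (θ : q ⟶ q') [F : Wh d τ d' θ] :
   Ev (evc e d) (σ ▷ k) (evc e' d') θ := ⟨by
   simp only [evc_hom, Category.assoc, F.eq, ← comp_whiskerRight_assoc, E.eq]
   simp ⟩

instance evLeftUnitorHom (d : U ≫ 𝟙 X ≅ U) [D : IsEvi d] (e : U ≫ f ≅ r) : Ev (evc d e) (λ_ f).hom e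
    (𝟙 r) := ⟨by rw [D.eq]; simp [evc_hom]⟩

instance evLeftUnitorInv (d : U ≫ 𝟙 X ≅ U) [D : Evi U d] (e : U ≫ f ≅ r) : Ev e (λ_ f).inv (evc d e)
    (𝟙 r) := ⟨by rw [D.eq]; simp [evc_hom]⟩

instance evRightUnitorHom (d : r ≫ 𝟙 Y ≅ r) [D : IsEvi d] (e : U ≫ f ≅ r) : Ev (evc e d)
    (ρ_ f).hom e (𝟙 r) := ⟨by rw [D.eq]; simp [evc_hom]⟩

instance evRightUnitorInv (d : r ≫ 𝟙 Y ≅ r) [D : Evi r d] (e : U ≫ f ≅ r) : Ev e (ρ_ f).inv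
    (evc e d) (𝟙 r) := ⟨by rw [D.eq]; simp [evc_hom]⟩

/-- Both bracketings are evaluated one factor at a time from the left and so have the same value;
the associator becomes an identity. -/
instance evAssocHom {k : Y ⟶ Z} {l : Z ⟶ W} {q : G ⟶ Z} {p : G ⟶ W} (e₁ : U ≫ f ≅ r)
    (e₂ : r ≫ k ≅ q) (e₃ : q ≫ l ≅ p) :
   Ev (evc (evc e₁ e₂) e₃) (α_ f k l).hom (evc e₁ (evc e₂ e₃)) (𝟙 _) := ⟨by simp [evc_hom]⟩

instance evAssocInv {k : Y ⟶ Z} {l : Z ⟶ W} {q : G ⟶ Z} {p : G ⟶ W} (e₁ : U ≫ f ≅ r)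
    (e₂ : r ≫ k ≅ q) (e₃ : q ≫ l ≅ p) :
   Ev (evc e₁ (evc e₂ e₃)) (α_ f k l).inv (evc (evc e₁ e₂) e₃) (𝟙 _) := ⟨by simp [evc_hom]⟩

theorem ev_pre (a : G' ⟶ G) (e : U ≫ f ≅ r) (σ : f ⟶ g) (e' : U ≫ g ≅ s) (τ : r ⟶ s)
    [E : Ev e σ e' τ] : Ev (pre a e) σ (pre a e') (pull₂ a τ) := ⟨by
  change ((α_ a U f).hom ≫ a ◁ e.hom) ≫ a ◁ τ = (a ≫ U) ◁ σ ≫ (α_ a U g).hom ≫ a ◁ e'.hom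
  rw [Category.assoc, ← Bicategory.whiskerLeft_comp, E.eq]
  simp⟩

theorem ev_symm {A B : M} {R : A ⟶ B} {C : M} {f g : B ⟶ C} {r : A ⟶ C} {e : R ≫ f ≅ r}
    {e' : R ≫ g ≅ r} {σ : f ≅ g} (E : Ev e σ.hom e' (𝟙 r)) : Ev e' σ.inv e (𝟙 r) := ⟨by
  have := E.eq
  rw [Category.comp_id] at this ⊢
  rw [this, ← Bicategory.whiskerLeft_comp_assoc]
  simp⟩

/-- The fallback rule: strip a common reindexing, evaluate, and reindex the result. Its low priority
leaves precedence to rules that match the 2-cell itself. -/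
instance (priority := low) evPre (a : G' ⟶ G) (e₀ : pull a U ≫ f ≅ pull a r) (e : U ≫ f ≅ r)
    [P : Pull a e₀ e] (σ : f ⟶ g) (e' : U ≫ g ≅ s) (τ : r ⟶ s) [E : Ev e σ e' τ]
    (e₀' : pull a U ≫ g ≅ pull a s) [Q : Push a e' e₀'] (τ' : pull a r ⟶ pull a s) [R : Pl a τ τ'] :
        Ev e₀ σ e₀' τ' := by
  rw [P.eq, ← Q.eq, ← R.eq]
  exact ev_pre a e σ e' τ
end

section
variable {r s t : G ⟶ X} {h : X ⟶ Y}

instance whId {q : G ⟶ Y} (d : r ≫ h ≅ q) : Wh d (𝟙 r) d (𝟙 q) := ⟨by simp⟩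
instance whAtom (σ : r ⟶ s) {q : G ⟶ Y} (e : s ≫ h ≅ q) (c : s ≫ h ⟶ q) [A : Atom s h e c]
    (τ : r ≫ h ⟶ s ≫ h) [B : Wr σ h τ] (υ : r ≫ h ⟶ q) [C : Cmp τ c υ] :
   Wh (evAtom r h) σ e υ := ⟨by rw [← C.eq, ← A.eq, ← B.eq]; simp [evAtom]⟩

instance whEvi (σ : r ⟶ s) (d : r ≫ 𝟙 X ≅ r) [D : IsEvi d] (d' : s ≫ 𝟙 X ≅ s) [D' : Evi s d'] :
    Wh d σ d' σ := ⟨by rw [D.eq, D'.eq]; simp⟩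

instance whComp {q q' : G ⟶ Y} (d : r ≫ h ≅ q) (σ : r ⟶ s) (d' : s ≫ h ≅ q') (τ : q ⟶ q')
    [E : Wh d σ d' τ] (σ' : s ⟶ t) {q'' : G ⟶ Y} (d'' : t ≫ h ≅ q'') (τ' : q' ⟶ q'')
    [E' : Wh d' σ' d'' τ']
   (υ : q ⟶ q'') [C : Cmp τ τ' υ] : Wh d (σ ≫ σ') d'' υ := ⟨by
   rw [← C.eq, ← Category.assoc, E.eq, Category.assoc, E'.eq, Bicategory.comp_whiskerRight,
       Category.assoc]⟩

instance whEvc {q q' : G ⟶ Y} (d : r ≫ h ≅ q) (σ : r ⟶ s) (d' : s ≫ h ≅ q') (τ : q ⟶ q')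
    [E : Wh d σ d' τ]
  {k : Y ⟶ Z} {u u' : G ⟶ Z} (c : q ≫ k ≅ u) (c' : q' ≫ k ≅ u') (υ : u ⟶ u') [E' : Wh c τ c' υ] :
      Wh (evc d c) σ (evc d' c') υ := ⟨by
  rw [evc_hom, Category.assoc, Category.assoc, E'.eq, ← comp_whiskerRight_assoc, E.eq]; simp
      [evc_hom]⟩

theorem wh_pre (a : G' ⟶ G) {q q' : G ⟶ Y} (d : r ≫ h ≅ q) (σ : r ⟶ s) (d' : s ≫ h ≅ q')
    (τ : q ⟶ q') [E : Wh d σ d' τ] :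
  Wh (pre a d) (pull₂ a σ) (pre a d') (pull₂ a τ) := ⟨by
  change ((α_ a r h).hom ≫ a ◁ d.hom) ≫ a ◁ τ = (a ◁ σ) ▷ h ≫ (α_ a s h).hom ≫ a ◁ d'.hom
  rw [Category.assoc, ← Bicategory.whiskerLeft_comp, E.eq]
  simp⟩

instance (priority := low) whPre (a : G' ⟶ G) {q q' : G ⟶ Y} (d₀ : pull a r ≫ h ≅ pull a q)
    (d : r ≫ h ≅ q) [P : Pull a d₀ d] (σ : r ⟶ s) (d' : s ≫ h ≅ q') (τ : q ⟶ q') [E : Wh d σ d' τ]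
  (d₀' : pull a s ≫ h ≅ pull a q') [Q : Push a d' d₀'] (τ' : pull a q ⟶ pull a q')
      [R : Pl a τ τ']  :
  Wh d₀ (pull₂ a σ) d₀' τ' := by
  rw [P.eq, ← Q.eq, ← R.eq]
  exact wh_pre a d σ d' τ
end
end

/-! ### Evaluation through the tensor product and its constraints. -/

section
variable {M : Type u} [Bicategory.{w, v} M] [TensorBicategory M]

variable {G H K X Y Z X' Y' Z' X'' Y'' Z'' : M}

/-- Tensor of 2-cells, with identities removed. -/
class Tn {f f' : G ⟶ X} {g g' : H ⟶ Y} (σ : f ⟶ f') (τ : g ⟶ g')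
    (υ : outParam (f ⊠₁ g ⟶ f' ⊠₁ g')) : Prop where
  eq : σ ⊠₂ τ = υ

instance (priority := low) {f f' : G ⟶ X} {g g' : H ⟶ Y} (σ : f ⟶ f') (τ : g ⟶ g') :
    Tn σ τ (σ ⊠₂ τ) := ⟨rfl⟩

instance {f : G ⟶ X} {g : H ⟶ Y} : Tn (𝟙 f) (𝟙 g) (𝟙 _) := ⟨by simp⟩

/-- The value of a tensor product of morphisms. -/
def evt {U : G ⟶ X} {f : X ⟶ X'} {r : G ⟶ X'} {V : H ⟶ Y} {g : Y ⟶ Y'} {s : H ⟶ Y'} (e₁ : U ≫ f ≅ r)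
    (e₂ : V ≫ g ≅ s) :
  U ⊠₁ V ≫ f ⊠₁ g ≅ r ⊠₁ s := (tensorComp U f V g).symm ≪≫ tensorIso e₁ e₂

/-- The value of the associativity constraint. -/
def eva (U : G ⟶ X) (V : H ⟶ Y) (W : K ⟶ Z) : (U ⊠₁ V) ⊠₁ W ≫ aHom X Y Z ≅ pull (aHom G H K)
    (U ⊠₁ (V ⊠₁ W)) := aNat U V W

/-- The value of the left unit constraint. -/
def evl (U : G ⟶ X) : 𝟙 (TensorBicategory.unit : M) ⊠₁ U ≫ lHom X ≅ pull (lHom G) U := lNat U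

/-- The value of the right unit constraint. -/
def evr (U : G ⟶ X) : U ≫ rHom X ≅ pull (rHom G) (U ⊠₁ 𝟙 (TensorBicategory.unit : M)) := rNat U

theorem evt_hom {U : G ⟶ X} {f : X ⟶ X'} {r : G ⟶ X'} {V : H ⟶ Y} {g : Y ⟶ Y'} {s : H ⟶ Y'}
    (e₁ : U ≫ f ≅ r) (e₂ : V ≫ g ≅ s) :
  (evt e₁ e₂).hom = (tensorComp U f V g).inv ≫ (e₁.hom ⊠₂ e₂.hom) := rfl

theorem tensorComp_whisker_left' {f : X ⟶ X'} {f' f'' : X' ⟶ X''} {g : Y ⟶ Y'} {g' g'' : Y' ⟶ Y''}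
    (σ : f' ⟶ f'') (τ : g' ⟶ g'') :
    f ⊠₁ g ◁ (σ ⊠₂ τ) ≫ (tensorComp f f'' g g'').inv = (tensorComp f f' g g').inv ≫
        ((f ◁ σ) ⊠₂ (g ◁ τ)) := by
  rw [Iso.comp_inv_eq, Category.assoc, tensorComp_whisker_left, Iso.inv_hom_id_assoc]

theorem tensorComp_whisker_right' {f f₁ : X ⟶ X'} (f' : X' ⟶ X'') {g g₁ : Y ⟶ Y'} (g' : Y' ⟶ Y'')
    (σ : f ⟶ f₁) (τ : g ⟶ g₁) :
    (σ ⊠₂ τ) ▷ f' ⊠₁ g' ≫ (tensorComp f₁ f' g₁ g').inv = (tensorComp f f' g g').inv ≫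
        ((σ ▷ f') ⊠₂ (τ ▷ g')) := by
  rw [Iso.comp_inv_eq, Category.assoc, tensorComp_whisker_right, Iso.inv_hom_id_assoc]

section
variable {U : G ⟶ X} {V : H ⟶ Y} {f f' : X ⟶ X'} {g g' : Y ⟶ Y'} {r r' : G ⟶ X'} {s s' : H ⟶ Y'}

instance evTensor (e₁ : U ≫ f ≅ r) (σ : f ⟶ f') (e₁' : U ≫ f' ≅ r') (σ' : r ⟶ r')
    [E₁ : Ev e₁ σ e₁' σ']
  (e₂ : V ≫ g ≅ s) (τ : g ⟶ g') (e₂' : V ≫ g' ≅ s') (τ' : s ⟶ s') [E₂ : Ev e₂ τ e₂' τ']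
      (υ : r ⊠₁ s ⟶ r' ⊠₁ s') [T : Tn σ' τ' υ] :
  Ev (evt e₁ e₂) (σ ⊠₂ τ) (evt e₁' e₂') υ := ⟨by
  rw [← T.eq, evt_hom, evt_hom, Category.assoc, tensorHom₂_comp, E₁.eq, E₂.eq, ← tensorHom₂_comp,
      ← Category.assoc, ← Category.assoc, tensorComp_whisker_left']⟩

/-- This is the associativity law `tensorComp_assoc` of the pseudofunctor: with tensor products
evaluated in each factor separately, functoriality becomes invisible. -/
instance evTensorCompHom {h : X' ⟶ X''} {k : Y' ⟶ Y''} {p : G ⟶ X''} {q : H ⟶ Y''} (e₁ : U ≫ f ≅ r)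
    (e₂ : V ≫ g ≅ s) (d₁ : r ≫ h ≅ p) (d₂ : s ≫ k ≅ q) :
  Ev (evt (evc e₁ d₁) (evc e₂ d₂)) (tensorComp f h g k).hom (evc (evt e₁ e₂) (evt d₁ d₂)) (𝟙 _) :=
      ⟨by
  have h₁ : (tensorComp U (f ≫ h) V (g ≫ k)).inv ≫ ((α_ U f h).inv ⊠₂ (α_ V g k).inv) =
      U ⊠₁ V ◁ (tensorComp f h g k).hom ≫ (α_ _ _ _).inv ≫ (tensorComp U f V g).inv ▷ h ⊠₁ k ≫
        (tensorComp (U ≫ f) h (V ≫ g) k).inv := by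
    have := tensorComp_assoc U f h V g k
    rw [← tensorIso_hom, ← Iso.eq_inv_comp] at this
    rw [← tensorIso_inv, Iso.inv_comp_eq, reassoc_of% this]
    simp
  rw [evt_hom, evc_hom, evc_hom, evc_hom, Category.comp_id, ← tensorHom₂_comp, reassoc_of% h₁,
    ← tensorHom₂_comp, ← Category.assoc (tensorComp (U ≫ f) h (V ≫ g) k).inv,
    ← tensorComp_whisker_right', evt_hom, evt_hom]
  simp⟩

instance evTensorCompInv {h : X' ⟶ X''} {k : Y' ⟶ Y''} {p : G ⟶ X''} {q : H ⟶ Y''} (e₁ : U ≫ f ≅ r)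
    (e₂ : V ≫ g ≅ s) (d₁ : r ≫ h ≅ p) (d₂ : s ≫ k ≅ q) :
  Ev (evc (evt e₁ e₂) (evt d₁ d₂)) (tensorComp f h g k).inv (evt (evc e₁ d₁) (evc e₂ d₂)) (𝟙 _) :=
  ev_symm (evTensorCompHom e₁ e₂ d₁ d₂)

instance evTensorIdHom (d₁ : U ≫ 𝟙 X ≅ U) (d₂ : V ≫ 𝟙 Y ≅ V) [D₁ : IsEvi d₁] [D₂ : IsEvi d₂] :
  Ev (evt d₁ d₂) (tensorId X Y).hom (evi (U ⊠₁ V)) (𝟙 _) := ⟨by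
  rw [D₁.eq, D₂.eq, evt_hom]
  rw [tensorComp_id_right]
  simp [evi]⟩

instance evTensorIdInv (d₁ : U ≫ 𝟙 X ≅ U) (d₂ : V ≫ 𝟙 Y ≅ V) [D₁ : Evi U d₁] [D₂ : Evi V d₂]
    (d : U ⊠₁ V ≫ 𝟙 (X ⊠ Y) ≅ U ⊠₁ V) [D : IsEvi d] :
  Ev d (tensorId X Y).inv (evt d₁ d₂) (𝟙 _) := by
  have : IsEvi d₁ := ⟨D₁.eq⟩
  have : IsEvi d₂ := ⟨D₂.eq⟩
  rw [D.eq]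
  exact ev_symm (evTensorIdHom d₁ d₂)
end

instance whTensor {f f' : G ⟶ X} {g g' : H ⟶ Y} {h : X ⟶ X'} {k : Y ⟶ Y'} {r r' : G ⟶ X'}
    {s s' : H ⟶ Y'}
  (d₁ : f ≫ h ≅ r) (σ : f ⟶ f') (d₁' : f' ≫ h ≅ r') (σ' : r ⟶ r') [E₁ : Wh d₁ σ d₁' σ']
  (d₂ : g ≫ k ≅ s) (τ : g ⟶ g') (d₂' : g' ≫ k ≅ s') (τ' : s ⟶ s') [E₂ : Wh d₂ τ d₂' τ']
      (υ : r ⊠₁ s ⟶ r' ⊠₁ s') [T : Tn σ' τ' υ] :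
  Wh (evt d₁ d₂) (σ ⊠₂ τ) (evt d₁' d₂') υ := ⟨by
  rw [← T.eq, evt_hom, evt_hom, Category.assoc, tensorHom₂_comp, E₁.eq, E₂.eq, ← tensorHom₂_comp,
      ← Category.assoc, ← Category.assoc, tensorComp_whisker_right']⟩

section
variable {U : G ⟶ X} {V : H ⟶ Y} {W : K ⟶ Z} {f : X ⟶ X'} {g : Y ⟶ Y'} {h : Z ⟶ Z'} {r : G ⟶ X'}
    {s : H ⟶ Y'} {t : K ⟶ Z'}

/-- The composition law `aNat_comp` for `U, V, W` followed by `f, g, h`. The constraint `a` moves in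
front of all elements and survives only as a reindexing. -/
instance evAssocNatHom (e₁ : U ≫ f ≅ r) (e₂ : V ≫ g ≅ s) (e₃ : W ≫ h ≅ t) :
  Ev (evc (evt (evt e₁ e₂) e₃) (eva r s t)) (aNat f g h).hom
      (evc (eva U V W) (pre (aHom G H K) (evt e₁ (evt e₂ e₃)))) (𝟙 _) := ⟨by
  have hQ : (aHom G H K ◁ ((𝟙 (U ≫ f) ⊠₂ (tensorComp V g W h).hom) ≫
      (tensorComp U f (V ⊠₁ W) (g ⊠₁ h)).hom)) ≫
      aHom G H K ◁ ((tensorComp U f (V ⊠₁ W) (g ⊠₁ h)).inv ≫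
          (𝟙 (U ≫ f) ⊠₂ (tensorComp V g W h).inv)) = 𝟙 _ := by
    rw [← Bicategory.whiskerLeft_comp]; simp
  have hP : ((tensorComp (U ⊠₁ V) (f ⊠₁ g) W h).inv ≫
      ((tensorComp U f V g).inv ⊠₂ 𝟙 (W ≫ h))) ▷ aHom X' Y' Z' ≫
      (((tensorComp U f V g).hom ⊠₂ 𝟙 (W ≫ h)) ≫ (tensorComp (U ⊠₁ V) (f ⊠₁ g) W h).hom) ▷ aHom X'
          Y' Z' = 𝟙 _ := by
    rw [← Bicategory.comp_whiskerRight, Category.assoc, tensorHom₂_comp_assoc]; simp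
  -- Multiplying `aNat_comp` by inverse tensor constraints on both sides isolates the constraint of
  -- the composite; `hP` and `hQ` do the cancelling.
  have h₁ := congrArg (fun k =>
      ((tensorComp (U ⊠₁ V) (f ⊠₁ g) W h).inv ≫ ((tensorComp U f V g).inv ⊠₂ 𝟙 (W ≫ h))) ▷ aHom X'
      Y' Z' ≫
    k ≫ aHom G H K ◁ ((tensorComp U f (V ⊠₁ W) (g ⊠₁ h)).inv ≫
        (𝟙 (U ≫ f) ⊠₂ (tensorComp V g W h).inv))) (aNat_comp U V W f g h)
  simp only [Category.assoc, hQ, reassoc_of% hP, Category.comp_id] at h₁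
  change ((α_ _ _ _).inv ≫
      ((tensorComp (U ⊠₁ V) (f ⊠₁ g) W h).inv ≫
      (((tensorComp U f V g).inv ≫ (e₁.hom ⊠₂ e₂.hom)) ⊠₂ e₃.hom)) ▷ aHom X' Y' Z' ≫
    (aNat r s t).hom) ≫ 𝟙 (aHom G H K ≫ r ⊠₁ (s ⊠₁ t)) = (U ⊠₁ V) ⊠₁ W ◁ (aNat f g h).hom ≫
        (α_ _ _ _).inv ≫ (aNat U V W).hom ▷ f ⊠₁ (g ⊠₁ h) ≫ (α_ _ _ _).hom ≫
      aHom G H K ◁ ((tensorComp U f (V ⊠₁ W) (g ⊠₁ h)).inv ≫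
          (e₁.hom ⊠₂ ((tensorComp V g W h).inv ≫ (e₂.hom ⊠₂ e₃.hom))))
  have s₁ : ((tensorComp U f V g).inv ≫ (e₁.hom ⊠₂ e₂.hom)) ⊠₂ e₃.hom =
      ((tensorComp U f V g).inv ⊠₂ 𝟙 (W ≫ h)) ≫ ((e₁.hom ⊠₂ e₂.hom) ⊠₂ e₃.hom) := by
    rw [tensorHom₂_comp, Category.id_comp]
  have s₂ : e₁.hom ⊠₂ ((tensorComp V g W h).inv ≫ (e₂.hom ⊠₂ e₃.hom)) =
      (𝟙 (U ≫ f) ⊠₂ (tensorComp V g W h).inv) ≫ (e₁.hom ⊠₂ (e₂.hom ⊠₂ e₃.hom)) := by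
    rw [tensorHom₂_comp, Category.id_comp]
  rw [Category.comp_id, s₁, s₂, ← Category.assoc (tensorComp (U ⊠₁ V) (f ⊠₁ g) W h).inv,
      Bicategory.comp_whiskerRight, Category.assoc, aNat_naturality,
    ← Category.assoc _ (aNat _ _ _).hom, h₁, ← Category.assoc
        (tensorComp U f (V ⊠₁ W) (g ⊠₁ h)).inv, Bicategory.whiskerLeft_comp (aHom G H K) _
        (e₁.hom ⊠₂ (e₂.hom ⊠₂ e₃.hom))]
  simp only [Category.assoc, Iso.inv_hom_id_assoc]⟩

instance evLeftNatHom (e₁ : U ≫ f ≅ r) (d : 𝟙 (TensorBicategory.unit : M) ≫ 𝟙 _ ≅ 𝟙 _) [IsEvi d] :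
  Ev (evc (evt d e₁) (evl r)) (lNat f).hom (evc (evl U) (pre (lHom G) e₁)) (𝟙 _) := ⟨by
  rename_i D
  change ((α_ _ _ _).inv ≫ ((tensorComp (𝟙 _) (𝟙 _) U f).inv ≫ (d.hom ⊠₂ e₁.hom)) ▷ lHom X' ≫
      (lNat r).hom) ≫ 𝟙 (lHom G ≫ r) = (𝟙 (TensorBicategory.unit : M) ⊠₁ U) ◁ (lNat f).hom ≫
      (α_ _ _ _).inv ≫
    (lNat U).hom ▷ f ≫ (α_ _ _ _).hom ≫ lHom G ◁ e₁.hom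
  have s₁ : d.hom ⊠₂ e₁.hom = ((ρ_ (𝟙 (TensorBicategory.unit : M))).hom ⊠₂ 𝟙 (U ≫ f)) ≫
      (𝟙 _ ⊠₂ e₁.hom) := by
    rw [D.eq, tensorHom₂_comp]; simp
  rw [Category.comp_id, s₁, ← Category.assoc (tensorComp (𝟙 _) (𝟙 _) U f).inv,
      Bicategory.comp_whiskerRight, Category.assoc, lNat_naturality, lNat_comp]
  simp only [Category.assoc]
  rw [← Bicategory.comp_whiskerRight_assoc, Category.assoc, tensorHom₂_comp_assoc]
  simp⟩

instance evRightNatHom (e₁ : U ≫ f ≅ r) (d : 𝟙 (TensorBicategory.unit : M) ≫ 𝟙 _ ≅ 𝟙 _) [Evi _ d] :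
  Ev (evc e₁ (evr r)) (rNat f).hom (evc (evr U) (pre (rHom G) (evt e₁ d))) (𝟙 _) := ⟨by
  rename_i D
  change ((α_ _ _ _).inv ≫ e₁.hom ▷ rHom X' ≫ (rNat r).hom) ≫ 𝟙 (rHom G ≫ r ⊠₁ 𝟙 _) =
      U ◁ (rNat f).hom ≫ (α_ _ _ _).inv ≫ (rNat U).hom ▷ _ ≫ (α_ _ _ _).hom ≫
    rHom G ◁ ((tensorComp U f (𝟙 _) (𝟙 _)).inv ≫ (e₁.hom ⊠₂ d.hom))
  have s₁ : e₁.hom ⊠₂ d.hom = (𝟙 (U ≫ f) ⊠₂ (λ_ (𝟙 (TensorBicategory.unit : M))).hom) ≫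
      (e₁.hom ⊠₂ 𝟙 _) := by
    rw [D.eq, tensorHom₂_comp, Bicategory.unitors_equal]; simp
  have h₁ := rNat_comp U f
  have h₂ := congrArg (fun k => k ≫ rHom G ◁ ((tensorComp U f (𝟙 _) (𝟙 _)).inv ≫
      (𝟙 (U ≫ f) ⊠₂ (λ_ (𝟙 (TensorBicategory.unit : M))).hom))) h₁
  simp only [Category.assoc, ← Bicategory.whiskerLeft_comp, Iso.hom_inv_id_assoc, tensorHom₂_comp,
      Category.comp_id, Iso.inv_hom_id, tensorHom₂_id, Bicategory.whiskerLeft_id] at h₂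
  rw [Category.comp_id, rNat_naturality, h₂, s₁]
  simp only [Category.assoc, Iso.inv_hom_id_assoc, Bicategory.whiskerLeft_comp]⟩
end

end

section
variable {M : Type u} [Bicategory.{w, v} M]
variable {G X Y : M}

/-- The value of a 2-cell at a generalized element. -/
def evCell {U : G ⟶ X} {f g : X ⟶ Y} {r s : G ⟶ Y} (e : U ≫ f ≅ r) (σ : f ⟶ g) (e' : U ≫ g ≅ s) :
    r ⟶ s := e.inv ≫ U ◁ σ ≫ e'.hom

theorem evCell_spec {U : G ⟶ X} {f g : X ⟶ Y} {r s : G ⟶ Y} (e : U ≫ f ≅ r) (σ : f ⟶ g)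
    (e' : U ≫ g ≅ s) : Ev e σ e' (evCell e σ e') := ⟨by simp [evCell]⟩
end

section
variable {M : Type u} [Bicategory.{w, v} M] [TensorBicategory M]
variable {G H K L X Y Z X' Y' Z' X'' Y'' Z'' : M}

theorem rightMerge_inv (f : X ⟶ X') (g : X' ⟶ X'') (h : Y ⟶ Y') : (rightMerge f g h).inv =
    (𝟙 _ ⊠₂ (λ_ h).inv) ≫ (tensorComp f g (𝟙 Y) h).hom := rfl

theorem leftMerge_inv (f : X ⟶ X') (g : Y ⟶ Y') (h : Y' ⟶ Y'') : (leftMerge f g h).inv =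
    ((λ_ f).inv ⊠₂ 𝟙 _) ≫ (tensorComp (𝟙 X) f g h).hom := rfl
end

/-! ### Uniqueness, naturality and faithfulness of values. -/

section
variable {M : Type u} [Bicategory.{w, v} M]
variable {G H K X Y Z : M} {U U' : G ⟶ X} {f g : X ⟶ Y} {r s r' s' : G ⟶ Y}

/-- The comparison `e.hom` is invertible, so a 2-cell has only one value between given comparisons.
This turns an axiom into an equation between computed values at arbitrary elements. -/
theorem Ev.unique {e : U ≫ f ≅ r} {σ : f ⟶ g} {e' : U ≫ g ≅ s} {τ : r ⟶ s}
    {σ' : f ⟶ g} {τ' : r ⟶ s} (h : Ev e σ e' τ) (h' : Ev e σ' e' τ') (hs : σ = σ') : τ = τ' := by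
  subst hs
  rw [← cancel_epi e.hom, h.eq, h'.eq]

theorem Ev.eq_evCell {e : U ≫ f ≅ r} {σ : f ⟶ g} {e' : U ≫ g ≅ s} {τ : r ⟶ s} (h : Ev e σ e' τ) :
    evCell e σ e' = τ := by
  rw [evCell, ← h.eq, Iso.inv_hom_id_assoc]

/-- The interchange law transported along the comparisons. Naturality of the values of structure
2-cells, and their compatibility with the unit triangles, are instances of it. -/
theorem Ev.natural {e : U ≫ f ≅ r} {σ : f ⟶ g} {e' : U ≫ g ≅ s} {τ : r ⟶ s} (h : Ev e σ e' τ)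
    {d : U' ≫ f ≅ r'} {d' : U' ≫ g ≅ s'} {τ' : r' ⟶ s'} (h' : Ev d σ d' τ') {φ : U ⟶ U'}
    {θ : r ⟶ r'} {θ' : s ⟶ s'} (k : Wh e φ d θ) (k' : Wh e' φ d' θ') : τ ≫ θ' = θ ≫ τ' := by
  rw [← cancel_epi e.hom, ← Category.assoc, h.eq, Category.assoc, k'.eq, ← Category.assoc e.hom,
      k.eq,
    Category.assoc, h'.eq, whisker_exchange_assoc]

/-- Whiskering by `U` on the left is faithful. -/
class LeftFaithful (U : G ⟶ X) : Prop where
  eq_of_whisker : ∀ {Y : M} {f g : X ⟶ Y} {σ τ : f ⟶ g}, U ◁ σ = U ◁ τ → σ = τ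

instance : LeftFaithful (𝟙 X) := ⟨fun {_ _ _ σ τ} h => by
  simpa using h⟩

/-- Needed because the generic element of a tensor product is a tensor product of identities, which
is only isomorphic to an identity. -/
theorem LeftFaithful.of_iso {U V : G ⟶ X} (i : U ≅ V) [LeftFaithful V] : LeftFaithful U :=
  ⟨fun {Y f g σ τ} h => LeftFaithful.eq_of_whisker (U := V) (by
    rw [← cancel_epi (i.hom ▷ f), ← whisker_exchange, ← whisker_exchange, h])⟩

/-- The way back from values to 2-cells: at a generic element, equal values force equal 2-cells. -/
theorem Ev.injective [hU : LeftFaithful U] {e : U ≫ f ≅ r} {σ : f ⟶ g} {e' : U ≫ g ≅ s} {τ : r ⟶ s}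
    {σ' : f ⟶ g} {τ' : r ⟶ s} (h : Ev e σ e' τ) (h' : Ev e σ' e' τ') (hs : τ = τ') : σ = σ' := by
  subst hs
  apply LeftFaithful.eq_of_whisker (U := U)
  rw [← cancel_mono e'.hom, ← h.eq, ← h'.eq]

theorem Ev.isIso {e : U ≫ f ≅ r} {σ : f ⟶ g} {e' : U ≫ g ≅ s} {τ : r ⟶ s} (h : Ev e σ e' τ)
    [IsIso σ] : IsIso τ := by
  rw [← h.eq_evCell, evCell]; infer_instance

theorem Ev.inv {e : U ≫ f ≅ r} {σ : f ⟶ g} {e' : U ≫ g ≅ s} {τ : r ⟶ s} (h : Ev e σ e' τ)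
    [IsIso σ] [IsIso τ] : Ev e' (inv σ) e (inv τ) := ⟨by
  rw [IsIso.comp_inv_eq, Category.assoc, h.eq, ← Bicategory.whiskerLeft_comp_assoc]; simp⟩

theorem wh_of {h : X ⟶ Y} (d : U ≫ h ≅ r) (σ : U ⟶ U') (d' : U' ≫ h ≅ s) :
    Wh d σ d' (d.inv ≫ σ ▷ h ≫ d'.hom) := ⟨by simp⟩
end

/-! ### Reindexing inside a tensor product. -/

section
variable {M : Type u} [Bicategory.{w, v} M] [TensorBicategory M]
variable {G H K L X Y Z X' Y' Z' : M}

instance : LeftFaithful (𝟙 X ⊠₁ 𝟙 Y) := .of_iso (tensorId X Y)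
instance : LeftFaithful ((𝟙 X ⊠₁ 𝟙 Y) ⊠₁ 𝟙 Z) :=
  .of_iso (tensorIso (tensorId X Y) (Iso.refl _) ≪≫ tensorId _ _)

section
variable {U U' : G ⟶ X} {V V' : H ⟶ Y} {W W' : K ⟶ Z}

instance whEva (σ : U ⟶ U') (τ : V ⟶ V') (υ : W ⟶ W') :
    Wh (eva U V W) ((σ ⊠₂ τ) ⊠₂ υ) (eva U' V' W') (pull₂ _ (σ ⊠₂ (τ ⊠₂ υ))) :=
  ⟨(aNat_naturality σ τ υ).symm⟩

instance whEvl (σ : U ⟶ U') : Wh (evl U) (𝟙 _ ⊠₂ σ) (evl U') (pull₂ _ σ) :=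
  ⟨(lNat_naturality σ).symm⟩

instance whEvr (σ : U ⟶ U') : Wh (evr U) σ (evr U') (pull₂ _ (σ ⊠₂ 𝟙 _)) :=
  ⟨(rNat_naturality σ).symm⟩

/-- Moving `(b ⊗ 1)` out of the first factor. -/
def pullTen (b : L ⟶ G) (U : G ⟶ X) (V : H ⟶ Y) : pull b U ⊠₁ V ≅ pull (b ▷ₜ H) (U ⊠₁ V) :=
  (rightMerge b U V).symm

/-- Associativity of the tensor constraint once more, now for reindexing on the left of the
elements. The two one-sided forms that follow serve to move `r` and `ℓ` out of a single tensor
factor. -/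
theorem tensorComp_evt (b : L ⟶ G) (c : K ⟶ H) {u : X ⟶ X'} {v : Y ⟶ Y'} {r : G ⟶ X'} {s : H ⟶ Y'}
    (d : U ≫ u ≅ r) (d' : V ≫ v ≅ s) :
    (evt (α_ b U u ≪≫ whiskerLeftIso b d) (α_ c V v ≪≫ whiskerLeftIso c d')).hom ≫
      (tensorComp b r c s).hom =
    (tensorComp b U c V).hom ▷ (u ⊠₁ v) ≫ (α_ _ _ _).hom ≫ (b ⊠₁ c) ◁ (evt d d').hom := by
  have h₁ := tensorComp_assoc b U u c V v
  have h₂ : (tensorComp (b ≫ U) u (c ≫ V) v).inv ≫ ((α_ b U u).hom ⊠₂ (α_ c V v).hom) ≫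
      (tensorComp b (U ≫ u) c (V ≫ v)).hom = (tensorComp b U c V).hom ▷ _ ≫
      (α_ _ _ _).hom ≫ b ⊠₁ c ◁ (tensorComp U u V v).inv := by
    rw [Iso.inv_comp_eq, ← cancel_mono (b ⊠₁ c ◁ (tensorComp U u V v).hom)]
    simp only [Category.assoc, h₁, ← Bicategory.whiskerLeft_comp, Iso.inv_hom_id]
    simp
  have h₃ := tensorComp_whisker_left b c d.hom d'.hom
  simp only [evt_hom, Iso.trans_hom, whiskerLeftIso_hom, Bicategory.whiskerLeft_comp,
    ← tensorHom₂_comp, Category.assoc, h₃]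
  rw [reassoc_of% h₂]

theorem rightMerge_evt (b : L ⟶ G) {u : X ⟶ X'} {v : Y ⟶ Y'} {r : G ⟶ X'} {s : H ⟶ Y'}
    (d : U ≫ u ≅ r) (d' : V ≫ v ≅ s) :
    (evt (α_ b U u ≪≫ whiskerLeftIso b d) d').hom ≫ (rightMerge b r s).inv =
    (rightMerge b U V).inv ▷ (u ⊠₁ v) ≫ (α_ _ _ _).hom ≫ (b ▷ₜ H) ◁ (evt d d').hom := by
  have h := tensorComp_evt b (𝟙 H) d d'
  have h₄ := tensorComp_whisker_right' u v (𝟙 (b ≫ U)) (λ_ V).inv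
  simp only [evt_hom, rightMerge_inv, comp_whiskerRight, Category.assoc] at h ⊢
  rw [← h, reassoc_of% h₄]
  simp only [tensorHom₂_comp_assoc]
  simp

theorem leftMerge_evt (b : L ⟶ H) {u : X ⟶ X'} {v : Y ⟶ Y'} {r : G ⟶ X'} {s : H ⟶ Y'}
    (d : U ≫ u ≅ r) (d' : V ≫ v ≅ s) :
    (evt d (α_ b V v ≪≫ whiskerLeftIso b d')).hom ≫ (leftMerge r b s).inv =
    (leftMerge U b V).inv ▷ (u ⊠₁ v) ≫ (α_ _ _ _).hom ≫ (G ◁ₜ b) ◁ (evt d d').hom := by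
  have h := tensorComp_evt (𝟙 G) b d d'
  have h₄ := tensorComp_whisker_right' u v (λ_ U).inv (𝟙 (b ≫ V))
  simp only [evt_hom, leftMerge_inv, comp_whiskerRight, Category.assoc] at h ⊢
  rw [← h, reassoc_of% h₄]
  simp only [tensorHom₂_comp_assoc]
  simp

theorem rightMerge_inv_naturality (b : L ⟶ G) (σ : U ⟶ U') (τ : V ⟶ V') :
    ((b ◁ σ) ⊠₂ τ) ≫ (rightMerge b U' V').inv = (rightMerge b U V).inv ≫ (b ▷ₜ H) ◁ (σ ⊠₂ τ) := by
  have h := tensorComp_whisker_left b (𝟙 H) σ τ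
  simp only [rightMerge_inv, Category.assoc]
  rw [← h]
  simp only [tensorHom₂_comp_assoc]
  simp

theorem leftMerge_inv_naturality (b : L ⟶ H) (σ : U ⟶ U') (τ : V ⟶ V') :
    (σ ⊠₂ (b ◁ τ)) ≫ (leftMerge U' b V').inv = (leftMerge U b V).inv ≫ (G ◁ₜ b) ◁ (σ ⊠₂ τ) := by
  have h := tensorComp_whisker_left (𝟙 G) b σ τ
  simp only [leftMerge_inv, Category.assoc]
  rw [← h]
  simp only [tensorHom₂_comp_assoc]
  simp

theorem pullTen_naturality (b : L ⟶ G) (σ : U ⟶ U') (τ : V ⟶ V') :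
    (pull₂ b σ ⊠₂ τ) ≫ (pullTen b U' V').hom = (pullTen b U V).hom ≫ pull₂ _ (σ ⊠₂ τ) :=
  rightMerge_inv_naturality b σ τ

theorem whPullTen (b : L ⟶ G) {u : X ⟶ X'} {v : Y ⟶ Y'} {r : G ⟶ X'} {s : H ⟶ Y'}
    (d : U ≫ u ≅ r) (d' : V ≫ v ≅ s) :
    Wh (evt (pre b d) d') (pullTen b U V).hom (pre _ (evt d d')) (pullTen b r s).hom :=
  ⟨rightMerge_evt b d d'⟩
end
end

/-! ### Evaluation of long pastings. -/

section
variable {M : Type u} [Bicategory.{w, v} M] {G X Y : M}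

/-- Peels off the first factor, whose value is found by instance search; the rest is then evaluated
from the target `e'` just computed. Repeated application looks through `⊗≫` and evaluates a pasting
from its source to its target. -/
theorem Ev.next {U : G ⟶ X} {f g h : X ⟶ Y} {r s t : G ⟶ Y} {e : U ≫ f ≅ r} {σ : f ⟶ g}
    {e' : U ≫ g ≅ s} {τ : r ⟶ s} {σ' : g ⟶ h} {e'' : U ≫ h ≅ t} {τ' : s ⟶ t} [E : Ev e σ e' τ]
    (E' : Ev e' σ' e'' τ') : Ev e (σ ≫ σ') e'' (τ ≫ τ') :=
  evComp e σ e' τ σ' e'' τ' _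
end

section
variable {M : Type u} [Bicategory.{w, v} M] {G X Y Z W : M} {U : G ⟶ X}

/-! Evaluation of the coherence isomorphisms hidden in `⊗≫`. -/

instance {f g h k : X ⟶ Y} [C : BicategoricalCoherence g h] {r s : G ⟶ Y} (e : U ≫ f ≅ r)
    (σ : f ⟶ g) (σ' : h ⟶ k) (e' : U ≫ k ≅ s) (τ : r ⟶ s)
    [E : Ev e (σ ≫ C.iso.hom ≫ σ') e' τ] : Ev e (σ ⊗≫ σ') e' τ := E

instance (f : X ⟶ Y) {r s : G ⟶ Y} (e : U ≫ f ≅ r)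
    (e' : U ≫ f ≅ s) (τ : r ⟶ s) [E : Ev e (𝟙 f) e' τ] :
    Ev e (BicategoricalCoherence.refl f).iso.hom e' τ := E

instance (f : X ⟶ Y) (g h : Y ⟶ Z) [C : BicategoricalCoherence g h] {r s : G ⟶ Z}
    (e : U ≫ f ≫ g ≅ r)
    (e' : U ≫ f ≫ h ≅ s) (τ : r ⟶ s) [E : Ev e (f ◁ C.iso.hom) e' τ] :
    Ev e (BicategoricalCoherence.whiskerLeft f g h).iso.hom e' τ := E

instance (f g : X ⟶ Y) (h : Y ⟶ Z) [C : BicategoricalCoherence f g] {r s : G ⟶ Z}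
    (e : U ≫ f ≫ h ≅ r)
    (e' : U ≫ g ≫ h ≅ s) (τ : r ⟶ s) [E : Ev e (C.iso.hom ▷ h) e' τ] :
    Ev e (BicategoricalCoherence.whiskerRight f g h).iso.hom e' τ := E

instance (f g : X ⟶ Y) [C : BicategoricalCoherence f g] {r s : G ⟶ Y} (e : U ≫ 𝟙 X ≫ f ≅ r)
    (e' : U ≫ g ≅ s) (τ : r ⟶ s) [E : Ev e ((λ_ f).hom ≫ C.iso.hom) e' τ] :
    Ev e (BicategoricalCoherence.left f g).iso.hom e' τ := E

instance (f g : X ⟶ Y) [C : BicategoricalCoherence f g] {r s : G ⟶ Y} (e : U ≫ f ≅ r)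
    (e' : U ≫ 𝟙 X ≫ g ≅ s) (τ : r ⟶ s) [E : Ev e (C.iso.hom ≫ (λ_ g).inv) e' τ] :
    Ev e (BicategoricalCoherence.left' f g).iso.hom e' τ := E

instance (f g : X ⟶ Y) [C : BicategoricalCoherence f g] {r s : G ⟶ Y} (e : U ≫ f ≅ r)
    (e' : U ≫ g ≫ 𝟙 Y ≅ s) (τ : r ⟶ s) [E : Ev e (C.iso.hom ≫ (ρ_ g).inv) e' τ] :
    Ev e (BicategoricalCoherence.right' f g).iso.hom e' τ := E

instance (f : X ⟶ Y) (g : Y ⟶ Z) (h : Z ⟶ W) (i : X ⟶ W) [C : BicategoricalCoherence (f ≫ g ≫ h) i]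
    {r s : G ⟶ W} (e : U ≫ (f ≫ g) ≫ h ≅ r)
    (e' : U ≫ i ≅ s) (τ : r ⟶ s) [E : Ev e ((α_ f g h).hom ≫ C.iso.hom) e' τ] :
    Ev e (BicategoricalCoherence.assoc f g h i).iso.hom e' τ := E

instance (f : X ⟶ Y) (g : Y ⟶ Z) (h : Z ⟶ W) (i : X ⟶ W) [C : BicategoricalCoherence i (f ≫ g ≫ h)]
    {r s : G ⟶ W} (e : U ≫ i ≅ r)
    (e' : U ≫ (f ≫ g) ≫ h ≅ s) (τ : r ⟶ s) [E : Ev e (C.iso.hom ≫ (α_ f g h).inv) e' τ] :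
    Ev e (BicategoricalCoherence.assoc' f g h i).iso.hom e' τ := E

end

section
variable {M : Type u} [Bicategory.{w, v} M] [TensorBicategory M] {G X X' X'' Y Y' Y'' : M}

/-- This and the following rules unfold the merging, splitting and interchange isomorphisms into
functoriality constraints and unitors, and `aNatLeft` into `tensorId` and `aNat`; all of these have
rules already. -/
instance (f : X ⟶ X') (g : X' ⟶ X'') (h : Y ⟶ Y') {U : G ⟶ X ⊠ Y}
    {r s : G ⟶ X'' ⊠ Y'} (e : U ≫ f ▷ₜ Y ≫ g ⊠₁ h ≅ r) (e' : U ≫ (f ≫ g) ⊠₁ h ≅ s) (τ : r ⟶ s)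
    [E : Ev e ((tensorComp f g (𝟙 Y) h).inv ≫ (𝟙 _ ⊠₂ (λ_ h).hom)) e' τ] :
    Ev e (rightMerge f g h).hom e' τ := E

instance (f : X ⟶ X') (g : X' ⟶ X'') (h : Y ⟶ Y') {U : G ⟶ X ⊠ Y}
    {r s : G ⟶ X'' ⊠ Y'} (e : U ≫ (f ≫ g) ⊠₁ h ≅ r) (e' : U ≫ f ▷ₜ Y ≫ g ⊠₁ h ≅ s) (τ : r ⟶ s)
    [E : Ev e ((𝟙 _ ⊠₂ (λ_ h).inv) ≫ (tensorComp f g (𝟙 Y) h).hom) e' τ] :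
    Ev e (rightMerge f g h).inv e' τ := E

instance (f : X ⟶ X') (g : X' ⟶ X'') (h : Y ⟶ Y') {U : G ⟶ X ⊠ Y}
    {r s : G ⟶ X'' ⊠ Y'} (e : U ≫ (f ≫ g) ⊠₁ h ≅ r) (e' : U ≫ f ⊠₁ h ≫ g ▷ₜ Y' ≅ s) (τ : r ⟶ s)
    [E : Ev e ((𝟙 _ ⊠₂ (ρ_ h).inv) ≫ (tensorComp f g h (𝟙 Y')).hom) e' τ] :
    Ev e (mergeRight f g h).inv e' τ := E

instance (f : X ⟶ X') (g : Y ⟶ Y') (h : Y' ⟶ Y'') {U : G ⟶ X ⊠ Y}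
    {r s : G ⟶ X' ⊠ Y''} (e : U ≫ X ◁ₜ g ≫ f ⊠₁ h ≅ r) (e' : U ≫ f ⊠₁ (g ≫ h) ≅ s) (τ : r ⟶ s)
    [E : Ev e ((tensorComp (𝟙 X) f g h).inv ≫ ((λ_ f).hom ⊠₂ 𝟙 _)) e' τ] :
    Ev e (leftMerge f g h).hom e' τ := E

instance (f : X ⟶ X') (g : Y ⟶ Y') (h : Y' ⟶ Y'') {U : G ⟶ X ⊠ Y}
    {r s : G ⟶ X' ⊠ Y''} (e : U ≫ f ⊠₁ (g ≫ h) ≅ r) (e' : U ≫ X ◁ₜ g ≫ f ⊠₁ h ≅ s) (τ : r ⟶ s)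
    [E : Ev e (((λ_ f).inv ⊠₂ 𝟙 _) ≫ (tensorComp (𝟙 X) f g h).hom) e' τ] :
    Ev e (leftMerge f g h).inv e' τ := E

instance (f : X ⟶ X') (g : Y ⟶ Y') (h : Y' ⟶ Y'') {U : G ⟶ X ⊠ Y}
    {r s : G ⟶ X' ⊠ Y''} (e : U ≫ f ⊠₁ g ≫ X' ◁ₜ h ≅ r) (e' : U ≫ f ⊠₁ (g ≫ h) ≅ s) (τ : r ⟶ s)
    [E : Ev e ((tensorComp f (𝟙 X') g h).inv ≫ ((ρ_ f).hom ⊠₂ 𝟙 _)) e' τ] :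
    Ev e (mergeLeft f g h).hom e' τ := E

instance (f : X ⟶ X') (g : Y ⟶ Y') (h : Y' ⟶ Y'') {U : G ⟶ X ⊠ Y}
    {r s : G ⟶ X' ⊠ Y''} (e : U ≫ f ⊠₁ (g ≫ h) ≅ r) (e' : U ≫ f ⊠₁ g ≫ X' ◁ₜ h ≅ s) (τ : r ⟶ s)
    [E : Ev e (((ρ_ f).inv ⊠₂ 𝟙 _) ≫ (tensorComp f (𝟙 X') g h).hom) e' τ] :
    Ev e (mergeLeft f g h).inv e' τ := E

instance (f : X ⟶ X') (g : Y ⟶ Y') {U : G ⟶ X ⊠ Y}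
    {r s : G ⟶ X' ⊠ Y'} (e : U ≫ f ▷ₜ Y ≫ X' ◁ₜ g ≅ r) (e' : U ≫ f ⊠₁ g ≅ s) (τ : r ⟶ s)
    [E : Ev e ((tensorComp f (𝟙 X') (𝟙 Y) g).inv ≫ ((ρ_ f).hom ⊠₂ (λ_ g).hom)) e' τ] :
    Ev e (splitRL f g).inv e' τ := E

instance (f : X ⟶ X') (g : Y ⟶ Y') {U : G ⟶ X ⊠ Y}
    {r s : G ⟶ X' ⊠ Y'} (e : U ≫ f ⊠₁ g ≅ r) (e' : U ≫ X ◁ₜ g ≫ f ▷ₜ Y' ≅ s) (τ : r ⟶ s)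
    [E : Ev e (((λ_ f).inv ⊠₂ (ρ_ g).inv) ≫ (tensorComp (𝟙 X) f g (𝟙 Y')).hom) e' τ] :
    Ev e (splitLR f g).hom e' τ := E

instance (f : X ⟶ X') (g : Y ⟶ Y') {U : G ⟶ X ⊠ Y}
    {r s : G ⟶ X' ⊠ Y'} (e : U ≫ f ▷ₜ Y ≫ X' ◁ₜ g ≅ r) (e' : U ≫ X ◁ₜ g ≫ f ▷ₜ Y' ≅ s) (τ : r ⟶ s)
    [E : Ev e ((splitRL f g).inv ≫ (splitLR f g).hom) e' τ] :
    Ev e (interchange f g).hom e' τ := E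

instance (X Y : M) {Z Z' : M} (h : Z ⟶ Z') {U : G ⟶ (X ⊠ Y) ⊠ Z}
    {r s : G ⟶ X ⊠ (Y ⊠ Z')} (e : U ≫ (X ⊠ Y) ◁ₜ h ≫ aHom X Y Z' ≅ r)
        (e' : U ≫ aHom X Y Z ≫ X ◁ₜ (Y ◁ₜ h) ≅ s) (τ : r ⟶ s)
    [E : Ev e (((tensorId X Y).inv ⊠₂ 𝟙 h) ▷ aHom X Y Z' ≫ (aNat (𝟙 X) (𝟙 Y) h).hom) e' τ] :
    Ev e (aNatLeft X Y h).hom e' τ := E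

end

/-! ### Identity laws of `ℓ` and `r`, and evaluation of `r ⊗ 1`. -/

section
variable {M : Type u} [Bicategory.{w, v} M] [TensorBicategory M]
variable {G H K L X Y Z X' Y' Z' X'' Y'' : M}

/-- The pseudofunctor made from `Prod.sectR` carries its identity constraint as an `eqToIso`, which
must be recognised as trivial before the identity law of `ℓ` is usable. -/
theorem sectR_comp_mapId (X : M) : ((Prod.sectR TensorBicategory.unit M).toPseudofunctor.comp
    TensorBicategory.tensor).mapId X = tensorId TensorBicategory.unit X := by
  ext
  have h := (Prod.sectR (TensorBicategory.unit : M) M).mapId_eq_eqToIso X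
  simp only [Pseudofunctor.comp_mapId, h]
  change (TensorBicategory.tensor.map₂Iso (Iso.refl (𝟙 ((TensorBicategory.unit, X) : M × M))) ≪≫
      _).hom = _
  have h₁ : TensorBicategory.tensor.map₂ (𝟙 (𝟙 ((TensorBicategory.unit, X) : M × M))) = 𝟙 _ :=
      PrelaxFunctor.map₂_id _ _
  exact (congrArg (fun k => k ≫ _) h₁).trans (Category.id_comp _)

theorem sectL_comp_mapId (X : M) : ((Prod.sectL M TensorBicategory.unit).toPseudofunctor.comp
    TensorBicategory.tensor).mapId X = tensorId X TensorBicategory.unit := by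
  ext
  have h := (Prod.sectL M (TensorBicategory.unit : M)).mapId_eq_eqToIso X
  simp only [Pseudofunctor.comp_mapId, h]
  change (TensorBicategory.tensor.map₂Iso (Iso.refl (𝟙 ((X, TensorBicategory.unit) : M × M))) ≪≫
      _).hom = _
  have h₁ : TensorBicategory.tensor.map₂ (𝟙 (𝟙 ((X, TensorBicategory.unit) : M × M))) = 𝟙 _ :=
      PrelaxFunctor.map₂_id _ _
  exact (congrArg (fun k => k ≫ _) h₁).trans (Category.id_comp _)

theorem lNat_id (X : M) : (lNat (𝟙 X)).hom =
    (tensorId TensorBicategory.unit X).hom ▷ lHom X ≫ (λ_ _).hom ≫ (ρ_ _).inv := by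
  have e := TensorBicategory.leftUnit.naturality_id X
  rw [sectR_comp_mapId] at e
  have e' : (lNat (𝟙 X)).hom ≫ lHom X ◁ 𝟙 (𝟙 X) = (tensorId TensorBicategory.unit X).hom ▷ lHom X ≫
      (λ_ _).hom ≫ (ρ_ _).inv := e
  simpa using e'

theorem rNat_id (X : M) : (rNat (𝟙 X)).hom ≫ rHom X ◁ (tensorId X TensorBicategory.unit).hom =
    (λ_ _).hom ≫ (ρ_ _).inv := by
  have e := TensorBicategory.rightUnit.naturality_id X
  rw [sectL_comp_mapId] at e
  have e' : (rNat (𝟙 X)).hom ≫ rHom X ◁ (tensorId X TensorBicategory.unit).hom =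
      (𝟙 (𝟙 X)) ▷ rHom X ≫ (λ_ _).hom ≫ (ρ_ _).inv := e
  simpa using e'

/-- Evaluation of `r ⊗ 1`. -/
def evrL (U : G ⟶ X) (V : H ⟶ Y) :
    U ⊠₁ V ≫ rHom X ▷ₜ Y ≅ pull (rHom G ▷ₜ H) ((U ⊠₁ 𝟙 (TensorBicategory.unit : M)) ⊠₁ V) :=
  evt (evr U) (evi V) ≪≫ pullTen _ _ _

/-- The value of `r` in the first factor is a reindexing of that factor alone. It has to be moved
outside the tensor product, so the value here is `pullTen` and not an identity; the high priority
makes this rule win over `evTensorCompHom`. -/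
instance (priority := high) evTensorCompRho {U : G ⟶ X} {V : H ⟶ Y}
    {f : X ⊠ TensorBicategory.unit ⟶ X'}
    {g : Y ⟶ Y'} {r : G ⊠ TensorBicategory.unit ⟶ X'} {s : H ⟶ Y'}
    (d₁₀ : pull (rHom G) (U ⊠₁ 𝟙 _) ≫ f ≅ pull (rHom G) r) (d₁ : U ⊠₁ 𝟙 _ ≫ f ≅ r)
    [P : Pull (rHom G) d₁₀ d₁] (d' : V ≫ 𝟙 Y ≅ V) [D : IsEvi d'] (d₂ : V ≫ g ≅ s) :
    Ev (evt (evc (evr U) d₁₀) (evc d' d₂)) (tensorComp (rHom X) f (𝟙 Y) g).hom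
      (evc (evrL U V) (pre (rHom G ▷ₜ H) (evt d₁ d₂))) (pullTen (rHom G) r s).hom := ⟨by
  have h := (evTensorCompHom (evr U) d' d₁₀ d₂).eq
  have h' := (whPullTen (rHom G) d₁ d₂).eq
  rw [Category.comp_id] at h
  rw [h, P.eq, Category.assoc]
  congr 1
  rw [evc_hom, evc_hom, Category.assoc, Category.assoc, h', evrL, Iso.trans_hom, comp_whiskerRight,
    Category.assoc, evi, D.eq]⟩

end

/-! ### The unit triangles as isomorphisms between generalized elements. -/

section
variable {M : Type u} [Bicategory.{w, v} M] {G H K X Y Z : M}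

/-- Interchange of `R` with `d`, with the associators placed as they occur when `R` is a unit
triangle. -/
theorem whisker_cell {r : G ⟶ H} {a : H ⟶ K} {c : G ⟶ K} (R : r ≫ a ⟶ c) {U : K ⟶ X} {f : X ⟶ Y}
    {q : K ⟶ Y} (d : U ≫ f ⟶ q) :
    (α_ r (a ≫ U) f).hom ≫ r ◁ (α_ a U f).hom ≫ r ◁ a ◁ d ≫ (α_ r a q).inv ≫ R ▷ q =
      (α_ r a U).inv ▷ f ≫ R ▷ U ▷ f ≫ (α_ c U f).hom ≫ c ◁ d := by
  have h : R ▷ U ▷ f ≫ (α_ c U f).hom ≫ c ◁ d = (α_ (r ≫ a) U f).hom ≫ (r ≫ a) ◁ d ≫ R ▷ q := by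
    rw [whisker_exchange]; simp
  rw [h]; simp

theorem whisker_cell₃ {r : G ⟶ H} {a : H ⟶ K} {b : K ⟶ Z} {c : G ⟶ Z} (R : r ≫ a ≫ b ⟶ c)
    {U : Z ⟶ X}
    {W : K ⟶ X} (m : W ⟶ b ≫ U) {f : X ⟶ Y} {q : Z ⟶ Y} (d : U ≫ f ⟶ q) :
    (α_ r (a ≫ W) f).hom ≫ r ◁ (α_ a W f).hom ≫ r ◁ a ◁ m ▷ f ≫ r ◁ a ◁ (α_ b U f).hom ≫
      r ◁ a ◁ b ◁ d ≫ r ◁ (α_ a b q).inv ≫ (α_ r (a ≫ b) q).inv ≫ R ▷ q =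
      (r ◁ a ◁ m) ▷ f ≫ (r ◁ (α_ a b U).inv) ▷ f ≫ (α_ r (a ≫ b) U).inv ▷ f ≫ R ▷ U ▷ f ≫
        (α_ c U f).hom ≫ c ◁ d := by
  have h : R ▷ U ▷ f ≫ (α_ c U f).hom ≫ c ◁ d = (α_ (r ≫ a ≫ b) U f).hom ≫
      (r ≫ a ≫ b) ◁ d ≫ R ▷ q := by
    rw [whisker_exchange]; simp
  rw [h]; bicategory
end

section
variable {M : Type u} [Bicategory.{w, v} M] [MonoidalBicategory M]
variable {G H K L X Y Z X' Y' Z' X'' Y'' : M}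

/-- The isomorphism `U ⊗ (Q r) ≅ (U ⊗ Q) a r` given by the right unit triangle. -/
def rightIso (U : G ⟶ X) (Q : H ⊠ unitObj M ⟶ Y) :
    pull (rHom (G ⊠ H)) (pull (aHom G H (unitObj M)) (U ⊠₁ Q)) ≅ U ⊠₁ pull (rHom H) Q :=
  (α_ _ _ _).symm ≪≫ whiskerRightIso (MonoidalBicategory.right G H) _ ≪≫ leftMerge U (rHom H) Q

/-- The isomorphism `(U ⊗ V ℓ) a (r ⊗ 1) ≅ U ⊗ V` given by the middle unit triangle. -/
def midIso (U : G ⟶ X) (V : H ⟶ Y) :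
    pull (rHom G ▷ₜ H) (pull (aHom G (unitObj M) H) (U ⊠₁ pull (lHom H) V)) ≅ U ⊠₁ V :=
  whiskerLeftIso _ (whiskerLeftIso _ (leftMerge U (lHom H) V).symm) ≪≫
    whiskerLeftIso _ (α_ _ _ _).symm ≪≫ (α_ _ _ _).symm ≪≫
      whiskerRightIso (MonoidalBicategory.mid G H) _ ≪≫ λ_ _

/-- The isomorphism `Q ℓ r ≅ Q` on the unit object. -/
noncomputable def rlIso (Q : unitObj M ⟶ X) : pull (rHom (unitObj M)) (pull (lHom (unitObj M)) Q) ≅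
    Q :=
  (α_ _ _ _).symm ≪≫ whiskerRightIso (rlUnitIso M) _ ≪≫ λ_ _

theorem rightIso_hom_naturality {U U' : G ⟶ X} {Q Q' : H ⊠ unitObj M ⟶ Y} (σ : U ⟶ U')
    (τ : Q ⟶ Q') :
    pull₂ _ (pull₂ _ (σ ⊠₂ τ)) ≫ (rightIso U' Q').hom =
      (rightIso U Q).hom ≫ (σ ⊠₂ pull₂ _ τ) := by
  have h := leftMerge_inv_naturality (rHom H) σ τ
  rw [Iso.eq_inv_comp, ← Category.assoc, Iso.comp_inv_eq] at h
  change rHom (G ⊠ H) ◁ (aHom G H (unitObj M) ◁ (σ ⊠₂ τ)) ≫ (α_ _ _ _).inv ≫ _ ▷ _ ≫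
    (leftMerge U' (rHom H) Q').hom = ((α_ _ _ _).inv ≫ _ ▷ _ ≫ (leftMerge U (rHom H) Q).hom) ≫
      (σ ⊠₂ (rHom H ◁ τ))
  rw [Category.assoc, Category.assoc, h]
  rw [← whisker_exchange_assoc]
  simp

theorem rlIso_hom_naturality {Q Q' : unitObj M ⟶ X} (τ : Q ⟶ Q') :
    pull₂ _ (pull₂ _ τ) ≫ (rlIso Q').hom = (rlIso Q).hom ≫ τ := by
  change _ ◁ (_ ◁ τ) ≫ (α_ _ _ _).inv ≫ _ ▷ _ ≫ (λ_ _).hom = ((α_ _ _ _).inv ≫ _ ▷ _ ≫ (λ_ _).hom) ≫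
      τ
  rw [Category.assoc, Category.assoc, ← leftUnitor_naturality, ← whisker_exchange_assoc]
  simp

section
variable {U : G ⟶ X} {V : H ⟶ Y} {f : X ⟶ X'} {g : Y ⟶ Y'} {r : G ⟶ X'} {s : H ⟶ Y'}

/-- The triangle acts on the domains of the elements and `f ⊗ g` on their codomains, so the two
operations commute by interchange. The next two lemmas have the same reason. -/
theorem wh_rightIso {Q : H ⊠ unitObj M ⟶ Y} {q : H ⊠ unitObj M ⟶ Y'} (d₁ : U ≫ f ≅ r)
    (d₂ : Q ≫ g ≅ q) :
    Wh (pre (rHom (G ⊠ H)) (pre (aHom G H (unitObj M)) (evt d₁ d₂))) (rightIso U Q).hom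
      (evt d₁ (pre (rHom H) d₂)) (rightIso r q).hom := ⟨by
  have h := leftMerge_evt (rHom H) d₁ d₂
  rw [Iso.comp_inv_eq, Category.assoc, Category.assoc] at h
  change ((α_ (rHom (G ⊠ H)) (aHom G H (unitObj M) ≫ U ⊠₁ Q) _).hom ≫
      _ ◁ ((α_ (aHom G H (unitObj M)) (U ⊠₁ Q) _).hom ≫ _ ◁ (evt d₁ d₂).hom)) ≫
    (α_ _ _ _).inv ≫ (MonoidalBicategory.right G H).hom ▷ _ ≫ (leftMerge r (rHom H) q).hom =
    ((α_ _ _ _).inv ≫ (MonoidalBicategory.right G H).hom ▷ _ ≫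
        (leftMerge U (rHom H) Q).hom) ▷ f ⊠₁ g ≫ (evt d₁ (α_ _ _ _ ≪≫ whiskerLeftIso _ d₂)).hom
  rw [h]
  have k := whisker_cell (MonoidalBicategory.right G H).hom (evt d₁ d₂).hom
  simp only [comp_whiskerRight, Category.assoc, hom_inv_whiskerRight_assoc,
      Bicategory.whiskerLeft_comp]
  simpa only [Category.assoc] using congrArg (fun x => x ≫ (leftMerge r (rHom H) q).hom) k⟩

theorem wh_midIso (d₁ : U ≫ f ≅ r) (d₂ : V ≫ g ≅ s) :
    Wh (pre (rHom G ▷ₜ H) (pre (aHom G (unitObj M) H) (evt d₁ (pre (lHom H) d₂)))) (midIso U V).hom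
      (evt d₁ d₂) (midIso r s).hom := ⟨by
  have h := leftMerge_evt (lHom H) d₁ d₂
  change ((α_ (rHom G ▷ₜ H) (aHom G (unitObj M) H ≫ U ⊠₁ (lHom H ≫ V)) _).hom ≫
      _ ◁ ((α_ (aHom G (unitObj M) H) (U ⊠₁ (lHom H ≫ V)) _).hom ≫
      _ ◁ (evt d₁ (α_ _ _ _ ≪≫ whiskerLeftIso _ d₂)).hom)) ≫
    (rHom G ▷ₜ H) ◁ (aHom G (unitObj M) H ◁ (leftMerge r (lHom H) s).inv) ≫ _ ◁ (α_ _ _ _).inv ≫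
        (α_ _ _ _).inv ≫ (MonoidalBicategory.mid G H).hom ▷ _ ≫ (λ_ _).hom =
    ((rHom G ▷ₜ H) ◁ (aHom G (unitObj M) H ◁ (leftMerge U (lHom H) V).inv) ≫ _ ◁ (α_ _ _ _).inv ≫
        (α_ _ _ _).inv ≫ (MonoidalBicategory.mid G H).hom ▷ _ ≫ (λ_ _).hom) ▷ f ⊠₁ g ≫
        (evt d₁ d₂).hom
  have k := whisker_cell₃ (MonoidalBicategory.mid G H).hom (leftMerge U (lHom H) V).inv
      (evt d₁ d₂).hom
  have h' := congrArg (fun x => (rHom G ▷ₜ H) ◁ (aHom G (unitObj M) H ◁ x)) h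
  simp only [Bicategory.whiskerLeft_comp] at h' k
  simp only [Category.assoc, Bicategory.whiskerLeft_comp, comp_whiskerRight]
  rw [reassoc_of% h']
  have k' := congrArg (fun x => x ≫ (λ_ _).hom) k
  simp only [Category.assoc] at k'
  refine k'.trans ?_
  simp⟩

theorem wh_rlIso {Q : unitObj M ⟶ Y} {q : unitObj M ⟶ Y'} (d₂ : Q ≫ g ≅ q) :
    Wh (pre _ (pre _ d₂)) (rlIso Q).hom d₂ (rlIso q).hom := ⟨by
  change ((α_ (rHom _) (lHom _ ≫ Q) _).hom ≫ _ ◁ ((α_ (lHom _) Q _).hom ≫ _ ◁ d₂.hom)) ≫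
    (α_ _ _ _).inv ≫ (rlUnitIso M).hom ▷ _ ≫ (λ_ _).hom =
    ((α_ _ _ _).inv ≫ (rlUnitIso M).hom ▷ _ ≫ (λ_ _).hom) ▷ g ≫ d₂.hom
  have k := congrArg (fun x => x ≫ (λ_ _).hom) (whisker_cell (rlUnitIso M).hom d₂.hom)
  simp only [Bicategory.whiskerLeft_comp, Category.assoc] at k ⊢
  refine k.trans ?_
  simp⟩
end

theorem comp_tensorHom₂_left {U U' : G ⟶ X} {V V' : H ⟶ Y} {P : G ⊠ H ⟶ X ⊠ Y} (π : P ⟶ U ⊠₁ V)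
    (σ : U ⟶ U') (τ : V ⟶ V') : π ≫ (σ ⊠₂ τ) = (π ≫ (σ ⊠₂ 𝟙 V)) ≫ (𝟙 U' ⊠₂ τ) := by
  simp

theorem comp_tensorHom₂_right {U U' : G ⟶ X} {V V' : H ⟶ Y} {P : G ⊠ H ⟶ X ⊠ Y} (π : P ⟶ U ⊠₁ V)
    (σ : U ⟶ U') (τ : V ⟶ V') : π ≫ (σ ⊠₂ τ) = (π ≫ (𝟙 U ⊠₂ τ)) ≫ (σ ⊠₂ 𝟙 V') := by
  simp

/-- The modification axiom `right_natural`: the triangle on the codomains `X, Y` is carried to the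
triangle on the domains `G, H`. -/
instance ev_right (U : G ⟶ X) (V : H ⟶ Y) :
    Ev (evc (evr (U ⊠₁ V)) (pre _ (eva U V (𝟙 (unitObj M))))) (MonoidalBicategory.right X Y).hom
      (evt (evi U) (evr V)) (rightIso U (V ⊠₁ 𝟙 (unitObj M))).hom := ⟨by
  have h := MonoidalBicategory.right_natural U V
  have e : (evt (evi U) (evr V)).hom = (mergeLeft U V (rHom Y)).hom ≫ (𝟙 U ⊠₂ (rNat V).hom) := by
    exact comp_tensorHom₂_left (tensorComp U (𝟙 X) V (rHom Y)).inv (ρ_ U).hom (rNat V).hom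
  have e' : (evc (evr (U ⊠₁ V)) (pre _ (eva U V (𝟙 (unitObj M))))).hom =
    (α_ _ _ _).inv ≫ (rNat (U ⊠₁ V)).hom ▷ aHom X Y (unitObj M) ≫
        (α_ _ _ _).hom ≫ rHom (G ⊠ H) ◁ (aNat U V (𝟙 (unitObj M))).hom := rfl
  have e'' : (rightIso U (V ⊠₁ 𝟙 (unitObj M))).hom = (α_ _ _ _).inv ≫
      (MonoidalBicategory.right G H).hom ▷ U ⊠₁ (V ▷ₜ unitObj M) ≫
      (leftMerge U (rHom H) (V ▷ₜ unitObj M)).hom := rfl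
  rw [e, e', e'']
  dsimp only [pull]
  simpa [bicategoricalComp] using h.symm⟩

/-- The modification axiom `mid_natural`, with the value of `r ⊗ 1` already moved outside the tensor
product. -/
instance ev_mid (U : G ⟶ X) (V : H ⟶ Y) :
    Ev (evc (evrL U V) (evc (pre _ (eva U (𝟙 (unitObj M)) V))
        (pre _ (pre _ (evt (evi U) (evl V))))))
       (MonoidalBicategory.mid X Y).hom
      (evi (U ⊠₁ V)) (midIso U V).hom := ⟨by
  have h := MonoidalBicategory.mid_natural U V
  have e : (evrL U V).hom = (mergeRight U (rHom X) V).hom ≫ ((rNat U).hom ⊠₂ 𝟙 V) ≫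
      (rightMerge (rHom G) (U ▷ₜ unitObj M) V).inv := by
    refine (congrArg (fun x => x ≫ (rightMerge (rHom G) (U ▷ₜ unitObj M) V).inv)
      (comp_tensorHom₂_right (tensorComp U (rHom X) V (𝟙 Y)).inv (rNat U).hom (ρ_ V).hom)).trans ?_
    exact Category.assoc _ _ _
  have e' : (evt (evi U) (evl V)).hom = (mergeLeft U (unitObj M ◁ₜ V) (lHom Y)).hom ≫
      (𝟙 U ⊠₂ (lNat V).hom) := by
    exact comp_tensorHom₂_left (tensorComp U (𝟙 X) (unitObj M ◁ₜ V) (lHom Y)).inv (ρ_ U).hom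
        (lNat V).hom
  change ((α_ _ _ _).inv ≫ (evrL U V).hom ▷ _ ≫
      ((α_ _ _ _).inv ≫ ((α_ _ _ _).hom ≫ _ ◁ (aNat U (𝟙 (unitObj M)) V).hom) ▷ _ ≫
    ((α_ _ (_ ≫ _) _).hom ≫ _ ◁ ((α_ _ _ _).hom ≫ _ ◁ (evt (evi U) (evl V)).hom)))) ≫
     _ ◁ _ ◁ (leftMerge U (lHom H) V).inv ≫ _ ◁ (α_ _ _ _).inv ≫ (α_ _ _ _).inv ≫
         (MonoidalBicategory.mid G H).hom ▷ _ ≫ (λ_ _).hom = _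
  rw [e, e']
  dsimp only [pull, evi]
  simpa [bicategoricalComp] using h.symm⟩

/-- The unit-unit axioms contain no variable, so the identity element of the unit object is enough,
and the identity laws `rNat_id` and `lNat_id` take the place of a modification axiom. -/
instance ev_rlUnit :
    Ev (evc (evr (𝟙 (unitObj M))) (pre (rHom _) (evl (𝟙 (unitObj M))))) (rlUnitIso M).hom
        (evi (𝟙 _)) (rlIso (𝟙 _)).hom := ⟨by
  change ((α_ _ _ _).inv ≫ (rNat (𝟙 (unitObj M))).hom ▷ _ ≫
      (α_ _ _ _).hom ≫ _ ◁ (lNat (𝟙 (unitObj M))).hom) ≫ (α_ _ _ _).inv ≫ (rlUnitIso M).hom ▷ _ ≫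
      (λ_ _).hom
     = _ ◁ _ ≫ (ρ_ _).hom
  have h' : (rNat (𝟙 (unitObj M))).hom ▷ lHom (unitObj M) ≫
      (rHom (unitObj M) ◁ (tensorId (unitObj M) (unitObj M)).hom) ▷ lHom (unitObj M) =
      (λ_ (rHom (unitObj M))).hom ▷ lHom (unitObj M) ≫ (ρ_ (rHom (unitObj M))).inv ▷ lHom
          (unitObj M) := by
    rw [← comp_whiskerRight, ← comp_whiskerRight]
    exact congrArg (fun x => x ▷ lHom (unitObj M)) (rNat_id (unitObj M))
  rw [lNat_id]
  have k : (rNat (𝟙 (unitObj M))).hom ▷ lHom (unitObj M) ≫ (α_ _ _ _).hom ≫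
      rHom (unitObj M) ◁ (tensorId (unitObj M) (unitObj M)).hom ▷ lHom (unitObj M) =
      (λ_ (rHom (unitObj M))).hom ▷ lHom (unitObj M) ≫ (ρ_ (rHom (unitObj M))).inv ▷ lHom
          (unitObj M) ≫ (α_ _ _ _).hom := by
    rw [← reassoc_of% h']
    simp
  simp
  rw [reassoc_of% k]
  simp⟩
end

/-! ### Skew monoidales and opmonoidal morphisms at generalized elements. -/

section
variable {M : Type u} [Bicategory.{w, v} M] [MonoidalBicategory M] {A B : LeftSkewMonoidale M}
variable {G H K L : M}

attribute [instance] wh_rightIso wh_midIso wh_rlIso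

namespace LeftSkewMonoidale
variable (A)

/-- The tensor product of generalized elements. -/
abbrev ten (X : G ⟶ A.obj) (Y : H ⟶ A.obj) : G ⊠ H ⟶ A.obj := X ⊠₁ Y ≫ A.p

/-- The tensor product of 2-cells between generalized elements. -/
def ten₂ {X X' : G ⟶ A.obj} {Y Y' : H ⟶ A.obj} (σ : X ⟶ X') (τ : Y ⟶ Y') :
    A.ten X Y ⟶ A.ten X' Y' := (σ ⊠₂ τ) ▷ A.p

@[simp] theorem ten₂_id (X : G ⟶ A.obj) (Y : H ⟶ A.obj) : A.ten₂ (𝟙 X) (𝟙 Y) = 𝟙 _ := by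
  simp [ten₂]

theorem ten₂_comp {X X' X'' : G ⟶ A.obj} {Y Y' Y'' : H ⟶ A.obj} (σ : X ⟶ X')
    (σ' : X' ⟶ X'') (τ : Y ⟶ Y') (τ' : Y' ⟶ Y'') :
    A.ten₂ σ τ ≫ A.ten₂ σ' τ' = A.ten₂ (σ ≫ σ') (τ ≫ τ') := by
  simp [ten₂, ← comp_whiskerRight]

theorem ten₂_comp_assoc {X X' X'' : G ⟶ A.obj} {Y Y' Y'' : H ⟶ A.obj} (σ : X ⟶ X')
    (σ' : X' ⟶ X'') (τ : Y ⟶ Y') (τ' : Y' ⟶ Y'') {Q : G ⊠ H ⟶ A.obj} (υ : A.ten X'' Y'' ⟶ Q) :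
    A.ten₂ σ τ ≫ A.ten₂ σ' τ' ≫ υ = A.ten₂ (σ ≫ σ') (τ ≫ τ') ≫ υ := by
  rw [← Category.assoc, ten₂_comp]

instance {X X' : G ⟶ A.obj} {Y Y' : H ⟶ A.obj} (σ : X ⟶ X') (τ : Y ⟶ Y') :
    Wr (σ ⊠₂ τ) A.p (A.ten₂ σ τ) := ⟨rfl⟩

/-- The associativity constraint at generalized elements. -/
def αF (X : G ⟶ A.obj) (Y : H ⟶ A.obj) (Z : K ⟶ A.obj) :
    A.ten (A.ten X Y) Z ⟶ pull (aHom G H K) (A.ten X (A.ten Y Z)) :=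
  evCell (evc (evt (evAtom (X ⊠₁ Y) A.p) (evi Z)) (evAtom _ A.p)) A.α
    (evc (eva X Y Z) (evc (pre _ (evt (evi X) (evAtom (Y ⊠₁ Z) A.p))) (pre _ (evAtom _ A.p))))

/-- The left unit constraint at a generalized element. -/
def lamF (Y : G ⟶ A.obj) : A.ten A.j Y ⟶ pull (lHom G) Y :=
  evCell (evc (evt (evid A.j) (evi Y)) (evAtom _ A.p)) A.lam (evl Y)

/-- The right unit constraint at a generalized element. -/
def rhoF (X : G ⟶ A.obj) : X ⟶ pull (rHom G) (A.ten X A.j) :=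
  evCell (evi X) A.rho
    (evc (evr X) (evc (pre _ (evt (evi X) (evid A.j))) (pre _ (evAtom _ A.p))))

/-- Moving `b ⊗ 1` out of a tensor product of generalized elements. -/
def pullTenP (b : L ⟶ G) (X : G ⟶ A.obj) (Y : H ⟶ A.obj) :
    A.ten (pull b X) Y ≅ pull (b ▷ₜ H) (A.ten X Y) :=
  whiskerRightIso (pullTen b X Y) A.p ≪≫ pullAssoc _ _ _

/-- `rightIso`, followed by the multiplication. -/
def rightIsoP (X : G ⟶ A.obj) (Q : H ⊠ unitObj M ⟶ A.obj) :
    pull (rHom (G ⊠ H)) (pull (aHom G H (unitObj M)) (A.ten X Q)) ≅ A.ten X (pull (rHom H) Q) :=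
  (pre _ (pre _ (evAtom _ A.p))).symm ≪≫ whiskerRightIso (rightIso X Q) A.p

/-- `midIso`, followed by the multiplication. -/
def midIsoP (X : G ⟶ A.obj) (Y : H ⟶ A.obj) :
    pull (rHom G ▷ₜ H) (pull (aHom G (unitObj M) H) (A.ten X (pull (lHom H) Y))) ≅ A.ten X Y :=
  (pre _ (pre _ (evAtom _ A.p))).symm ≪≫ whiskerRightIso (midIso X Y) A.p

end LeftSkewMonoidale

instance wh_rightIsoP (X : G ⟶ A.obj) (Q : H ⊠ unitObj M ⟶ A.obj) :
    Wh (pre _ (pre _ (evAtom _ A.p))) (rightIso X Q).hom (evAtom _ A.p) (A.rightIsoP X Q).hom := ⟨by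
  simp [LeftSkewMonoidale.rightIsoP, evAtom]⟩

instance wh_midIsoP (X : G ⟶ A.obj) (Y : H ⟶ A.obj) :
    Wh (pre _ (pre _ (evAtom _ A.p))) (midIso X Y).hom (evAtom _ A.p) (A.midIsoP X Y).hom := ⟨by
  simp [LeftSkewMonoidale.midIsoP, evAtom]⟩

instance wh_pullTenP (b : L ⟶ G) (X : G ⟶ A.obj) (Y : H ⟶ A.obj) :
    Wh (evAtom _ A.p) (pullTen b X Y).hom (pre _ (evAtom _ A.p)) (A.pullTenP b X Y).hom := ⟨by
  rw [pre_hom, evAtom_hom, evAtom_hom]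
  simp [LeftSkewMonoidale.pullTenP, pullAssoc, pull]
  rfl⟩

instance ev_α (X : G ⟶ A.obj) (Y : H ⟶ A.obj) (Z : K ⟶ A.obj) (d : X ≫ 𝟙 _ ≅ X) (d' : Z ≫ 𝟙 _ ≅ Z)
    [D : Evi X d] [D' : IsEvi d'] :
    Ev (evc (evt (evAtom (X ⊠₁ Y) A.p) d') (evAtom _ A.p)) A.α
      (evc (eva X Y Z) (evc (pre _ (evt d (evAtom (Y ⊠₁ Z) A.p))) (pre _ (evAtom _ A.p))))
          (A.αF X Y Z) := by
  rw [D.eq, D'.eq]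
  exact evCell_spec _ _ _

instance ev_lam (Y : G ⟶ A.obj) (d : Y ≫ 𝟙 _ ≅ Y) [D : IsEvi d] :
    Ev (evc (evt (evid A.j) d) (evAtom _ A.p)) A.lam (evl Y) (A.lamF Y) := by
  rw [D.eq]
  exact evCell_spec _ _ _

instance ev_rho (X : G ⟶ A.obj) (d d' : X ≫ 𝟙 _ ≅ X) [D : IsEvi d] [D' : Evi X d'] :
    Ev d A.rho (evc (evr X) (evc (pre _ (evt d' (evid A.j))) (pre _ (evAtom _ A.p)))) (A.rhoF X) :=
        by
  rw [D.eq, D'.eq]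
  exact evCell_spec _ _ _

namespace LeftSkewMonoidale

theorem middle_unitF (X : G ⟶ A.obj) (Z : H ⟶ A.obj) :
    A.ten₂ (A.rhoF X) (𝟙 Z) ≫ (A.pullTenP _ (A.ten X A.j) Z).hom ≫ pull₂ _ (A.αF X A.j Z) ≫
      pull₂ _ (pull₂ _ (A.ten₂ (𝟙 X) (A.lamF Z))) ≫ (A.midIsoP X Z).hom = 𝟙 (A.ten X Z) := by
  have h := A.middle_unit
  -- The two evaluations compute the values of the two sides of the axiom, and `h` identifies them;
  -- only identities remain to be removed. The other lemmas of this kind follow the same scheme.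
  have k := Ev.unique (U := X ⊠₁ Z) (e := evAtom _ A.p)
    (by (repeat apply Ev.next); infer_instance) (by (repeat apply Ev.next); infer_instance) h
  simpa only [Category.id_comp, Category.comp_id, Category.assoc, LeftSkewMonoidale.ten₂_id,
      id_whiskerRight, pull₂_id] using k

theorem right_unitF (X : G ⟶ A.obj) (Y : H ⟶ A.obj) :
    A.ten₂ (𝟙 X) (A.rhoF Y) =
      A.rhoF (A.ten X Y) ≫ pull₂ _ (A.αF X Y A.j) ≫ (A.rightIsoP X (A.ten Y A.j)).hom := by
  have h := A.right_unit
  have k := Ev.unique (U := X ⊠₁ Y) (e := evAtom _ A.p)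
    (by (repeat apply Ev.next); infer_instance) (by (repeat apply Ev.next); infer_instance) h
  simpa only [Category.id_comp, Category.comp_id, Category.assoc, LeftSkewMonoidale.ten₂_id,
      id_whiskerRight, pull₂_id] using k

theorem unit_unitF (A : LeftSkewMonoidale M) :
    A.rhoF A.j ≫ pull₂ _ (A.lamF A.j) ≫ (rlIso A.j).hom = 𝟙 A.j := by
  have h := A.unit_unit
  have k := Ev.unique (U := 𝟙 _) (e := evid A.j)
    (by (repeat apply Ev.next); infer_instance) (by (repeat apply Ev.next); infer_instance) h
  simpa only [Category.id_comp, Category.comp_id, Category.assoc, LeftSkewMonoidale.ten₂_id,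
      id_whiskerRight, pull₂_id] using k

end LeftSkewMonoidale

section
variable {t : A.obj ⟶ A.obj} {k : unitObj M ⟶ A.obj}

/-- A 2-cell `t p ⇒ p (t ⊗ t)` at generalized elements. -/
def psiF (ψ : A.p ≫ t ⟶ t ⊠₁ t ≫ A.p) (X : G ⟶ A.obj) (Y : H ⟶ A.obj) :
    A.ten X Y ≫ t ⟶ A.ten (X ≫ t) (Y ≫ t) :=
  evCell (evc (evAtom (X ⊠₁ Y) A.p) (evAtom _ t)) ψ
    (evc (evt (evAtom X t) (evAtom Y t)) (evAtom _ A.p))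

instance ev_psi (ψ : A.p ≫ t ⟶ t ⊠₁ t ≫ A.p) (X : G ⟶ A.obj) (Y : H ⟶ A.obj) :
    Ev (evc (evAtom (X ⊠₁ Y) A.p) (evAtom _ t)) ψ
      (evc (evt (evAtom X t) (evAtom Y t)) (evAtom _ A.p)) (psiF ψ X Y) :=
  evCell_spec _ _ _

/-- A 2-cell `1 ⇒ t` at a generalized element. -/
def etaF (η : 𝟙 A.obj ⟶ t) (X : G ⟶ A.obj) : X ⟶ X ≫ t :=
  evCell (evi X) η (evAtom X t)

instance ev_eta (η : 𝟙 A.obj ⟶ t) (X : G ⟶ A.obj) (d : X ≫ 𝟙 _ ≅ X) [D : IsEvi d] :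
    Ev d η (evAtom X t) (etaF η X) := by
  rw [D.eq]
  exact evCell_spec _ _ _

/-- A 2-cell `t t ⇒ t` at a generalized element. -/
def muF (μ : t ≫ t ⟶ t) (X : G ⟶ A.obj) : (X ≫ t) ≫ t ⟶ X ≫ t :=
  evCell (evc (evAtom X t) (evAtom _ t)) μ (evAtom X t)

instance ev_mu (μ : t ≫ t ⟶ t) (X : G ⟶ A.obj) :
    Ev (evc (evAtom X t) (evAtom _ t)) μ (evAtom X t) (muF μ X) :=
  evCell_spec _ _ _

instance ev_unitCell (v₀ : k ≫ t ⟶ A.j) :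
    Ev (evc (evid k) (evAtom k t)) v₀ (evid A.j) v₀ := ⟨by
  simp [evc_hom, evid_hom, evAtom_hom]⟩

/-- A 2-cell `t p (t ⊗ 1) ⇒ p (t ⊗ t)` at generalized elements. -/
def vF (v : t ▷ₜ A.obj ≫ A.p ≫ t ⟶ t ⊠₁ t ≫ A.p) (X : G ⟶ A.obj) (Y : H ⟶ A.obj) :
    A.ten (X ≫ t) Y ≫ t ⟶ A.ten (X ≫ t) (Y ≫ t) :=
  evCell (evc (evt (evAtom X t) (evi Y)) (evc (evAtom _ A.p) (evAtom _ t))) v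
    (evc (evt (evAtom X t) (evAtom Y t)) (evAtom _ A.p))

instance ev_v (v : t ▷ₜ A.obj ≫ A.p ≫ t ⟶ t ⊠₁ t ≫ A.p) (X : G ⟶ A.obj) (Y : H ⟶ A.obj)
    (d : Y ≫ 𝟙 _ ≅ Y) [D : IsEvi d] :
    Ev (evc (evt (evAtom X t) d) (evc (evAtom _ A.p) (evAtom _ t))) v
      (evc (evt (evAtom X t) (evAtom Y t)) (evAtom _ A.p)) (vF v X Y) := by
  rw [D.eq]
  exact evCell_spec _ _ _

/-- A 2-cell `1 ⇒ p (t ⊗ k)` at a generalized element. -/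
def kappaF (κ : 𝟙 A.obj ⟶ rHom A.obj ≫ t ⊠₁ k ≫ A.p) (X : G ⟶ A.obj) :
    X ⟶ pull (rHom G) (A.ten (X ≫ t) k) :=
  evCell (evi X) κ
    (evc (evr X) (evc (pre _ (evt (evAtom X t) (evid k))) (pre _ (evAtom _ A.p))))

instance ev_kappa (κ : 𝟙 A.obj ⟶ rHom A.obj ≫ t ⊠₁ k ≫ A.p) (X : G ⟶ A.obj)
    (d : X ≫ 𝟙 _ ≅ X) [D : IsEvi d] :
    Ev d κ (evc (evr X) (evc (pre _ (evt (evAtom X t) (evid k))) (pre _ (evAtom _ A.p))))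
      (kappaF κ X) := by
  rw [D.eq]
  exact evCell_spec _ _ _
end

namespace IsOpmonoidal
variable {t : A.obj ⟶ A.obj} {F : OpmonoidalData (A := A) (B := A) t}

theorem assocF (h : IsOpmonoidal F) (X : G ⟶ A.obj) (Y : H ⟶ A.obj) (Z : K ⟶ A.obj) :
    psiF F.ψ (A.ten X Y) Z ≫ A.ten₂ (psiF F.ψ X Y) (𝟙 _) ≫ A.αF (X ≫ t) (Y ≫ t) (Z ≫ t) =
      A.αF X Y Z ▷ t ≫ (pullAssoc _ _ t).hom ≫ pull₂ _ (psiF F.ψ X (A.ten Y Z)) ≫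
        pull₂ _ (A.ten₂ (𝟙 _) (psiF F.ψ Y Z)) := by
  have h := h.assoc
  have k := Ev.unique (U := (X ⊠₁ Y) ⊠₁ Z)
      (e := evc (evt (evAtom _ A.p) (evi _)) (evc (evAtom _ A.p) (evAtom _ t)))
    (by (repeat apply Ev.next); infer_instance) (by (repeat apply Ev.next); infer_instance) h
  simpa only [Category.id_comp, Category.comp_id, Category.assoc, LeftSkewMonoidale.ten₂_id,
      id_whiskerRight, pull₂_id] using k

theorem left_unitF (h : IsOpmonoidal F) (Y : G ⟶ A.obj) :
    psiF F.ψ A.j Y ≫ A.ten₂ F.ψ₀ (𝟙 _) ≫ A.lamF (Y ≫ t) = A.lamF Y ▷ t ≫ (pullAssoc _ _ t).hom := by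
  have h := h.left_unit
  have k := Ev.unique (U := 𝟙 _ ⊠₁ Y)
      (e := evc (evt (evid A.j) (evi _)) (evc (evAtom _ A.p) (evAtom _ t)))
    (by (repeat apply Ev.next); infer_instance) (by (repeat apply Ev.next); infer_instance) h
  simpa only [Category.id_comp, Category.comp_id, Category.assoc, LeftSkewMonoidale.ten₂_id,
      id_whiskerRight, pull₂_id] using k

theorem right_unitF (h : IsOpmonoidal F) (X : G ⟶ A.obj) :
    A.rhoF X ▷ t ≫ (pullAssoc _ _ t).hom ≫ pull₂ _ (psiF F.ψ X A.j) ≫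
      pull₂ _ (A.ten₂ (𝟙 _) F.ψ₀) = A.rhoF (X ≫ t) := by
  have h := h.right_unit
  have k := Ev.unique (U := X) (e := evAtom _ t)
    (by (repeat apply Ev.next); infer_instance) (by (repeat apply Ev.next); infer_instance) h
  simpa only [Category.id_comp, Category.comp_id, Category.assoc, LeftSkewMonoidale.ten₂_id,
      id_whiskerRight, pull₂_id] using k

/-- Only the identity elements are used: they are generic, and evaluation there is faithful. -/
theorem of_family
    (assoc : ∀ {G H K : M} (X : G ⟶ A.obj) (Y : H ⟶ A.obj) (Z : K ⟶ A.obj), psiF F.ψ (A.ten X Y) Z ≫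
        A.ten₂ (psiF F.ψ X Y) (𝟙 _) ≫ A.αF (X ≫ t) (Y ≫ t) (Z ≫ t) =
      A.αF X Y Z ▷ t ≫ (pullAssoc _ _ t).hom ≫ pull₂ _ (psiF F.ψ X (A.ten Y Z)) ≫
        pull₂ _ (A.ten₂ (𝟙 _) (psiF F.ψ Y Z)))
    (left_unit : ∀ {G : M} (Y : G ⟶ A.obj), psiF F.ψ A.j Y ≫ A.ten₂ F.ψ₀ (𝟙 _) ≫ A.lamF (Y ≫ t) =
        A.lamF Y ▷ t ≫ (pullAssoc _ _ t).hom)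
    (right_unit : ∀ {G : M} (X : G ⟶ A.obj), A.rhoF X ▷ t ≫
        (pullAssoc _ _ t).hom ≫ pull₂ _ (psiF F.ψ X A.j) ≫
      pull₂ _ (A.ten₂ (𝟙 _) F.ψ₀) = A.rhoF (X ≫ t)) : IsOpmonoidal F := by
  constructor
  · refine Ev.injective (U := (𝟙 A.obj ⊠₁ 𝟙 A.obj) ⊠₁ 𝟙 A.obj)
        (e := evc (evt (evAtom _ A.p) (evi _)) (evc (evAtom _ A.p) (evAtom _ t)))
      (by (repeat apply Ev.next); infer_instance) (by (repeat apply Ev.next); infer_instance) ?_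
    simpa only [Category.id_comp, Category.comp_id, Category.assoc, LeftSkewMonoidale.ten₂_id,
        id_whiskerRight, pull₂_id] using assoc (𝟙 A.obj) (𝟙 A.obj) (𝟙 A.obj)
  · refine Ev.injective (U := 𝟙 (unitObj M) ⊠₁ 𝟙 A.obj)
        (e := evc (evt (evid A.j) (evi _)) (evc (evAtom _ A.p) (evAtom _ t)))
      (by (repeat apply Ev.next); infer_instance) (by (repeat apply Ev.next); infer_instance) ?_
    simpa only [Category.id_comp, Category.comp_id, Category.assoc, LeftSkewMonoidale.ten₂_id,
        id_whiskerRight, pull₂_id] using left_unit (𝟙 A.obj)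
  · refine Ev.injective (U := 𝟙 A.obj) (e := evAtom _ t)
      (by (repeat apply Ev.next); infer_instance) (by (repeat apply Ev.next); infer_instance) ?_
    simpa only [Category.id_comp, Category.comp_id, Category.assoc, LeftSkewMonoidale.ten₂_id,
        id_whiskerRight, pull₂_id] using right_unit (𝟙 A.obj)

end IsOpmonoidal
end

/-! ### Opmonoidal monads and skew left warpings at generalized elements. -/

section
variable {M : Type u} [Bicategory.{w, v} M] [MonoidalBicategory M] {A B : LeftSkewMonoidale M}
variable {G H K L : M}

section
variable {t : A.obj ⟶ A.obj} {F : OpmonoidalData (A := A) (B := A) t}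

theorem IsOpmonoidal₂.eta_tensorF {η : 𝟙 A.obj ⟶ t} (h : IsOpmonoidal₂ (OpmonoidalData.id A) F η)
    (X : G ⟶ A.obj) (Y : H ⟶ A.obj) :
    etaF η (A.ten X Y) ≫ psiF F.ψ X Y = A.ten₂ (etaF η X) (etaF η Y) := by
  have h := h.tensor.symm
  simp only [OpmonoidalData.id, OpmonoidalData.comp] at h
  have k := Ev.unique (U := X ⊠₁ Y) (e := evc (evAtom _ A.p) (evi _))
    (by (repeat apply Ev.next); infer_instance) (by (repeat apply Ev.next); infer_instance) h
  simpa only [Category.id_comp, Category.comp_id, Category.assoc, LeftSkewMonoidale.ten₂_id,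
    id_whiskerRight, pull₂_id] using k

theorem IsOpmonoidal₂.eta_unitF {η : 𝟙 A.obj ⟶ t} (h : IsOpmonoidal₂ (OpmonoidalData.id A) F η) :
    etaF η A.j ≫ F.ψ₀ = 𝟙 _ := by
  have h := h.unit
  simp only [OpmonoidalData.id, OpmonoidalData.comp] at h
  have k := Ev.unique (U := 𝟙 _) (e := evc (evid A.j) (evi _))
    (by (repeat apply Ev.next); infer_instance) (by (repeat apply Ev.next); infer_instance) h
  simpa only [Category.id_comp, Category.comp_id, Category.assoc, LeftSkewMonoidale.ten₂_id,
    id_whiskerRight, pull₂_id] using k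

theorem IsOpmonoidal₂.mu_tensorF {μ : t ≫ t ⟶ t} (h : IsOpmonoidal₂ (F.comp F) F μ) (X : G ⟶ A.obj)
    (Y : H ⟶ A.obj) :
    psiF F.ψ X Y ▷ t ≫ psiF F.ψ (X ≫ t) (Y ≫ t) ≫ A.ten₂ (muF μ X) (muF μ Y) =
      muF μ (A.ten X Y) ≫ psiF F.ψ X Y := by
  have h := h.tensor
  simp only [OpmonoidalData.id, OpmonoidalData.comp] at h
  have k := Ev.unique (U := X ⊠₁ Y) (e := evc (evAtom _ A.p) (evc (evAtom _ t) (evAtom _ t)))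
    (by (repeat apply Ev.next); infer_instance) (by (repeat apply Ev.next); infer_instance) h
  simpa only [Category.id_comp, Category.comp_id, Category.assoc, LeftSkewMonoidale.ten₂_id,
    id_whiskerRight, pull₂_id] using k

theorem IsOpmonoidal₂.mu_unitF {μ : t ≫ t ⟶ t} (h : IsOpmonoidal₂ (F.comp F) F μ) :
    muF μ A.j ≫ F.ψ₀ = F.ψ₀ ▷ t ≫ F.ψ₀ := by
  have h := h.unit
  simp only [OpmonoidalData.id, OpmonoidalData.comp] at h
  have k := Ev.unique (U := 𝟙 _) (e := evc (evid A.j) (evc (evAtom _ t) (evAtom _ t)))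
    (by (repeat apply Ev.next); infer_instance) (by (repeat apply Ev.next); infer_instance) h
  simpa only [Category.id_comp, Category.comp_id, Category.assoc, LeftSkewMonoidale.ten₂_id,
    id_whiskerRight, pull₂_id] using k

theorem IsOpmonoidal₂.eta_of_family {η : 𝟙 A.obj ⟶ t}
    (tensor : ∀ {G H : M} (X : G ⟶ A.obj) (Y : H ⟶ A.obj), etaF η (A.ten X Y) ≫ psiF F.ψ X Y =
        A.ten₂ (etaF η X) (etaF η Y))
    (unit : etaF η A.j ≫ F.ψ₀ = 𝟙 _) : IsOpmonoidal₂ (OpmonoidalData.id A) F η := by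
  constructor
  · symm
    simp only [OpmonoidalData.id, OpmonoidalData.comp]
    refine Ev.injective (U := 𝟙 A.obj ⊠₁ 𝟙 A.obj) (e := evc (evAtom _ A.p) (evi _))
      (by (repeat apply Ev.next); infer_instance) (by (repeat apply Ev.next); infer_instance) ?_
    simpa only [Category.id_comp, Category.comp_id, Category.assoc, LeftSkewMonoidale.ten₂_id,
      id_whiskerRight, pull₂_id] using tensor (𝟙 A.obj) (𝟙 A.obj)
  · simp only [OpmonoidalData.id, OpmonoidalData.comp]
    refine Ev.injective (U := 𝟙 (unitObj M)) (e := evc (evid A.j) (evi _))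
      (by (repeat apply Ev.next); infer_instance) (by (repeat apply Ev.next); infer_instance) ?_
    simpa only [Category.id_comp, Category.comp_id, Category.assoc, LeftSkewMonoidale.ten₂_id,
      id_whiskerRight, pull₂_id] using unit

theorem IsOpmonoidal₂.mu_of_family {μ : t ≫ t ⟶ t}
    (tensor : ∀ {G H : M} (X : G ⟶ A.obj) (Y : H ⟶ A.obj), psiF F.ψ X Y ▷ t ≫ psiF F.ψ (X ≫ t)
        (Y ≫ t) ≫ A.ten₂ (muF μ X) (muF μ Y) =
      muF μ (A.ten X Y) ≫ psiF F.ψ X Y)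
    (unit : muF μ A.j ≫ F.ψ₀ = F.ψ₀ ▷ t ≫ F.ψ₀) : IsOpmonoidal₂ (F.comp F) F μ := by
  constructor
  · simp only [OpmonoidalData.id, OpmonoidalData.comp]
    refine Ev.injective (U := 𝟙 A.obj ⊠₁ 𝟙 A.obj)
        (e := evc (evAtom _ A.p) (evc (evAtom _ t) (evAtom _ t)))
      (by (repeat apply Ev.next); infer_instance) (by (repeat apply Ev.next); infer_instance) ?_
    simpa only [Category.id_comp, Category.comp_id, Category.assoc, LeftSkewMonoidale.ten₂_id,
      id_whiskerRight, pull₂_id] using tensor (𝟙 A.obj) (𝟙 A.obj)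
  · simp only [OpmonoidalData.id, OpmonoidalData.comp]
    refine Ev.injective (U := 𝟙 (unitObj M)) (e := evc (evid A.j) (evc (evAtom _ t) (evAtom _ t)))
      (by (repeat apply Ev.next); infer_instance) (by (repeat apply Ev.next); infer_instance) ?_
    simpa only [Category.id_comp, Category.comp_id, Category.assoc, LeftSkewMonoidale.ten₂_id,
      id_whiskerRight, pull₂_id] using unit

theorem monad_assocF {μ : t ≫ t ⟶ t} (h' : μ ▷ t ≫ μ = (α_ t t t).hom ≫ t ◁ μ ≫ μ) (X : G ⟶ A.obj) :
    muF μ X ▷ t ≫ muF μ X = muF μ (X ≫ t) ≫ muF μ X := by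
  have h := h'
  have k := Ev.unique (U := X) (e := evc (evc (evAtom _ t) (evAtom _ t)) (evAtom _ t))
    (by (repeat apply Ev.next); infer_instance) (by (repeat apply Ev.next); infer_instance) h
  simpa only [Category.id_comp, Category.comp_id, Category.assoc, LeftSkewMonoidale.ten₂_id,
    id_whiskerRight, pull₂_id] using k

theorem monad_assoc_of_family {μ : t ≫ t ⟶ t}
    (h : ∀ {G : M} (X : G ⟶ A.obj), muF μ X ▷ t ≫ muF μ X = muF μ (X ≫ t) ≫ muF μ X) : μ ▷ t ≫ μ =
    (α_ t t t).hom ≫ t ◁ μ ≫ μ := by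
  refine Ev.injective (U := 𝟙 A.obj) (e := evc (evc (evAtom _ t) (evAtom _ t)) (evAtom _ t))
    (by (repeat apply Ev.next); infer_instance) (by (repeat apply Ev.next); infer_instance) ?_
  simpa only [Category.id_comp, Category.comp_id, Category.assoc, LeftSkewMonoidale.ten₂_id,
    id_whiskerRight, pull₂_id] using h (𝟙 A.obj)

theorem monad_left_unitF {η : 𝟙 A.obj ⟶ t} {μ : t ≫ t ⟶ t} (h' : η ▷ t ≫ μ = (λ_ t).hom)
    (X : G ⟶ A.obj) :
    etaF η X ▷ t ≫ muF μ X = 𝟙 _ := by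
  have h := h'
  have k := Ev.unique (U := X) (e := evc (evi _) (evAtom _ t))
    (by (repeat apply Ev.next); infer_instance) (by (repeat apply Ev.next); infer_instance) h
  simpa only [Category.id_comp, Category.comp_id, Category.assoc, LeftSkewMonoidale.ten₂_id,
    id_whiskerRight, pull₂_id] using k

theorem monad_left_unit_of_family {η : 𝟙 A.obj ⟶ t} {μ : t ≫ t ⟶ t}
    (h : ∀ {G : M} (X : G ⟶ A.obj), etaF η X ▷ t ≫ muF μ X = 𝟙 _) : η ▷ t ≫ μ = (λ_ t).hom := by
  refine Ev.injective (U := 𝟙 A.obj) (e := evc (evi _) (evAtom _ t))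
    (by (repeat apply Ev.next); infer_instance) (by (repeat apply Ev.next); infer_instance) ?_
  simpa only [Category.id_comp, Category.comp_id, Category.assoc, LeftSkewMonoidale.ten₂_id,
    id_whiskerRight, pull₂_id] using h (𝟙 A.obj)

theorem monad_right_unitF {η : 𝟙 A.obj ⟶ t} {μ : t ≫ t ⟶ t} (h' : t ◁ η ≫ μ = (ρ_ t).hom)
    (X : G ⟶ A.obj) :
    etaF η (X ≫ t) ≫ muF μ X = 𝟙 _ := by
  have h := h'
  have k := Ev.unique (U := X) (e := evc (evAtom _ t) (evi _))
    (by (repeat apply Ev.next); infer_instance) (by (repeat apply Ev.next); infer_instance) h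
  simpa only [Category.id_comp, Category.comp_id, Category.assoc, LeftSkewMonoidale.ten₂_id,
    id_whiskerRight, pull₂_id] using k

theorem monad_right_unit_of_family {η : 𝟙 A.obj ⟶ t} {μ : t ≫ t ⟶ t}
    (h : ∀ {G : M} (X : G ⟶ A.obj), etaF η (X ≫ t) ≫ muF μ X = 𝟙 _) : t ◁ η ≫ μ = (ρ_ t).hom := by
  refine Ev.injective (U := 𝟙 A.obj) (e := evc (evAtom _ t) (evi _))
    (by (repeat apply Ev.next); infer_instance) (by (repeat apply Ev.next); infer_instance) ?_
  simpa only [Category.id_comp, Category.comp_id, Category.assoc, LeftSkewMonoidale.ten₂_id,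
    id_whiskerRight, pull₂_id] using h (𝟙 A.obj)

end

namespace SkewLeftWarping
variable (W : SkewLeftWarping A)

theorem assocF (X : G ⟶ A.obj) (Y : H ⟶ A.obj) (Z : K ⟶ A.obj) :
    vF W.v (A.ten (X ≫ W.t) Y) Z ≫ A.ten₂ (vF W.v X Y) (𝟙 _) ≫
        A.αF (X ≫ W.t) (Y ≫ W.t) (Z ≫ W.t) =
      A.ten₂ (vF W.v X Y) (𝟙 Z) ▷ W.t ≫ A.αF (X ≫ W.t) (Y ≫ W.t) Z ▷ W.t ≫
        (pullAssoc _ _ W.t).hom ≫ pull₂ _ (vF W.v X (A.ten (Y ≫ W.t) Z)) ≫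
        pull₂ _ (A.ten₂ (𝟙 _) (vF W.v Y Z)) := by
  have h := W.assoc
  have k := Ev.unique (U := (X ⊠₁ Y) ⊠₁ Z)
      (e := evc (evt (evt (evAtom _ W.t) (evi _)) (evi _))
      (evc (evt (evAtom _ A.p) (evi _))
      (evc (evt (evAtom _ W.t) (evi _)) (evc (evAtom _ A.p) (evAtom _ W.t)))))
    (by (repeat apply Ev.next); infer_instance) (by (repeat apply Ev.next); infer_instance) h
  simpa only [Category.id_comp, Category.comp_id, Category.assoc, LeftSkewMonoidale.ten₂_id,
    id_whiskerRight, pull₂_id] using k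

theorem left_unitF (Y : G ⟶ A.obj) :
    vF W.v W.k Y ≫ A.ten₂ W.v₀ (𝟙 _) ≫ A.lamF (Y ≫ W.t) =
      A.ten₂ W.v₀ (𝟙 Y) ▷ W.t ≫ A.lamF Y ▷ W.t ≫ (pullAssoc _ _ W.t).hom := by
  have h := W.left_unit
  have k := Ev.unique (U := 𝟙 _ ⊠₁ Y)
      (e := evc (evt (evid W.k) (evi _))
      (evc (evt (evAtom _ W.t) (evi _)) (evc (evAtom _ A.p) (evAtom _ W.t))))
    (by (repeat apply Ev.next); infer_instance) (by (repeat apply Ev.next); infer_instance) h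
  simpa only [Category.id_comp, Category.comp_id, Category.assoc, LeftSkewMonoidale.ten₂_id,
    id_whiskerRight, pull₂_id] using k

theorem right_unitF (X : G ⟶ A.obj) :
    kappaF W.κ X ▷ W.t ≫ (pullAssoc _ _ W.t).hom ≫ pull₂ _ (vF W.v X W.k) ≫
        pull₂ _ (A.ten₂ (𝟙 _) W.v₀) = A.rhoF (X ≫ W.t) := by
  have h := W.right_unit
  have k := Ev.unique (U := X) (e := evAtom _ W.t)
    (by (repeat apply Ev.next); infer_instance) (by (repeat apply Ev.next); infer_instance) h
  simpa only [Category.id_comp, Category.comp_id, Category.assoc, LeftSkewMonoidale.ten₂_id,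
    id_whiskerRight, pull₂_id] using k

theorem unit_tensorF (X : G ⟶ A.obj) (Y : H ⟶ A.obj) :
    kappaF W.κ (A.ten (X ≫ W.t) Y) ≫ pull₂ _ (A.ten₂ (vF W.v X Y) (𝟙 _)) ≫
        pull₂ _ (A.αF (X ≫ W.t) (Y ≫ W.t) W.k) ≫
        (A.rightIsoP (X ≫ W.t) (A.ten (Y ≫ W.t) W.k)).hom =
      A.ten₂ (𝟙 _) (kappaF W.κ Y) := by
  have h := W.unit_tensor
  have k := Ev.unique (U := X ⊠₁ Y) (e := evc (evt (evAtom _ W.t) (evi _)) (evAtom _ A.p))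
    (by (repeat apply Ev.next); infer_instance) (by (repeat apply Ev.next); infer_instance) h
  simpa only [Category.id_comp, Category.comp_id, Category.assoc, LeftSkewMonoidale.ten₂_id,
    id_whiskerRight, pull₂_id] using k

theorem unit_unitF :
    kappaF W.κ W.k ≫ pull₂ _ (A.ten₂ W.v₀ (𝟙 _)) ≫ pull₂ _ (A.lamF W.k) ≫ (rlIso W.k).hom = 𝟙 W.k :=
        by
  have h := W.unit_unit
  have k := Ev.unique (U := 𝟙 _) (e := evid W.k)
    (by (repeat apply Ev.next); infer_instance) (by (repeat apply Ev.next); infer_instance) h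
  simpa only [Category.id_comp, Category.comp_id, Category.assoc, LeftSkewMonoidale.ten₂_id,
    id_whiskerRight, pull₂_id] using k

end SkewLeftWarping

/-- A skew left warping from its axioms at generalized elements. -/
def SkewLeftWarping.ofFamily (W : SkewLeftWarpingData A)
    (assoc : ∀ {G H K : M} (X : G ⟶ A.obj) (Y : H ⟶ A.obj) (Z : K ⟶ A.obj),
        vF W.v (A.ten (X ≫ W.t) Y) Z ≫ A.ten₂ (vF W.v X Y) (𝟙 _) ≫
        A.αF (X ≫ W.t) (Y ≫ W.t) (Z ≫ W.t) =
      A.ten₂ (vF W.v X Y) (𝟙 Z) ▷ W.t ≫ A.αF (X ≫ W.t) (Y ≫ W.t) Z ▷ W.t ≫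
        (pullAssoc _ _ W.t).hom ≫ pull₂ _ (vF W.v X (A.ten (Y ≫ W.t) Z)) ≫
        pull₂ _ (A.ten₂ (𝟙 _) (vF W.v Y Z)))
    (left_unit : ∀ {G : M} (Y : G ⟶ A.obj), vF W.v W.k Y ≫ A.ten₂ W.v₀ (𝟙 _) ≫ A.lamF (Y ≫ W.t) =
      A.ten₂ W.v₀ (𝟙 Y) ▷ W.t ≫ A.lamF Y ▷ W.t ≫ (pullAssoc _ _ W.t).hom)
    (right_unit : ∀ {G : M} (X : G ⟶ A.obj), kappaF W.κ X ▷ W.t ≫ (pullAssoc _ _ W.t).hom ≫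
        pull₂ _ (vF W.v X W.k) ≫
        pull₂ _ (A.ten₂ (𝟙 _) W.v₀) = A.rhoF (X ≫ W.t))
    (unit_tensor : ∀ {G H : M} (X : G ⟶ A.obj) (Y : H ⟶ A.obj), kappaF W.κ (A.ten (X ≫ W.t) Y) ≫
        pull₂ _ (A.ten₂ (vF W.v X Y) (𝟙 _)) ≫
        pull₂ _ (A.αF (X ≫ W.t) (Y ≫ W.t) W.k) ≫
        (A.rightIsoP (X ≫ W.t) (A.ten (Y ≫ W.t) W.k)).hom =
      A.ten₂ (𝟙 _) (kappaF W.κ Y))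
    (unit_unit : kappaF W.κ W.k ≫ pull₂ _ (A.ten₂ W.v₀ (𝟙 _)) ≫ pull₂ _ (A.lamF W.k) ≫
        (rlIso W.k).hom = 𝟙 W.k) :
    SkewLeftWarping A where
  toSkewLeftWarpingData := W
  assoc := by
    refine Ev.injective (U := (𝟙 A.obj ⊠₁ 𝟙 A.obj) ⊠₁ 𝟙 A.obj)
        (e := evc (evt (evt (evAtom _ W.t) (evi _)) (evi _))
        (evc (evt (evAtom _ A.p) (evi _))
        (evc (evt (evAtom _ W.t) (evi _)) (evc (evAtom _ A.p) (evAtom _ W.t)))))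
      (by (repeat apply Ev.next); infer_instance) (by (repeat apply Ev.next); infer_instance) ?_
    simpa only [Category.id_comp, Category.comp_id, Category.assoc, LeftSkewMonoidale.ten₂_id,
      id_whiskerRight, pull₂_id] using assoc (𝟙 A.obj) (𝟙 A.obj) (𝟙 A.obj)
  left_unit := by
    refine Ev.injective (U := 𝟙 (unitObj M) ⊠₁ 𝟙 A.obj)
        (e := evc (evt (evid W.k) (evi _))
        (evc (evt (evAtom _ W.t) (evi _)) (evc (evAtom _ A.p) (evAtom _ W.t))))
      (by (repeat apply Ev.next); infer_instance) (by (repeat apply Ev.next); infer_instance) ?_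
    simpa only [Category.id_comp, Category.comp_id, Category.assoc, LeftSkewMonoidale.ten₂_id,
      id_whiskerRight, pull₂_id] using left_unit (𝟙 A.obj)
  right_unit := by
    refine Ev.injective (U := 𝟙 A.obj) (e := evAtom _ W.t)
      (by (repeat apply Ev.next); infer_instance) (by (repeat apply Ev.next); infer_instance) ?_
    simpa only [Category.id_comp, Category.comp_id, Category.assoc, LeftSkewMonoidale.ten₂_id,
      id_whiskerRight, pull₂_id] using right_unit (𝟙 A.obj)
  unit_tensor := by
    refine Ev.injective (U := 𝟙 A.obj ⊠₁ 𝟙 A.obj)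
        (e := evc (evt (evAtom _ W.t) (evi _)) (evAtom _ A.p))
      (by (repeat apply Ev.next); infer_instance) (by (repeat apply Ev.next); infer_instance) ?_
    simpa only [Category.id_comp, Category.comp_id, Category.assoc, LeftSkewMonoidale.ten₂_id,
      id_whiskerRight, pull₂_id] using unit_tensor (𝟙 A.obj) (𝟙 A.obj)
  unit_unit := by
    refine Ev.injective (U := 𝟙 (unitObj M)) (e := evid W.k)
      (by (repeat apply Ev.next); infer_instance) (by (repeat apply Ev.next); infer_instance) ?_
    simpa only [Category.id_comp, Category.comp_id, Category.assoc, LeftSkewMonoidale.ten₂_id,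
      id_whiskerRight, pull₂_id] using unit_unit
end

/-! ### Naturality of values and compatibility with reindexing. -/

section
variable {M : Type u} [Bicategory.{w, v} M] [MonoidalBicategory M] {A : LeftSkewMonoidale M}
variable {G H K L : M}

namespace LeftSkewMonoidale
variable {X X' : G ⟶ A.obj} {Y Y' : H ⟶ A.obj} {Z Z' : K ⟶ A.obj}

theorem αF_naturality (σ : X ⟶ X') (τ : Y ⟶ Y') (υ : Z ⟶ Z') :
    A.ten₂ (A.ten₂ σ τ) υ ≫ A.αF X' Y' Z' = A.αF X Y Z ≫ pull₂ _ (A.ten₂ σ (A.ten₂ τ υ)) :=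
  (Ev.natural (ev_α X Y Z (evi _) (evi _)) (ev_α X' Y' Z' (evi _) (evi _))
    (φ := (σ ⊠₂ τ) ⊠₂ υ) inferInstance inferInstance).symm

theorem lamF_naturality (τ : Y ⟶ Y') :
    A.ten₂ (𝟙 _) τ ≫ A.lamF Y' = A.lamF Y ≫ pull₂ _ τ :=
  (Ev.natural (ev_lam Y (evi _)) (ev_lam Y' (evi _))
    (φ := 𝟙 _ ⊠₂ τ) inferInstance inferInstance).symm

theorem rhoF_naturality (σ : X ⟶ X') :
    σ ≫ A.rhoF X' = A.rhoF X ≫ pull₂ _ (A.ten₂ σ (𝟙 _)) :=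
  (Ev.natural (ev_rho X (evi _) (evi _)) (ev_rho X' (evi _) (evi _))
    (φ := σ) inferInstance inferInstance).symm

theorem pullTenP_naturality (b : L ⟶ G) (σ : X ⟶ X') (τ : Y ⟶ Y') :
    A.ten₂ (pull₂ b σ) τ ≫ (A.pullTenP b X' Y').hom =
      (A.pullTenP b X Y).hom ≫ pull₂ _ (A.ten₂ σ τ) := by
  have h := congrArg (· ▷ A.p) (pullTen_naturality b σ τ)
  simp only [comp_whiskerRight] at h
  change _ ▷ A.p ≫ _ ▷ A.p ≫ _ = (_ ▷ A.p ≫ _) ≫ _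
  rw [reassoc_of% h, Category.assoc]
  congr 1
  exact pullAssoc_naturality _ _ _

theorem rightIsoP_naturality {Q Q' : H ⊠ unitObj M ⟶ A.obj} (σ : X ⟶ X') (τ : Q ⟶ Q') :
    pull₂ _ (pull₂ _ (A.ten₂ σ τ)) ≫ (A.rightIsoP X' Q').hom =
      (A.rightIsoP X Q).hom ≫ A.ten₂ σ (pull₂ _ τ) := by
  have h := congrArg (· ▷ A.p) (rightIso_hom_naturality σ τ)
  simp only [comp_whiskerRight] at h
  have k : Wh (pre (rHom (G ⊠ H)) (pre (aHom G H (unitObj M)) (evAtom (X ⊠₁ Q) A.p)))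
    (pull₂ _ (pull₂ _ (σ ⊠₂ τ))) (pre _ (pre _ (evAtom _ A.p))) (pull₂ _ (pull₂ _ (A.ten₂ σ τ))) :=
        inferInstance
  rw [← cancel_epi (pre (rHom (G ⊠ H)) (pre (aHom G H (unitObj M)) (evAtom (X ⊠₁ Q) A.p))).hom,
    reassoc_of% k.eq]
  simpa [rightIsoP, ten₂] using h

end LeftSkewMonoidale

section
variable {t : A.obj ⟶ A.obj} {k : unitObj M ⟶ A.obj} {X X' : G ⟶ A.obj} {Y Y' : H ⟶ A.obj}

theorem psiF_naturality (ψ : A.p ≫ t ⟶ t ⊠₁ t ≫ A.p) (σ : X ⟶ X') (τ : Y ⟶ Y') :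
    A.ten₂ σ τ ▷ t ≫ psiF ψ X' Y' = psiF ψ X Y ≫ A.ten₂ (σ ▷ t) (τ ▷ t) :=
  (Ev.natural (ev_psi ψ X Y) (ev_psi ψ X' Y') (φ := σ ⊠₂ τ) inferInstance inferInstance).symm

theorem etaF_naturality (η : 𝟙 A.obj ⟶ t) (σ : X ⟶ X') :
    σ ≫ etaF η X' = etaF η X ≫ σ ▷ t :=
  (Ev.natural (ev_eta η X (evi _)) (ev_eta η X' (evi _)) (φ := σ) inferInstance inferInstance).symm

theorem muF_naturality (μ : t ≫ t ⟶ t) (σ : X ⟶ X') :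
    σ ▷ t ▷ t ≫ muF μ X' = muF μ X ≫ σ ▷ t :=
  (Ev.natural (ev_mu μ X) (ev_mu μ X') (φ := σ) inferInstance inferInstance).symm

theorem vF_naturality (v : t ▷ₜ A.obj ≫ A.p ≫ t ⟶ t ⊠₁ t ≫ A.p) (σ : X ⟶ X')
    (τ : Y ⟶ Y') :
    A.ten₂ (σ ▷ t) τ ▷ t ≫ vF v X' Y' = vF v X Y ≫ A.ten₂ (σ ▷ t) (τ ▷ t) :=
  (Ev.natural (ev_v v X Y (evi _)) (ev_v v X' Y' (evi _)) (φ := σ ⊠₂ τ) inferInstance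
    inferInstance).symm

/-- Compares two evaluations of `η` at the reindexed element: the direct one, and the reindexing of
the value at `X`. -/
theorem etaF_pull (η : 𝟙 A.obj ⟶ t) (b : L ⟶ G) (X : G ⟶ A.obj) :
    etaF η (pull b X) ≫ (pullAssoc b X t).hom = pull₂ b (etaF η X) := by
  have h : Ev (pre b (evi X)) η (pre b (evAtom X t)) (pull₂ b (etaF η X)) := ev_pre _ _ _ _ _
  simpa using (Ev.natural (ev_eta η (pull b X) (evi _)) h (φ := 𝟙 _)
    (θ := 𝟙 _) ⟨by rw [IsEvi.eq (d := pre b (evi X))]; simp [evi]⟩ inferInstance)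

theorem muF_pull (μ : t ≫ t ⟶ t) (b : L ⟶ G) (X : G ⟶ A.obj) :
    muF μ (pull b X) ≫ (pullAssoc b X t).hom =
      (pullAssoc b X t).hom ▷ t ≫ (pullAssoc b (X ≫ t) t).hom ≫ pull₂ b (muF μ X) := by
  have h : Ev (pre b (evc (evAtom X t) (evAtom _ t))) μ (pre b (evAtom X t)) (pull₂ b (muF μ X)) :=
    ev_pre _ _ _ _ _
  rw [pre_evc] at h
  have k := Ev.natural (ev_mu μ (pull b X)) h (φ := 𝟙 _) inferInstance inferInstance
  simpa using k

/-- Exchanges the chosen value of the target for another one, such as the reindexed value for the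
bare composite. -/
theorem Ev.comp_wh {U : G ⟶ K} {f g : K ⟶ L} {r s s' : G ⟶ L} {e : U ≫ f ≅ r} {σ : f ⟶ g}
    {e' : U ≫ g ≅ s} {τ : r ⟶ s} (h : Ev e σ e' τ) {e'' : U ≫ g ≅ s'} {i : s ⟶ s'}
    (k : Wh e' (𝟙 U) e'' i) : Ev e σ e'' (τ ≫ i) := ⟨by
  rw [← Category.assoc, h.eq, Category.assoc, k.eq]; simp⟩

theorem ev_v_pull (v : t ▷ₜ A.obj ≫ A.p ≫ t ⟶ t ⊠₁ t ≫ A.p) (b : L ⟶ H) (X : G ⟶ A.obj)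
    (Y : H ⟶ A.obj) :
    Ev (evc (evt (evAtom X t) (pre b (evi Y))) (evc (evAtom _ A.p) (evAtom _ t))) v
      (evc (evt (evAtom X t) (pre b (evAtom Y t))) (evAtom _ A.p))
      (vF v X (pull b Y) ≫ A.ten₂ (𝟙 _) (pullAssoc b Y t).hom) := by
  have k : Wh (evt (evAtom X t) (evAtom (pull b Y) t)) (𝟙 _)
      (evt (evAtom X t) (pre b (evAtom Y t))) (𝟙 _ ⊠₂ (pullAssoc b Y t).hom) := by
    have := whTensor (evAtom X t) (𝟙 _) (evAtom X t) (𝟙 _) (evAtom (pull b Y) t) (𝟙 _)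
      (pre b (evAtom Y t)) (pullAssoc b Y t).hom (𝟙 _ ⊠₂ (pullAssoc b Y t).hom)
    rwa [tensorHom₂_id] at this
  exact (ev_v v X (pull b Y) (pre b (evi Y))).comp_wh (whEvc _ _ _ _ _ _ _)

/-- Together with `vF_rightIsoP` and `vF_midIsoP`, this carries v across the isomorphisms that the
unit axioms of A leave behind. Each holds by `Ev.natural`, applied to an isomorphism of elements. -/
theorem vF_pullTenP (v : t ▷ₜ A.obj ≫ A.p ≫ t ⟶ t ⊠₁ t ≫ A.p) (b : L ⟶ G)
    (X : G ⟶ A.obj) (Y : H ⟶ A.obj) :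
    vF v (pull b X) Y ≫ A.ten₂ (pullAssoc b X t).hom (𝟙 _) ≫ (A.pullTenP b (X ≫ t) (Y ≫ t)).hom =
      (A.ten₂ (pullAssoc b X t).hom (𝟙 _)) ▷ t ≫ (A.pullTenP b (X ≫ t) Y).hom ▷ t ≫
        (pullAssoc _ _ t).hom ≫ pull₂ _ (vF v X Y) := by
  have k {K : M} {u : A.obj ⟶ K} {q : H ⟶ K} (d : Y ≫ u ≅ q) : Wh (evt (evAtom (pull b X) t) d)
      (pullTen b X Y).hom (pre _ (evt (evAtom X t) d))
      ((pullAssoc b X t).hom ⊠₂ 𝟙 _ ≫ (pullTen b (X ≫ t) q).hom) := by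
    have h := whTensor (evAtom (pull b X) t) (𝟙 _) (pre b (evAtom X t)) (pullAssoc b X t).hom
      d (𝟙 _) d (𝟙 _) ((pullAssoc b X t).hom ⊠₂ 𝟙 _)
    have h' := whPullTen b (evAtom X t) d
    simpa using whComp _ _ _ _ (E := h) _ _ _ (E' := h') _
  have h := ev_pre (b ▷ₜ H) _ v _ _ (E := ev_v v X Y (evi Y))
  rw [pre_evc, pre_evc, pre_evc] at h
  have k₁ := k (evi Y)
  have k₂ := k (evAtom Y t)
  have := Ev.natural (ev_v v (pull b X) Y (evi Y)) h (φ := (pullTen b X Y).hom) inferInstance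
    inferInstance
  simpa [LeftSkewMonoidale.ten₂, LeftSkewMonoidale.pullTenP] using this

theorem pre_pre_evAtom_hom {P Q : M} (b : P ⟶ Q) (c : Q ⟶ G) (X : G ⟶ A.obj) (t : A.obj ⟶ A.obj) :
    (pre b (pre c (evAtom X t))).hom =
      (pullAssoc b _ t).hom ≫ pull₂ b (pullAssoc c X t).hom := by
  rw [pre_hom, pre_hom, evAtom_hom, Bicategory.whiskerLeft_id, Category.comp_id]
  rfl

theorem vF_rightIsoP (v : t ▷ₜ A.obj ≫ A.p ≫ t ⟶ t ⊠₁ t ≫ A.p) (X : G ⟶ A.obj)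
    (Q : H ⊠ unitObj M ⟶ A.obj) :
    (pullAssoc _ _ t).hom ≫ pull₂ _ (pullAssoc _ _ t).hom ≫ pull₂ _ (pull₂ _ (vF v X Q)) ≫
        (A.rightIsoP (X ≫ t) (Q ≫ t)).hom =
      (A.rightIsoP (X ≫ t) Q).hom ▷ t ≫ vF v X (pull _ Q) ≫ A.ten₂ (𝟙 _) (pullAssoc _ _ t).hom := by
  have h := ev_pre (rHom (G ⊠ H)) _ v _ _ (E := ev_pre (aHom G H (unitObj M)) _ v _ _
    (E := ev_v v X Q (evi Q)))
  rw [pre_evc, pre_evc, pre_evc, pre_evc, pre_evc, pre_evc] at h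
  have k := wh_of (pre (rHom (G ⊠ H)) (pre (aHom G H (unitObj M)) (evAtom (A.ten (X ≫ t) Q) t)))
    (A.rightIsoP (X ≫ t) Q).hom (evAtom _ t)
  have := Ev.natural h (ev_v_pull v (rHom H) X Q) (φ := (rightIso X Q).hom) inferInstance
    inferInstance
  rw [Category.assoc, Iso.eq_inv_comp, pre_pre_evAtom_hom] at this
  simpa [evAtom_hom] using this

theorem vF_midIsoP (v : t ▷ₜ A.obj ≫ A.p ≫ t ⟶ t ⊠₁ t ≫ A.p) (X : G ⟶ A.obj) (Y : H ⟶ A.obj) :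
    (pullAssoc _ _ t).hom ≫ pull₂ _ (pullAssoc _ _ t).hom ≫
        pull₂ _ (pull₂ _ (vF v X (pull _ Y))) ≫
            pull₂ _ (pull₂ _ (A.ten₂ (𝟙 _) (pullAssoc _ _ t).hom)) ≫
        (A.midIsoP (X ≫ t) (Y ≫ t)).hom =
      (A.midIsoP (X ≫ t) Y).hom ▷ t ≫ vF v X Y := by
  have h := ev_pre (rHom G ▷ₜ H) _ v _ _ (E := ev_pre (aHom G (unitObj M) H) _ v _ _
    (E := ev_v_pull v (lHom H) X Y))
  rw [pre_evc, pre_evc, pre_evc, pre_evc, pre_evc, pre_evc] at h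
  have k := wh_of (pre (rHom G ▷ₜ H) (pre (aHom G (unitObj M) H)
    (evAtom (A.ten (X ≫ t) (pull (lHom H) Y)) t))) (A.midIsoP (X ≫ t) Y).hom (evAtom _ t)
  have := Ev.natural h (ev_v v X Y (evi Y)) (φ := (midIso X Y).hom) inferInstance
    inferInstance
  rw [Category.assoc, Iso.eq_inv_comp, pre_pre_evAtom_hom] at this
  simpa [evAtom_hom] using this

theorem rlIso_whiskerRight (Q : unitObj M ⟶ A.obj) (t : A.obj ⟶ A.obj) :
    (pullAssoc _ _ t).hom ≫ pull₂ _ (pullAssoc _ _ t).hom ≫ (rlIso (Q ≫ t)).hom =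
      (rlIso Q).hom ▷ t := by
  have h := (wh_rlIso (evAtom Q t)).eq
  rw [pre_hom, pre_hom, evAtom_hom] at h
  simpa [pullAssoc, pull₂, pull, evAtom] using h
end
end

/-! ### The 2-cells of the two constructions and their values. -/

section
variable {M : Type u} [Bicategory.{w, v} M] [MonoidalBicategory M] {A : LeftSkewMonoidale M}
variable {G H K L : M}

theorem Ev.congr {U : G ⟶ K} {f g : K ⟶ L} {r s : G ⟶ L} {e : U ≫ f ≅ r} {σ : f ⟶ g}
    {e' : U ≫ g ≅ s} {τ τ' : r ⟶ s} (h : Ev e σ e' τ) (hτ : τ = τ') : Ev e σ e' τ' :=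
  hτ ▸ h

section
variable {t : A.obj ⟶ A.obj}

/-- The 2-cell `T A → T A ⊗ J`. -/
def normalCell (t : A.obj ⟶ A.obj) : t ⟶ rHom A.obj ≫ t ⊠₁ A.j ≫ A.p :=
  𝟙 t ⊗≫ t ◁ A.rho ⊗≫ (rNat t).hom ▷ (A.obj ◁ₜ A.j ≫ A.p) ⊗≫
    rHom A.obj ◁ (splitRL t A.j).inv ▷ A.p

theorem ev_normalCell (t : A.obj ⟶ A.obj) (X : G ⟶ A.obj) :
    Ev (evAtom X t) (normalCell t)
      (evc (evr X) (evc (pre _ (evt (evAtom X t) (evid A.j))) (pre _ (evAtom _ A.p))))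
          (A.rhoF (X ≫ t)) := by
  unfold normalCell
  apply Ev.congr
  · (repeat apply Ev.next); infer_instance
  · simp only [Category.id_comp, Category.comp_id, Category.assoc, LeftSkewMonoidale.ten₂_id,
      id_whiskerRight, pull₂_id]

/-- The 2-cell `T T A → T (T A ⊗ J) → T A ⊗ T J → T A ⊗ J`. -/
def multCell (v : t ▷ₜ A.obj ≫ A.p ≫ t ⟶ t ⊠₁ t ≫ A.p) (v₀ : A.j ≫ t ⟶ A.j) :
    t ≫ t ⟶ rHom A.obj ≫ t ⊠₁ A.j ≫ A.p :=
  normalCell t ▷ t ⊗≫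
    rHom A.obj ◁ (splitLR t A.j).hom ▷ (A.p ≫ t) ⊗≫
    (rHom A.obj ≫ A.obj ◁ₜ A.j) ◁ v ⊗≫
    rHom A.obj ◁ (leftMerge t A.j t).hom ▷ A.p ⊗≫
    rHom A.obj ◁ (𝟙 t ⊠₂ v₀) ▷ A.p

attribute [instance] ev_normalCell

theorem ev_multCell (v : t ▷ₜ A.obj ≫ A.p ≫ t ⟶ t ⊠₁ t ≫ A.p) (v₀ : A.j ≫ t ⟶ A.j) (X : G ⟶ A.obj) :
    Ev (evc (evAtom X t) (evAtom _ t)) (multCell v v₀)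
      (evc (evr X) (evc (pre _ (evt (evAtom X t) (evid A.j))) (pre _ (evAtom _ A.p))))
          (A.rhoF (X ≫ t) ▷ t ≫ (pullAssoc _ _ t).hom ≫ pull₂ _ (vF v X A.j) ≫
        pull₂ _ (A.ten₂ (𝟙 _) v₀)) := by
  unfold multCell
  apply Ev.congr
  · (repeat apply Ev.next); infer_instance
  · simp only [Category.id_comp, Category.comp_id, Category.assoc, LeftSkewMonoidale.ten₂_id,
      id_whiskerRight, pull₂_id]

/-- The 2-cell `T (X ⊗ Y) → T (T X ⊗ Y) → T X ⊗ T Y`. -/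
def opmonoidalCell (η : 𝟙 A.obj ⟶ t) (v : t ▷ₜ A.obj ≫ A.p ≫ t ⟶ t ⊠₁ t ≫ A.p) :
    A.p ≫ t ⟶ t ⊠₁ t ≫ A.p :=
  𝟙 _ ⊗≫ (tensorId A.obj A.obj).inv ▷ (A.p ≫ t) ⊗≫ tensorRight₂ η A.obj ▷ (A.p ≫ t) ⊗≫ v

theorem ev_opmonoidalCell (η : 𝟙 A.obj ⟶ t) (v : t ▷ₜ A.obj ≫ A.p ≫ t ⟶ t ⊠₁ t ≫ A.p)
    (X : G ⟶ A.obj) (Y : H ⟶ A.obj) :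
    Ev (evc (evAtom _ A.p) (evAtom _ t)) (opmonoidalCell η v)
      (evc (evt (evAtom X t) (evAtom Y t)) (evAtom _ A.p))
          (A.ten₂ (etaF η X) (𝟙 Y) ▷ t ≫ vF v X Y) := by
  unfold opmonoidalCell
  apply Ev.congr
  · (repeat apply Ev.next); infer_instance
  · simp only [Category.id_comp, Category.comp_id, Category.assoc, LeftSkewMonoidale.ten₂_id,
      id_whiskerRight, pull₂_id]

end

namespace OpmonoidalMonad
variable (T : OpmonoidalMonad A)

theorem ev_warpingData_v (X : G ⟶ A.obj) (Y : H ⟶ A.obj) :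
    Ev (evc (evt (evAtom X T.t) (evi Y)) (evc (evAtom _ A.p) (evAtom _ T.t))) T.warpingData.v
      (evc (evt (evAtom X T.t) (evAtom Y T.t)) (evAtom _ A.p))
          (psiF T.opm.ψ (X ≫ T.t) Y ≫ A.ten₂ (muF T.μ X) (𝟙 _)) := by
  dsimp only [OpmonoidalMonad.warpingData]
  apply Ev.congr
  · (repeat apply Ev.next); infer_instance
  · simp only [Category.id_comp, Category.comp_id, Category.assoc, LeftSkewMonoidale.ten₂_id,
      id_whiskerRight, pull₂_id]

theorem ev_warpingData_κ (X : G ⟶ A.obj) :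
    Ev (evi X) T.warpingData.κ
      (evc (evr X) (evc (pre _ (evt (evAtom X T.t) (evid A.j))) (pre _ (evAtom _ A.p))))
          (etaF T.η X ≫ A.rhoF (X ≫ T.t)) := by
  dsimp only [OpmonoidalMonad.warpingData]
  apply Ev.congr
  · (repeat apply Ev.next); infer_instance
  · simp only [Category.id_comp, Category.comp_id, Category.assoc, LeftSkewMonoidale.ten₂_id,
      id_whiskerRight, pull₂_id]

end OpmonoidalMonad

end

/-! ### From opmonoidal monads to skew left warpings. -/

section
variable {M : Type u} [Bicategory.{w, v} M] [MonoidalBicategory M] {A : LeftSkewMonoidale M}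
variable {G H K L : M}
open LeftSkewMonoidale

namespace OpmonoidalMonad
variable (T : OpmonoidalMonad A)

/-- Opmonoidality of μ at TX, Y; associativity of μ merges the two multiplications in the first
factor. -/
theorem mu_vF {v : T.t ▷ₜ A.obj ≫ A.p ≫ T.t ⟶ T.t ⊠₁ T.t ≫ A.p}
    (hv : ∀ {G H : M} (X : G ⟶ A.obj) (Y : H ⟶ A.obj),
      vF v X Y = psiF T.opm.ψ (X ≫ T.t) Y ≫ A.ten₂ (muF T.μ X) (𝟙 _))
    (X : G ⟶ A.obj) (Y : H ⟶ A.obj) :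
    muF T.μ (A.ten (X ≫ T.t) Y) ≫ vF v X Y =
      vF v X Y ▷ T.t ≫ psiF T.opm.ψ (X ≫ T.t) (Y ≫ T.t) ≫ A.ten₂ (muF T.μ X) (muF T.μ Y) := by
  have h := T.μ_isOpmonoidal.mu_tensorF (X ≫ T.t) Y
  simp only [hv, comp_whiskerRight, Category.assoc]
  rw [reassoc_of% @psiF_naturality, ← reassoc_of% h, ten₂_comp, ten₂_comp, monad_assocF T.assoc]
  simp

/-- Coassociativity of ψ at TX, TY, Z. The multiplications slide through α by naturality, and
`mu_vF` matches what remains in the first factor. -/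
theorem warping_assoc {v : T.t ▷ₜ A.obj ≫ A.p ≫ T.t ⟶ T.t ⊠₁ T.t ≫ A.p}
    (hv : ∀ {G H : M} (X : G ⟶ A.obj) (Y : H ⟶ A.obj),
      vF v X Y = psiF T.opm.ψ (X ≫ T.t) Y ≫ A.ten₂ (muF T.μ X) (𝟙 _))
    (X : G ⟶ A.obj) (Y : H ⟶ A.obj) (Z : K ⟶ A.obj) :
    vF v (A.ten (X ≫ T.t) Y) Z ≫ A.ten₂ (vF v X Y) (𝟙 _) ≫
        A.αF (X ≫ T.t) (Y ≫ T.t) (Z ≫ T.t) =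
      A.ten₂ (vF v X Y) (𝟙 Z) ▷ T.t ≫ A.αF (X ≫ T.t) (Y ≫ T.t) Z ▷ T.t ≫
        (pullAssoc _ _ T.t).hom ≫ pull₂ _ (vF v X (A.ten (Y ≫ T.t) Z)) ≫
        pull₂ _ (A.ten₂ (𝟙 _) (vF v Y Z)) := by
  have e : pull₂ (aHom G H K) (vF v X (A.ten (Y ≫ T.t) Z)) ≫
      pull₂ _ (A.ten₂ (𝟙 _) (vF v Y Z)) = pull₂ _ (psiF T.opm.ψ (X ≫ T.t) (A.ten (Y ≫ T.t) Z)) ≫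
        pull₂ _ (A.ten₂ (𝟙 _) (psiF T.opm.ψ (Y ≫ T.t) Z)) ≫
        pull₂ _ (A.ten₂ (muF T.μ X) (A.ten₂ (muF T.μ Y) (𝟙 _))) := by
    simp only [← pull₂_comp, hv, Category.assoc, ten₂_comp, Category.id_comp, Category.comp_id]
  have h := T.isOpmonoidal.assocF (X ≫ T.t) (Y ≫ T.t) Z
  rw [e, ← reassoc_of% h, reassoc_of% @psiF_naturality, hv (A.ten (X ≫ T.t) Y) Z, ← αF_naturality]
  simp only [Category.assoc, ten₂_comp_assoc, Category.id_comp, Category.comp_id, id_whiskerRight,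
    T.mu_vF hv]

theorem warping_left_unit {v : T.t ▷ₜ A.obj ≫ A.p ≫ T.t ⟶ T.t ⊠₁ T.t ≫ A.p}
    (hv : ∀ {G H : M} (X : G ⟶ A.obj) (Y : H ⟶ A.obj),
      vF v X Y = psiF T.opm.ψ (X ≫ T.t) Y ≫ A.ten₂ (muF T.μ X) (𝟙 _))
    (Y : G ⟶ A.obj) :
    vF v A.j Y ≫ A.ten₂ T.opm.ψ₀ (𝟙 _) ≫ A.lamF (Y ≫ T.t) =
      A.ten₂ T.opm.ψ₀ (𝟙 Y) ▷ T.t ≫ A.lamF Y ▷ T.t ≫ (pullAssoc _ _ T.t).hom := by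
  rw [← T.isOpmonoidal.left_unitF, reassoc_of% @psiF_naturality, hv]
  simp only [Category.assoc, ten₂_comp_assoc, Category.id_comp, Category.comp_id, id_whiskerRight,
    T.μ_isOpmonoidal.mu_unitF]

/-- The right counit condition at TX leaves ρ_{TX} μ_X Tη_X, and μTη = 1. -/
theorem warping_right_unit {v : T.t ▷ₜ A.obj ≫ A.p ≫ T.t ⟶ T.t ⊠₁ T.t ≫ A.p}
    (hv : ∀ {G H : M} (X : G ⟶ A.obj) (Y : H ⟶ A.obj),
      vF v X Y = psiF T.opm.ψ (X ≫ T.t) Y ≫ A.ten₂ (muF T.μ X) (𝟙 _))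
    {κ : 𝟙 A.obj ⟶ rHom A.obj ≫ T.t ⊠₁ A.j ≫ A.p}
    (hκ : ∀ {G : M} (X : G ⟶ A.obj), kappaF κ X = etaF T.η X ≫ A.rhoF (X ≫ T.t))
    (X : G ⟶ A.obj) :
    kappaF κ X ▷ T.t ≫ (pullAssoc _ _ T.t).hom ≫ pull₂ _ (vF v X A.j) ≫
        pull₂ _ (A.ten₂ (𝟙 _) T.opm.ψ₀) = A.rhoF (X ≫ T.t) := by
  have e : pull₂ (rHom G) (vF v X A.j) ≫ pull₂ _ (A.ten₂ (𝟙 _) T.opm.ψ₀) =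
      pull₂ _ (psiF T.opm.ψ (X ≫ T.t) A.j) ≫ pull₂ _ (A.ten₂ (𝟙 _) T.opm.ψ₀) ≫
        pull₂ _ (A.ten₂ (muF T.μ X) (𝟙 _)) := by
    simp only [← pull₂_comp, hv, Category.assoc, ten₂_comp, Category.id_comp, Category.comp_id]
  have h := T.isOpmonoidal.right_unitF (X ≫ T.t)
  rw [e, hκ, comp_whiskerRight, Category.assoc, reassoc_of% h, ← rhoF_naturality,
    reassoc_of% monad_left_unitF T.left_unit X]

/-- Moving ρ past v by naturality exposes the right unit axiom of A, which gives 1 ⊗ ρ. What remains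
is opmonoidality of η together with μη_T = 1. -/
theorem warping_unit_tensor {v : T.t ▷ₜ A.obj ≫ A.p ≫ T.t ⟶ T.t ⊠₁ T.t ≫ A.p}
    (hv : ∀ {G H : M} (X : G ⟶ A.obj) (Y : H ⟶ A.obj),
      vF v X Y = psiF T.opm.ψ (X ≫ T.t) Y ≫ A.ten₂ (muF T.μ X) (𝟙 _))
    {κ : 𝟙 A.obj ⟶ rHom A.obj ≫ T.t ⊠₁ A.j ≫ A.p}
    (hκ : ∀ {G : M} (X : G ⟶ A.obj), kappaF κ X = etaF T.η X ≫ A.rhoF (X ≫ T.t))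
    (X : G ⟶ A.obj) (Y : H ⟶ A.obj) :
    kappaF κ (A.ten (X ≫ T.t) Y) ≫ pull₂ _ (A.ten₂ (vF v X Y) (𝟙 _)) ≫
        pull₂ _ (A.αF (X ≫ T.t) (Y ≫ T.t) A.j) ≫
        (A.rightIsoP (X ≫ T.t) (A.ten (Y ≫ T.t) A.j)).hom =
      A.ten₂ (𝟙 _) (kappaF κ Y) := by
  have h := T.η_isOpmonoidal.eta_tensorF (X ≫ T.t) Y
  rw [hκ, hκ, Category.assoc, ← reassoc_of% @rhoF_naturality, ← right_unitF, hv, Category.assoc,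
    reassoc_of% h, ten₂_comp, ten₂_comp, reassoc_of% monad_right_unitF T.right_unit X]
  simp

theorem warping_unit_unit {κ : 𝟙 A.obj ⟶ rHom A.obj ≫ T.t ⊠₁ A.j ≫ A.p}
    (hκ : ∀ {G : M} (X : G ⟶ A.obj), kappaF κ X = etaF T.η X ≫ A.rhoF (X ≫ T.t)):
    kappaF κ A.j ≫ pull₂ _ (A.ten₂ T.opm.ψ₀ (𝟙 _)) ≫ pull₂ _ (A.lamF A.j) ≫ (rlIso A.j).hom =
      𝟙 A.j := by
  rw [hκ, Category.assoc, ← reassoc_of% @rhoF_naturality, unit_unitF, Category.comp_id,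
    T.η_isOpmonoidal.eta_unitF]

/-- The skew left warping constructed from an opmonoidal monad. -/
def warping : SkewLeftWarping A :=
  have hv {G H : M} (X : G ⟶ A.obj) (Y : H ⟶ A.obj) := (T.ev_warpingData_v X Y).eq_evCell
  have hκ {G : M} (X : G ⟶ A.obj) := (T.ev_warpingData_κ X).eq_evCell
  .ofFamily T.warpingData (T.warping_assoc hv) (T.warping_left_unit hv)
    (T.warping_right_unit hv hκ) (T.warping_unit_tensor hv hκ) (T.warping_unit_unit hκ)
end OpmonoidalMonad
end

/-! ### From skew left warpings to opmonoidal monads. -/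

section
variable {M : Type u} [Bicategory.{w, v} M] [MonoidalBicategory M] {A : LeftSkewMonoidale M}
variable {G H K L : M}
open LeftSkewMonoidale

instance [IsIso A.rho] (X : G ⟶ A.obj) : IsIso (A.rhoF X) :=
  (ev_rho X (evi X) (evi X)).isIso

instance [IsIso A.rho] (X : G ⟶ A.obj) (Y : H ⟶ A.obj) : IsIso (A.ten₂ (𝟙 X) (A.rhoF Y)) :=
  ⟨A.ten₂ (𝟙 X) (inv (A.rhoF Y)), by simp [ten₂_comp], by simp [ten₂_comp]⟩

/-- The axioms, at generalized elements, of a skew left warping `(t, j, v, v₀, κ)` together with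
the defining equations of the unit and multiplication of the corresponding monad. -/
structure WarpingMonad {t : A.obj ⟶ A.obj} (v : t ▷ₜ A.obj ≫ A.p ≫ t ⟶ t ⊠₁ t ≫ A.p)
    (v₀ : A.j ≫ t ⟶ A.j) (κ : 𝟙 A.obj ⟶ rHom A.obj ≫ t ⊠₁ A.j ≫ A.p) (η : 𝟙 A.obj ⟶ t)
    (μ : t ≫ t ⟶ t) : Prop where
  assoc {G H K : M} (X : G ⟶ A.obj) (Y : H ⟶ A.obj) (Z : K ⟶ A.obj) :
    vF v (A.ten (X ≫ t) Y) Z ≫ A.ten₂ (vF v X Y) (𝟙 _) ≫ A.αF (X ≫ t) (Y ≫ t) (Z ≫ t) =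
      A.ten₂ (vF v X Y) (𝟙 Z) ▷ t ≫ A.αF (X ≫ t) (Y ≫ t) Z ▷ t ≫ (pullAssoc _ _ t).hom ≫
        pull₂ _ (vF v X (A.ten (Y ≫ t) Z)) ≫ pull₂ _ (A.ten₂ (𝟙 _) (vF v Y Z))
  left_unit {G : M} (Y : G ⟶ A.obj) : vF v A.j Y ≫ A.ten₂ v₀ (𝟙 _) ≫ A.lamF (Y ≫ t) =
    A.ten₂ v₀ (𝟙 Y) ▷ t ≫ A.lamF Y ▷ t ≫ (pullAssoc _ _ t).hom
  right_unit {G : M} (X : G ⟶ A.obj) : kappaF κ X ▷ t ≫ (pullAssoc _ _ t).hom ≫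
    pull₂ _ (vF v X A.j) ≫ pull₂ _ (A.ten₂ (𝟙 _) v₀) = A.rhoF (X ≫ t)
  unit_tensor {G H : M} (X : G ⟶ A.obj) (Y : H ⟶ A.obj) :
    kappaF κ (A.ten (X ≫ t) Y) ≫ pull₂ _ (A.ten₂ (vF v X Y) (𝟙 _)) ≫
        pull₂ _ (A.αF (X ≫ t) (Y ≫ t) A.j) ≫ (A.rightIsoP (X ≫ t) (A.ten (Y ≫ t) A.j)).hom =
      A.ten₂ (𝟙 _) (kappaF κ Y)
  unit_unit : kappaF κ A.j ≫ pull₂ _ (A.ten₂ v₀ (𝟙 _)) ≫ pull₂ _ (A.lamF A.j) ≫ (rlIso A.j).hom =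
    𝟙 A.j
  eta_rho {G : M} (X : G ⟶ A.obj) : etaF η X ≫ A.rhoF (X ≫ t) = kappaF κ X
  mu_rho {G : M} (X : G ⟶ A.obj) : muF μ X ≫ A.rhoF (X ≫ t) =
    A.rhoF (X ≫ t) ▷ t ≫ (pullAssoc _ _ t).hom ≫ pull₂ _ (vF v X A.j) ≫ pull₂ _ (A.ten₂ (𝟙 _) v₀)

namespace WarpingMonad
variable {t : A.obj ⟶ A.obj} {v : t ▷ₜ A.obj ≫ A.p ≫ t ⟶ t ⊠₁ t ≫ A.p}
  {v₀ : A.j ≫ t ⟶ A.j} {κ : 𝟙 A.obj ⟶ rHom A.obj ≫ t ⊠₁ A.j ≫ A.p} {η : 𝟙 A.obj ⟶ t}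
  {μ : t ≫ t ⟶ t}

/-- Axiom 1 with Y = J, followed by 1 ⊗ λ(v₀ ⊗ 1). Axiom 2 then eliminates v_{J,Z}, so that only v
with first argument X or TX ⊗ J remains. -/
theorem assoc_lam (W : WarpingMonad v v₀ κ η μ) (X : G ⟶ A.obj) (Z : K ⟶ A.obj) :
    vF v (A.ten (X ≫ t) A.j) Z ≫ A.ten₂ (vF v X A.j) (𝟙 _) ≫ A.ten₂ (A.ten₂ (𝟙 _) v₀) (𝟙 _) ≫
        A.αF (X ≫ t) A.j (Z ≫ t) ≫ pull₂ _ (A.ten₂ (𝟙 _) (A.lamF (Z ≫ t))) =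
      A.ten₂ (vF v X A.j) (𝟙 Z) ▷ t ≫ A.ten₂ (A.ten₂ (𝟙 _) v₀) (𝟙 _) ▷ t ≫
        A.αF (X ≫ t) A.j Z ▷ t ≫ pull₂ _ (A.ten₂ (𝟙 _) (A.lamF Z)) ▷ t ≫ (pullAssoc _ _ t).hom ≫
        pull₂ _ (vF v X (pull _ Z)) ≫ pull₂ _ (A.ten₂ (𝟙 _) (pullAssoc _ _ t).hom) := by
  have h₁ := W.assoc X A.j Z
  have h₂ : pull₂ (aHom G (unitObj M) K) (vF v X (A.ten (A.j ≫ t) Z)) ≫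
        pull₂ _ (A.ten₂ (𝟙 _) (vF v A.j Z)) ≫
        pull₂ _ (A.ten₂ (𝟙 _) (A.ten₂ v₀ (𝟙 _)) ≫ A.ten₂ (𝟙 _) (A.lamF (Z ≫ t))) =
      pull₂ _ (A.ten₂ (𝟙 (X ≫ t)) (A.ten₂ v₀ (𝟙 Z) ≫ A.lamF Z) ▷ t) ≫
        pull₂ _ (vF v X (pull _ Z)) ≫ pull₂ _ (A.ten₂ (𝟙 _) (pullAssoc _ _ t).hom) := by
    have h := vF_naturality v (𝟙 X) (A.ten₂ v₀ (𝟙 Z) ≫ A.lamF Z)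
    rw [id_whiskerRight] at h
    simp only [← pull₂_comp, reassoc_of% h, ten₂_comp, Category.comp_id, W.left_unit,
      comp_whiskerRight, Category.assoc]
  rw [reassoc_of% @αF_naturality, ← pull₂_comp, reassoc_of% h₁, h₂, ← pullAssoc_naturality_assoc]
  have h₃ := congrArg (· ▷ t) ((reassoc_of% A.αF_naturality (𝟙 (X ≫ t)) v₀ (𝟙 Z))
    (pull₂ _ (A.ten₂ (𝟙 (X ≫ t)) (A.lamF Z))))
  simp only [comp_whiskerRight, ← pull₂_comp, ten₂_comp, Category.comp_id] at h₃
  rw [← reassoc_of% h₃]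

/-- Naturality of ρ turns axiom 5 into λ_J ρ_J v₀ η_J = 1, and λ_J ρ_J = 1 in A. -/
theorem eta_v₀ (W : WarpingMonad v v₀ κ η μ) : etaF η A.j ≫ v₀ = 𝟙 _ := by
  have h := W.unit_unit
  rwa [← W.eta_rho, Category.assoc, ← reassoc_of% @rhoF_naturality, unit_unitF,
    Category.comp_id] at h

variable [IsIso A.rho]

/-- Composed with ρ_{TX}, the claim is axiom 3, since ρη = κ. -/
theorem eta_mu (W : WarpingMonad v v₀ κ η μ) (X : G ⟶ A.obj) : etaF η X ▷ t ≫ muF μ X = 𝟙 _ := by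
  rw [← cancel_mono (A.rhoF (X ≫ t)), Category.assoc, W.mu_rho, ← comp_whiskerRight_assoc,
    W.eta_rho, W.right_unit, Category.id_comp]

/-- The middle unit axiom of A writes μ_X ⊗ 1 as (1 ⊗ λ) α (ρμ_X ⊗ 1), and ρμ_X is given by v_{X,J}.
So the claim reduces to associativity with J in the middle, which is `assoc_lam`. -/
theorem mu_v (W : WarpingMonad v v₀ κ η μ) (X : G ⟶ A.obj) (Z : K ⟶ A.obj) :
    A.ten₂ (muF μ X) (𝟙 Z) ▷ t ≫ vF v X Z = vF v (X ≫ t) Z ≫ A.ten₂ (muF μ X) (𝟙 _) := by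
  have hm {Y : K ⟶ A.obj} : A.ten₂ (muF μ X) (𝟙 Y) =
      A.ten₂ (A.rhoF (X ≫ t) ▷ t) (𝟙 Y) ≫ A.ten₂ (pullAssoc _ _ t).hom (𝟙 _) ≫
        (A.pullTenP _ _ Y).hom ≫ pull₂ _ (A.ten₂ (vF v X A.j) (𝟙 _)) ≫
        pull₂ _ (A.ten₂ (A.ten₂ (𝟙 _) v₀) (𝟙 _)) ≫ pull₂ _ (A.αF (X ≫ t) A.j Y) ≫
        pull₂ _ (pull₂ _ (A.ten₂ (𝟙 _) (A.lamF Y))) ≫ (A.midIsoP (X ≫ t) Y).hom := by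
    have h := A.middle_unitF (X ≫ t) Y
    rw [← Category.comp_id (A.ten₂ (muF μ X) (𝟙 Y)), ← h, ten₂_comp_assoc, W.mu_rho,
      ← reassoc_of% @pullTenP_naturality, ← reassoc_of% @pullTenP_naturality]
    simp only [ten₂_comp_assoc, Category.comp_id]
  have h := vF_naturality v (A.rhoF (X ≫ t)) (𝟙 Z)
  have h' := congrArg (pull₂ (rHom G ▷ₜ K)) (W.assoc_lam X Z)
  simp only [pull₂_comp] at h'
  rw [hm, hm]
  simp only [id_whiskerRight] at h
  rw [← reassoc_of% h, reassoc_of% @vF_pullTenP, reassoc_of% h', ← pullAssoc_naturality_assoc]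
  simp only [← pullAssoc_naturality_assoc, vF_midIsoP, comp_whiskerRight, Category.assoc]

/-- Naturality of ρ and the right unit axiom of A turn axiom 4 into this equation followed by 1 ⊗
ρ_{TY}, which is invertible. -/
theorem eta_v (W : WarpingMonad v v₀ κ η μ) (X : G ⟶ A.obj) (Y : H ⟶ A.obj) :
    etaF η (A.ten (X ≫ t) Y) ≫ vF v X Y = A.ten₂ (𝟙 _) (etaF η Y) := by
  have h := W.unit_tensor X Y
  rw [← W.eta_rho, Category.assoc, ← reassoc_of% @rhoF_naturality, ← right_unitF, ← W.eta_rho] at h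
  rw [← cancel_mono (A.ten₂ (𝟙 (X ≫ t)) (A.rhoF (Y ≫ t))), Category.assoc, h, ten₂_comp,
    Category.comp_id]

/-- After composition with ρ_{TX} this is the case Y = J of `eta_v`, together with v₀ η_J = 1. -/
theorem eta_mu_right (W : WarpingMonad v v₀ κ η μ) (X : G ⟶ A.obj) :
    etaF η (X ≫ t) ≫ muF μ X = 𝟙 _ := by
  rw [← cancel_mono (A.rhoF (X ≫ t)), Category.assoc, W.mu_rho, ← reassoc_of% @etaF_naturality,
    reassoc_of% @etaF_pull, ← reassoc_of% @pull₂_comp, W.eta_v, ← pull₂_comp, ten₂_comp, W.eta_v₀]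
  simp

/-- Insert λ_J ρ_J = 1 after v₀ μ_J. Then ρμ_J brings in v_{J,J}, which axiom 2 removes, and a
second use of λ_J ρ_J = 1, under T, leaves v₀ Tv₀. -/
theorem mu_v₀ (W : WarpingMonad v v₀ κ η μ) : muF μ A.j ≫ v₀ = v₀ ▷ t ≫ v₀ := by
  have h₁ : A.ten₂ (𝟙 (A.j ≫ t)) v₀ ≫ A.ten₂ v₀ (𝟙 _) ≫ A.lamF A.j =
      A.ten₂ v₀ (𝟙 _) ≫ A.lamF (A.j ≫ t) ≫ pull₂ _ v₀ := by
    rw [← lamF_naturality, ten₂_comp_assoc, ten₂_comp_assoc]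
    simp
  have h₂ : v₀ ≫ A.rhoF A.j = A.rhoF (A.j ≫ t) ≫ pull₂ _ (A.ten₂ v₀ (𝟙 _)) := rhoF_naturality _
  have h₃ := rlIso_hom_naturality v₀
  have h₄ := congrArg (· ▷ t) A.unit_unitF
  simp only [comp_whiskerRight, id_whiskerRight] at h₄
  have h₅ := congrArg (· ▷ t) h₂
  simp only [comp_whiskerRight] at h₅
  have h₆ : vF v A.j A.j ≫ A.ten₂ (𝟙 (A.j ≫ t)) v₀ ≫ A.ten₂ v₀ (𝟙 _) ≫ A.lamF A.j =
    A.ten₂ v₀ (𝟙 _) ▷ t ≫ A.lamF A.j ▷ t ≫ (pullAssoc _ _ t).hom ≫ pull₂ _ v₀ := by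
    rw [h₁, reassoc_of% W.left_unit A.j]
  have h₇ := congrArg (pull₂ (rHom _)) h₆
  simp only [pull₂_comp] at h₇
  have h₈ : muF μ A.j ≫ v₀ ≫ A.rhoF A.j ≫ pull₂ _ (A.lamF A.j) ≫ (rlIso A.j).hom =
      v₀ ▷ t ≫ v₀ := by
    rw [reassoc_of% h₂, reassoc_of% W.mu_rho A.j, reassoc_of% h₇, h₃, ← pullAssoc_naturality_assoc,
      ← pullAssoc_naturality_assoc, reassoc_of% @rlIso_whiskerRight, ← reassoc_of% h₅,
          reassoc_of% h₄]
  rwa [unit_unitF, Category.comp_id] at h₈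

theorem assoc_unit (W : WarpingMonad v v₀ κ η μ) (X : G ⟶ A.obj) (Y : H ⟶ A.obj) :
    vF v (A.ten (X ≫ t) Y) A.j ≫ A.ten₂ (𝟙 _) v₀ ≫ A.ten₂ (vF v X Y) (𝟙 _) ≫
        A.αF (X ≫ t) (Y ≫ t) A.j =
      A.ten₂ (vF v X Y) (𝟙 _) ▷ t ≫ A.αF (X ≫ t) (Y ≫ t) A.j ▷ t ≫ (pullAssoc _ _ t).hom ≫
        pull₂ _ (vF v X (A.ten (Y ≫ t) A.j)) ≫
        pull₂ _ (A.ten₂ (𝟙 _) (vF v Y A.j ≫ A.ten₂ (𝟙 _) v₀)) := by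
  have h₁ : A.ten₂ (𝟙 _) v₀ ≫ A.ten₂ (vF v X Y) (𝟙 _) ≫ A.αF (X ≫ t) (Y ≫ t) A.j =
      A.ten₂ (vF v X Y) (𝟙 _) ≫ A.αF (X ≫ t) (Y ≫ t) (A.j ≫ t) ≫
        pull₂ _ (A.ten₂ (𝟙 _) (A.ten₂ (𝟙 _) v₀)) := by
    rw [← αF_naturality]
    simp [ten₂_comp_assoc]
  rw [h₁, reassoc_of% W.assoc X Y A.j]
  simp only [← pull₂_comp, ten₂_comp, Category.comp_id]

/-- The 2-cell 1 ⊗ ρ_{TY} can be cancelled, and by the right unit axiom of A it is α ρ_{TX⊗TY} up to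
the right triangle. Naturality of ρ brings it to μ_{TX⊗Y}, where the equation defining μ and axiom 1
with Z = J apply. -/
theorem v_mu (W : WarpingMonad v v₀ κ η μ) (X : G ⟶ A.obj) (Y : H ⟶ A.obj) :
    muF μ (A.ten (X ≫ t) Y) ≫ vF v X Y =
      vF v X Y ▷ t ≫ vF v X (Y ≫ t) ≫ A.ten₂ (𝟙 _) (muF μ Y) := by
  have h₁ := congrArg (pull₂ (rHom (G ⊠ H))) (W.assoc_unit X Y)
  simp only [pull₂_comp] at h₁
  have h₂ := rhoF_naturality (vF v X Y)
  have h₃ := congrArg (· ▷ t) (A.right_unitF (X ≫ t) (Y ≫ t))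
  have h₄ := vF_naturality v (𝟙 X) (A.rhoF (Y ≫ t))
  simp only [comp_whiskerRight, id_whiskerRight] at h₃ h₄
  have h₅ := congrArg (· ▷ t) h₂
  simp only [comp_whiskerRight] at h₅
  rw [← cancel_mono (A.ten₂ (𝟙 (X ≫ t)) (A.rhoF (Y ≫ t)))]
  simp only [Category.assoc]
  rw [ten₂_comp, W.mu_rho, right_unitF, reassoc_of% h₂, reassoc_of% W.mu_rho, reassoc_of% h₁]
  simp only [← pullAssoc_naturality_assoc]
  rw [← reassoc_of% h₅, rightIsoP_naturality, reassoc_of% @vF_rightIsoP, ← reassoc_of% h₃,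
    reassoc_of% h₄]
  simp only [ten₂_comp, Category.comp_id, pull₂_comp]

/-- After cancelling ρ_{TX}, both sides are expressed by v_{X,J}. They agree by `v_mu` at Y = J and
v₀μ_J = v₀Tv₀, which is `h`. -/
theorem mu_assoc (W : WarpingMonad v v₀ κ η μ) (X : G ⟶ A.obj) :
    muF μ X ▷ t ≫ muF μ X = muF μ (X ≫ t) ≫ muF μ X := by
  have h : muF μ (A.ten (X ≫ t) A.j) ≫ vF v X A.j ≫ A.ten₂ (𝟙 _) v₀ =
      vF v X A.j ▷ t ≫ A.ten₂ (𝟙 _) v₀ ▷ t ≫ vF v X A.j ≫ A.ten₂ (𝟙 _) v₀ := by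
    have := vF_naturality v (𝟙 X) v₀
    rw [id_whiskerRight] at this
    rw [reassoc_of% W.v_mu X A.j, ten₂_comp, W.mu_v₀, reassoc_of% this, ten₂_comp]
  rw [← cancel_mono (A.rhoF (X ≫ t)), Category.assoc, Category.assoc, W.mu_rho,
    ← comp_whiskerRight_assoc, W.mu_rho, ← reassoc_of% @muF_naturality, reassoc_of% @muF_pull]
  simp only [← pull₂_comp, h]
  simp only [comp_whiskerRight, Category.assoc, pull₂_comp, pullAssoc_naturality_assoc]

/-- By `mu_v` and μη_T = 1, the given v is (μ ⊗ 1)ψ for the ψ constructed from it. This is one round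
trip of the bijection, and is also used for `psi_mu`. -/
theorem v_eq (W : WarpingMonad v v₀ κ η μ) (X : G ⟶ A.obj) (Y : H ⟶ A.obj) :
    vF v X Y = (A.ten₂ (etaF η (X ≫ t)) (𝟙 Y) ▷ t ≫ vF v (X ≫ t) Y) ≫
      A.ten₂ (muF μ X) (𝟙 _) := by
  rw [Category.assoc, ← W.mu_v, ← comp_whiskerRight_assoc, ten₂_comp, W.eta_mu_right]
  simp

theorem psi_eta (W : WarpingMonad v v₀ κ η μ) (X : G ⟶ A.obj) (Y : H ⟶ A.obj) :
    etaF η (A.ten X Y) ≫ A.ten₂ (etaF η X) (𝟙 _) ▷ t ≫ vF v X Y =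
      A.ten₂ (etaF η X) (etaF η Y) := by
  rw [← reassoc_of% @etaF_naturality, W.eta_v, ten₂_comp]
  simp

/-- Splitting μ_X ⊗ μ_Y into its two factors, `v_eq` absorbs μ_X ⊗ 1 and `v_mu` absorbs 1 ⊗ μ_Y. -/
theorem psi_mu (W : WarpingMonad v v₀ κ η μ) (X : G ⟶ A.obj) (Y : H ⟶ A.obj) :
    (A.ten₂ (etaF η X) (𝟙 _) ▷ t ≫ vF v X Y) ▷ t ≫
        (A.ten₂ (etaF η (X ≫ t)) (𝟙 _) ▷ t ≫ vF v (X ≫ t) (Y ≫ t)) ≫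
        A.ten₂ (muF μ X) (muF μ Y) =
      muF μ (A.ten X Y) ≫ A.ten₂ (etaF η X) (𝟙 _) ▷ t ≫ vF v X Y := by
  have h : A.ten₂ (muF μ X) (muF μ Y) = A.ten₂ (muF μ X) (𝟙 _) ≫ A.ten₂ (𝟙 _) (muF μ Y) := by
    simp [ten₂_comp]
  rw [h, ← Category.assoc _ (A.ten₂ _ _), ← W.v_eq, ← reassoc_of% @muF_naturality, W.v_mu,
    comp_whiskerRight_assoc]

theorem psi_right_unit (W : WarpingMonad v v₀ κ η μ) (X : G ⟶ A.obj) :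
    A.rhoF X ▷ t ≫ (pullAssoc _ _ t).hom ≫ pull₂ _ (A.ten₂ (etaF η X) (𝟙 _) ▷ t ≫ vF v X A.j) ≫
      pull₂ _ (A.ten₂ (𝟙 _) v₀) = A.rhoF (X ≫ t) := by
  rw [reassoc_of% @pull₂_comp, ← pullAssoc_naturality_assoc, ← comp_whiskerRight_assoc,
    ← rhoF_naturality, comp_whiskerRight_assoc, ← W.mu_rho, reassoc_of% W.eta_mu X]

theorem psi_left_unit (W : WarpingMonad v v₀ κ η μ) (Y : G ⟶ A.obj) :
    (A.ten₂ (etaF η A.j) (𝟙 _) ▷ t ≫ vF v A.j Y) ≫ A.ten₂ v₀ (𝟙 _) ≫ A.lamF (Y ≫ t) =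
      A.lamF Y ▷ t ≫ (pullAssoc _ _ t).hom := by
  rw [Category.assoc, W.left_unit, ← comp_whiskerRight_assoc, ten₂_comp, W.eta_v₀]
  simp

/-- Axiom 1 precomposed with units. By `psi_eta` everything before α on the left collapses to T((η_X
⊗ η_Y) ⊗ 1), which passes through α by naturality and splits into the units needed for the two
copies of ψ on the right. -/
theorem psi_assoc (W : WarpingMonad v v₀ κ η μ) (X : G ⟶ A.obj) (Y : H ⟶ A.obj) (Z : K ⟶ A.obj) :
    (A.ten₂ (etaF η (A.ten X Y)) (𝟙 _) ▷ t ≫ vF v (A.ten X Y) Z) ≫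
        A.ten₂ (A.ten₂ (etaF η X) (𝟙 _) ▷ t ≫ vF v X Y) (𝟙 _) ≫
        A.αF (X ≫ t) (Y ≫ t) (Z ≫ t) =
      A.αF X Y Z ▷ t ≫ (pullAssoc _ _ t).hom ≫
        pull₂ _ (A.ten₂ (etaF η X) (𝟙 _) ▷ t ≫ vF v X (A.ten Y Z)) ≫
        pull₂ _ (A.ten₂ (𝟙 _) (A.ten₂ (etaF η Y) (𝟙 _) ▷ t ≫ vF v Y Z)) := by
  have h₁ := W.assoc X Y Z
  have h₂ := vF_naturality v (A.ten₂ (etaF η X) (𝟙 Y)) (𝟙 Z)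
  have h₃ := vF_naturality v (𝟙 X) (A.ten₂ (etaF η Y) (𝟙 Z))
  have h₄ := congrArg (· ▷ t) (A.αF_naturality (etaF η X) (etaF η Y) (𝟙 Z))
  simp only [comp_whiskerRight, id_whiskerRight] at h₂ h₃ h₄
  have h₅ : A.ten₂ (A.ten₂ (etaF η X) (𝟙 Y) ▷ t ≫ vF v X Y) (𝟙 (Z ≫ t)) =
      A.ten₂ (A.ten₂ (etaF η X) (𝟙 Y) ▷ t) (𝟙 _) ≫ A.ten₂ (vF v X Y) (𝟙 _) := by
    simp [ten₂_comp]
  rw [h₅]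
  simp only [Category.assoc]
  rw [← reassoc_of% h₂, h₁]
  have h₆ : A.ten₂ (etaF η (A.ten X Y)) (𝟙 Z) ▷ t ≫ A.ten₂ (A.ten₂ (etaF η X) (𝟙 Y) ▷ t) (𝟙 Z) ▷ t ≫
      A.ten₂ (vF v X Y) (𝟙 Z) ▷ t = A.ten₂ (A.ten₂ (etaF η X) (etaF η Y)) (𝟙 Z) ▷ t := by
    rw [← comp_whiskerRight, ← comp_whiskerRight, ten₂_comp, ten₂_comp, W.psi_eta]
    simp
  have h₇ : A.ten₂ (etaF η X) (A.ten₂ (etaF η Y) (𝟙 Z)) ▷ t ≫ vF v X (A.ten (Y ≫ t) Z) ≫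
      A.ten₂ (𝟙 _) (vF v Y Z) = (A.ten₂ (etaF η X) (𝟙 _) ▷ t ≫ vF v X (A.ten Y Z)) ≫
        A.ten₂ (𝟙 _) (A.ten₂ (etaF η Y) (𝟙 _) ▷ t ≫ vF v Y Z) := by
    have h : A.ten₂ (etaF η X) (A.ten₂ (etaF η Y) (𝟙 Z)) =
        A.ten₂ (etaF η X) (𝟙 _) ≫ A.ten₂ (𝟙 _) (A.ten₂ (etaF η Y) (𝟙 Z)) := by simp [ten₂_comp]
    rw [h, comp_whiskerRight_assoc, reassoc_of% h₃, ten₂_comp, Category.assoc, Category.comp_id]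
  rw [reassoc_of% h₆, reassoc_of% h₄, pullAssoc_naturality_assoc, ← pull₂_comp, ← pull₂_comp, h₇,
    pull₂_comp]
end WarpingMonad
end

/-! ### The two constructions are mutually inverse. -/

section
variable {M : Type u} [Bicategory.{w, v} M] [MonoidalBicategory M] {A : LeftSkewMonoidale M}
variable {G H K L : M}
open LeftSkewMonoidale

/-- Apart from the whiskered ρ, every factor of `normalCell` is a coherence isomorphism. This is
where right normality makes the definitions of η and μ possible. -/
instance isIso_normalCell [IsIso A.rho] (t : A.obj ⟶ A.obj) : IsIso (normalCell t) := by
  unfold normalCell bicategoricalComp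
  infer_instance

section
variable {t : A.obj ⟶ A.obj}

theorem eta_ext {η η' : 𝟙 A.obj ⟶ t} (h : etaF η (𝟙 A.obj) = etaF η' (𝟙 A.obj)) : η = η' :=
  Ev.injective (ev_eta η (𝟙 A.obj) (evi _)) (ev_eta η' (𝟙 A.obj) (evi _)) h

theorem mu_ext {μ μ' : t ≫ t ⟶ t} (h : muF μ (𝟙 A.obj) = muF μ' (𝟙 A.obj)) : μ = μ' :=
  Ev.injective (ev_mu μ (𝟙 A.obj)) (ev_mu μ' (𝟙 A.obj)) h

theorem psi_ext {ψ ψ' : A.p ≫ t ⟶ t ⊠₁ t ≫ A.p}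
    (h : psiF ψ (𝟙 A.obj) (𝟙 A.obj) = psiF ψ' (𝟙 A.obj) (𝟙 A.obj)) : ψ = ψ' :=
  Ev.injective (ev_psi ψ (𝟙 A.obj) (𝟙 A.obj)) (ev_psi ψ' (𝟙 A.obj) (𝟙 A.obj)) h

theorem v_ext {v v' : t ▷ₜ A.obj ≫ A.p ≫ t ⟶ t ⊠₁ t ≫ A.p}
    (h : vF v (𝟙 A.obj) (𝟙 A.obj) = vF v' (𝟙 A.obj) (𝟙 A.obj)) : v = v' :=
  Ev.injective (ev_v v (𝟙 A.obj) (𝟙 A.obj) (evi _)) (ev_v v' (𝟙 A.obj) (𝟙 A.obj) (evi _)) h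

theorem kappa_ext {k : unitObj M ⟶ A.obj} {κ κ' : 𝟙 A.obj ⟶ rHom A.obj ≫ t ⊠₁ k ≫ A.p}
    (h : kappaF κ (𝟙 A.obj) = kappaF κ' (𝟙 A.obj)) : κ = κ' :=
  Ev.injective (ev_kappa κ (𝟙 A.obj) (evi _)) (ev_kappa κ' (𝟙 A.obj) (evi _)) h

theorem psiF_opmonoidalCell (η : 𝟙 A.obj ⟶ t) (v : t ▷ₜ A.obj ≫ A.p ≫ t ⟶ t ⊠₁ t ≫ A.p)
    (X : G ⟶ A.obj) (Y : H ⟶ A.obj) :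
    psiF (opmonoidalCell η v) X Y = A.ten₂ (etaF η X) (𝟙 Y) ▷ t ≫ vF v X Y :=
  (ev_opmonoidalCell η v X Y).eq_evCell

theorem etaF_comp_inv [IsIso A.rho] (κ : 𝟙 A.obj ⟶ rHom A.obj ≫ t ⊠₁ A.j ≫ A.p)
    (X : G ⟶ A.obj) :
    etaF (κ ≫ inv (normalCell t)) X = kappaF κ X ≫ inv (A.rhoF (X ≫ t)) := by
  have := (ev_normalCell t X).inv
  exact (Ev.next this (E := ev_kappa κ X (evi _))).eq_evCell

theorem muF_comp_inv [IsIso A.rho] (m : t ≫ t ⟶ rHom A.obj ≫ t ⊠₁ A.j ≫ A.p) (X : G ⟶ A.obj)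
    {τ} (h : Ev (evc (evAtom X t) (evAtom _ t)) m
      (evc (evr X) (evc (pre _ (evt (evAtom X t) (evid A.j))) (pre _ (evAtom _ A.p)))) τ) :
    muF (m ≫ inv (normalCell t)) X = τ ≫ inv (A.rhoF (X ≫ t)) := by
  have := (ev_normalCell t X).inv
  exact (Ev.next this (E := h)).eq_evCell
end

namespace WarpingMonad
variable {t : A.obj ⟶ A.obj} {v : t ▷ₜ A.obj ≫ A.p ≫ t ⟶ t ⊠₁ t ≫ A.p}
  {v₀ : A.j ≫ t ⟶ A.j} {κ : 𝟙 A.obj ⟶ rHom A.obj ≫ t ⊠₁ A.j ≫ A.p} {η η' : 𝟙 A.obj ⟶ t}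
  {μ μ' : t ≫ t ⟶ t} [IsIso A.rho]

theorem unique (W : WarpingMonad v v₀ κ η μ) (W' : WarpingMonad v v₀ κ η' μ') :
    η = η' ∧ μ = μ' := by
  constructor
  · apply eta_ext
    rw [← cancel_mono (A.rhoF (𝟙 _ ≫ t)), W.eta_rho, W'.eta_rho]
  · apply mu_ext
    rw [← cancel_mono (A.rhoF (𝟙 _ ≫ t)), W.mu_rho, W'.mu_rho]

/-- The opmonoidal monad constructed from a skew left warping. -/
def toOpmonoidalMonad (W : WarpingMonad v v₀ κ η μ) : OpmonoidalMonad A where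
  t := t
  opm := ⟨opmonoidalCell η v, v₀⟩
  η := η
  μ := μ
  assoc := monad_assoc_of_family W.mu_assoc
  left_unit := monad_left_unit_of_family W.eta_mu
  right_unit := monad_right_unit_of_family W.eta_mu_right
  isOpmonoidal := by
    apply IsOpmonoidal.of_family
    · intros; simpa only [psiF_opmonoidalCell] using W.psi_assoc _ _ _
    · intros; simpa only [psiF_opmonoidalCell] using W.psi_left_unit _
    · intros; simpa only [psiF_opmonoidalCell] using W.psi_right_unit _
  η_isOpmonoidal := by
    apply IsOpmonoidal₂.eta_of_family
    · intros; simpa only [psiF_opmonoidalCell] using W.psi_eta _ _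
    · exact W.eta_v₀
  μ_isOpmonoidal := by
    apply IsOpmonoidal₂.mu_of_family
    · intros; simpa only [psiF_opmonoidalCell] using W.psi_mu _ _
    · exact W.mu_v₀

/-- The component v is recovered by `v_eq` and κ by the equation defining η; the other components
agree by construction. -/
theorem warpingData_toOpmonoidalMonad (W : WarpingMonad v v₀ κ η μ) :
    W.toOpmonoidalMonad.warpingData = ⟨t, A.j, v, v₀, κ⟩ := by
  have hv : W.toOpmonoidalMonad.warpingData.v = v := by
    refine v_ext ((W.toOpmonoidalMonad.ev_warpingData_v (𝟙 _) (𝟙 _)).eq_evCell.trans ?_)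
    exact (congrArg (· ≫ _) (psiF_opmonoidalCell η v _ _)).trans (W.v_eq _ _).symm
  have hκ : W.toOpmonoidalMonad.warpingData.κ = κ :=
    kappa_ext ((W.toOpmonoidalMonad.ev_warpingData_κ (𝟙 _)).eq_evCell.trans (W.eta_rho _))
  exact congr (congrArg (fun v κ => SkewLeftWarpingData.mk t A.j v v₀ κ) hv) hκ

/-- A skew left warping with `k = j` determines the unit and multiplication of a monad. -/
theorem of_warping (W : SkewLeftWarping A) (hW : W.toSkewLeftWarpingData = ⟨t, A.j, v, v₀, κ⟩) :
    WarpingMonad v v₀ κ (κ ≫ inv (normalCell t)) (multCell v v₀ ≫ inv (normalCell t)) := by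
  obtain ⟨W, h₁, h₂, h₃, h₄, h₅⟩ := W
  subst hW
  let W' : SkewLeftWarping A := ⟨⟨t, A.j, v, v₀, κ⟩, h₁, h₂, h₃, h₄, h₅⟩
  exact {
    assoc := W'.assocF
    left_unit := W'.left_unitF
    right_unit := W'.right_unitF
    unit_tensor := W'.unit_tensorF
    unit_unit := W'.unit_unitF
    eta_rho := fun X => by rw [etaF_comp_inv]; simp
    mu_rho := fun X => by rw [muF_comp_inv _ _ (ev_multCell v v₀ X)]; simp }
end WarpingMonad

namespace OpmonoidalMonad
variable (T : OpmonoidalMonad A)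

/-- The right counit condition at TX and naturality of ρ show that the multiplication of any
opmonoidal monad satisfies the equation by which a warping defines μ. -/
theorem mu_rhoF {v : T.t ▷ₜ A.obj ≫ A.p ≫ T.t ⟶ T.t ⊠₁ T.t ≫ A.p}
    (hv : ∀ {G H : M} (X : G ⟶ A.obj) (Y : H ⟶ A.obj),
      vF v X Y = psiF T.opm.ψ (X ≫ T.t) Y ≫ A.ten₂ (muF T.μ X) (𝟙 _))
    (X : G ⟶ A.obj) : muF T.μ X ≫ A.rhoF (X ≫ T.t) =
      A.rhoF (X ≫ T.t) ▷ T.t ≫ (pullAssoc _ _ T.t).hom ≫ pull₂ _ (vF v X A.j) ≫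
        pull₂ _ (A.ten₂ (𝟙 _) T.opm.ψ₀) := by
  have e : pull₂ (rHom G) (vF v X A.j) ≫ pull₂ _ (A.ten₂ (𝟙 _) T.opm.ψ₀) =
      pull₂ _ (psiF T.opm.ψ (X ≫ T.t) A.j) ≫ pull₂ _ (A.ten₂ (𝟙 _) T.opm.ψ₀) ≫
        pull₂ _ (A.ten₂ (muF T.μ X) (𝟙 _)) := by
    simp only [← pull₂_comp, hv, Category.assoc, ten₂_comp, Category.id_comp, Category.comp_id]
  have h := T.isOpmonoidal.right_unitF (X ≫ T.t)
  rw [e, reassoc_of% h, rhoF_naturality]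

theorem warpingMonad : WarpingMonad T.warpingData.v T.opm.ψ₀ T.warpingData.κ T.η T.μ where
  assoc := T.warping.assocF
  left_unit := T.warping.left_unitF
  right_unit := T.warping.right_unitF
  unit_tensor := T.warping.unit_tensorF
  unit_unit := T.warping.unit_unitF
  eta_rho X := (T.ev_warpingData_κ X).eq_evCell.symm
  mu_rho := T.mu_rhoF fun X Y => (T.ev_warpingData_v X Y).eq_evCell

/-- Indeed v_{X,Y} T(η_X ⊗ 1) = (μ_X ⊗ 1) ψ_{TX,Y} T(η_X ⊗ 1) = (μ_X Tη_X ⊗ 1) ψ_{X,Y}, and μTη = 1.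
-/
theorem opm_ψ : T.opm.ψ = opmonoidalCell T.η T.warpingData.v := by
  apply psi_ext
  refine .trans ?_ (psiF_opmonoidalCell T.η T.warpingData.v _ _).symm
  refine .trans ?_ (congrArg (fun x => A.ten₂ (etaF T.η _) (𝟙 _) ▷ T.t ≫ x)
    (T.ev_warpingData_v (𝟙 _) (𝟙 _)).eq_evCell.symm)
  rw [reassoc_of% @psiF_naturality, ten₂_comp, monad_left_unitF T.left_unit]
  simp

theorem ext_warpingData [IsIso A.rho] {T T' : OpmonoidalMonad A}
    (h : T.warpingData = T'.warpingData) : T = T' := by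
  have W := T.warpingMonad
  have W' := T'.warpingMonad
  have hψ := T.opm_ψ
  have hψ' := T'.opm_ψ
  obtain ⟨t, ⟨ψ, ψ₀⟩, η, μ, _, _, _, _, _, _⟩ := T
  obtain ⟨t', ⟨ψ', ψ₀'⟩, η', μ', _, _, _, _, _, _⟩ := T'
  obtain rfl : t = t' := congrArg SkewLeftWarpingData.t h
  simp only [warpingData, SkewLeftWarpingData.mk.injEq, heq_eq_eq, true_and] at h hψ hψ' W W'
  obtain ⟨hv, rfl, hκ⟩ := h
  -- Both monads now belong to the same v, v₀ and κ, so cancelling ρ identifies their units and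
  -- multiplications; `opm_ψ` then identifies ψ.
  rw [← hv, ← hκ] at W'
  obtain ⟨rfl, rfl⟩ := W.unique W'
  rw [← hv] at hψ'
  obtain rfl := hψ.trans hψ'.symm
  rfl
end OpmonoidalMonad

theorem SkewLeftWarping.ext_data {W W' : SkewLeftWarping A}
    (h : W.toSkewLeftWarpingData = W'.toSkewLeftWarpingData) : W = W' := by
  obtain ⟨W, _, _, _, _, _⟩ := W
  obtain ⟨W', _, _, _, _, _⟩ := W'
  obtain rfl : W = W' := h
  rfl
end
end SkewWarp
open SkewWarp in

theorem mainTheorem5 {M : Type u} [Bicategory.{w, v} M] [MonoidalBicategory M]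
    (A : LeftSkewMonoidale M) (hA : A.RightNormal) :
    ∃ e : OpmonoidalMonad A ≃ {W : SkewLeftWarping A // W.k = A.j},
      ∀ T : OpmonoidalMonad A, (e T).val.toSkewLeftWarpingData = T.warpingData := by
  have : IsIso A.rho := hA
  refine ⟨Equiv.ofBijective (fun T => ⟨T.warping, rfl⟩) ⟨fun T T' h => ?_, fun ⟨W, hW⟩ => ?_⟩,
    fun T => rfl⟩
  · exact OpmonoidalMonad.ext_warpingData
      (congrArg (fun W => W.val.toSkewLeftWarpingData) h)
  · obtain ⟨⟨t, k, v, v₀, κ⟩, h₁, h₂, h₃, h₄, h₅⟩ := W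
    obtain rfl : k = A.j := hW
    have W' := WarpingMonad.of_warping ⟨⟨t, A.j, v, v₀, κ⟩, h₁, h₂, h₃, h₄, h₅⟩ rfl
    exact ⟨W'.toOpmonoidalMonad, Subtype.ext (SkewLeftWarping.ext_data
      W'.warpingData_toOpmonoidalMonad)⟩
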